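/- Let $f(z,w)\in\mathbb C[z,w]$ be squarefree, not divisible by $z$, with $f(0,0)=0$, and let $n$ be the multiplicity of $w=0$ as a root of $f(0,w)$. Let $E_n=\mathbb C^n/S_n$ be the space of unordered $n$-tuples of complex numbers, $\Delta\subset E_n$ the set of tuples with a repeated entry, and $B_n=\pi_1(E_n\setminus\Delta,\{1,\dots,n\})$ the braid group, with standard generators $\sigma_1,\dots,\sigma_{n-1}$ ($\sigma_i$ is the counterclockwise half turn that exchanges $i$ and $i+1$). A braid is positive if it is a product of standard generators without inverses, and strictly positive if it has such an expression in which each of $\sigma_1,\dots,\sigma_{n-1}$ occurs. The closed braid given by a loop $\ell$ in $E_n\setminus\Delta$ is the closure of $\beta\in B_n$ if $c\,\ell\,c^{-1}$ represents $\beta$ for some path $c$ in $E_n\setminus\Delta$ from $\{1,\dots,n\}$ to the base point of $\ell$. Then $n\ge 1$ and, for all sufficiently small $\delta>0$ and all $\varepsilon>0$ sufficiently small with respect to $\delta$, the following hold. 1. For $|z|\le\varepsilon$ the equation $f(z,w)=0$ has exactly $n$ roots with $|w|<\delta$, counted with multiplicity. They define a continuous $n$-valued function $F:\{|z|\le\varepsilon\}\to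 E_n$, analytic for $|z|<\varepsilon$, with $F(0)=\{0,\dots,0\}$ and $F(z)\notin\Delta$ for $z\ne0$. 2. The link of the singularity of $\{f=0\}$ at the origin, that is, the intersection of $\{f=0\}$ with the boundary of the bidisk $\{|z|\le\varepsilon,\ |w|\le\delta\}$, is the graph of $F$ over the circle $|z|=\varepsilon$. 3. For $0<r\le\varepsilon$ the roots over the circle $z=re^{i\theta}$ can be written as $F(re^{i\theta})=\{w_1(\theta),\dots,w_n(\theta)\}$ with continuous $w_i:\mathbb R\to\mathbb C$, and for $i\neq j$ the difference $w_i-w_j$ has no zero and has a differentiable argument with $$\frac{d\arg(w_i-w_j)}{d\theta}>0\quad\text{for all }\theta .$$ 4. The closed braid given by the loop $\theta\mapsto F(\varepsilon e^{i\theta})$, $0\le\theta\le2\pi$, in $E_n\setminus\Delta$ is the closure of a strictly positive (in particular positive) braid in $B_n$. 5. Each component of the link is the knot $\{(t^p,\alpha(t)):|t|^p=\varepsilon\}$ of a branch of $\{f=0\}$ at the origin, where $t\mapsto(t^p,\alpha(t))$, $p\ge1$, $\alpha(0)=0$, is a one-to-one analytic parametrization of the branch on $|t|^p\le\varepsilon$.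 For any two branches parametrized in this way whose knots are distinct, the linking number of the knots (the total winding number, over the circle $|z|=\varepsilon$, of the differences $a-b$ of points $a$ of the first and $b$ of the second knot over the same $z$) equals the intersection number of the branches at the origin (the order at $t=0$ of the equation $\prod_{s^q=z}(w-\beta(s))$ of the second branch $s\mapsto(s^q,\beta(s))$ along the first one), and it is positive. -/

import Mathlib

open Polynomial
open scoped Polynomial.Bivariate

noncomputable section

namespace BraidLink

/-! ### Unordered tuples, the discriminant locus and the configuration space -/

/-- The space `E_n` of unordered `n`-tuples of complex numbers, duplications allowed. -/
def UnorderedTuples (n : ℕ) : Type := Sym ℂ n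

/-- The underlying multiset of an unordered tuple. -/
def UnorderedTuples.toMultiset {n : ℕ} (s : UnorderedTuples n) : Multiset ℂ := s.1

/-- The quotient map `ℂⁿ → E_n = ℂⁿ / S_n`. -/
def ofTuple {n : ℕ} (v : Fin n → ℂ) : UnorderedTuples n :=
  ⟨(Finset.univ : Finset (Fin n)).val.map v, by simp⟩

/-- `E_n` carries the quotient topology of `ℂⁿ / S_n`. -/
instance (n : ℕ) : TopologicalSpace (UnorderedTuples n) :=
  TopologicalSpace.coinduced (ofTuple (n := n)) inferInstance

/-- The discriminant locus `Δ ⊆ E_n`: the unordered tuples with at least one duplication. -/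
def discriminantLocus (n : ℕ) : Set (UnorderedTuples n) := {s | ¬ s.toMultiset.Nodup}

/-- The configuration space `E_n \ Δ` of `n` distinct points in `ℂ`. -/
abbrev Conf (n : ℕ) : Type := {s : UnorderedTuples n // s ∉ discriminantLocus n}

/-- An `n`-valued function is analytic on `U` if the coefficients `c_k` of
`(w - r_1) ⋯ (w - r_n) = w ^ n + c_1 w ^ (n - 1) + ⋯ + c_n`, where `F z = {r_1, …, r_n}`,
are analytic functions of `z` on `U`. -/
def IsAnalyticMultivaluedOn {n : ℕ} (F : ℂ → UnorderedTuples n) (U : Set ℂ) : Prop :=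
  ∀ k : ℕ, AnalyticOnNhd ℂ
    (fun z => (((F z).toMultiset.map (fun r => (X - C r : ℂ[X]))).prod).coeff k) U

theorem continuous_ofTuple {n : ℕ} : Continuous (ofTuple (n := n)) :=
  continuous_coinduced_rng

theorem ofTuple_comp_perm {n : ℕ} (v : Fin n → ℂ) (e : Equiv.Perm (Fin n)) :
    ofTuple (v ∘ e) = ofTuple v := by
  apply Subtype.ext
  change Multiset.map (v ∘ e) Finset.univ.val = Multiset.map v Finset.univ.val
  rw [← Multiset.map_map, Multiset.map_univ_val_equiv e]

theorem ofTuple_notMem_discriminantLocus {n : ℕ} {v : Fin n → ℂ}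
    (hv : Function.Injective v) : ofTuple v ∉ discriminantLocus n := by
  intro h
  exact h (Finset.univ.nodup.map hv)

/-- The base point `* = {1, …, n}` of the configuration space. -/
def basePoint (n : ℕ) : Conf n :=
  ⟨ofTuple fun k => (k : ℂ) + 1, ofTuple_notMem_discriminantLocus fun a b h => by
    simpa [Fin.ext_iff] using h⟩

/-! ### The braid group, its standard generators and positivity -/

/-- The braid group on `n` strings, `B_n = π₁(E_n \ Δ, *)`. (Mathlib's product of loops `a * b`
runs through `b` first; the positivity notions below do not depend on this convention.) -/
abbrev BraidGroup (n : ℕ) : Type := FundamentalGroup (Conf n) (basePoint n)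

/-- The strings of the standard generator, at time `t`: the points `i + 1` and `i + 2` make
a counterclockwise half turn about their midpoint `i + 3 / 2`, all other points
of `{1, …, n}` stay fixed. (Indices `k`, `i` start at `0`.) -/
def halfTwist (n : ℕ) (i : Fin (n - 1)) (t : ℝ) (k : Fin n) : ℂ :=
  if (k : ℕ) = i then (i : ℂ) + 3 / 2 - Complex.exp (Real.pi * t * Complex.I) / 2
  else if (k : ℕ) = i + 1 then (i : ℂ) + 3 / 2 + Complex.exp (Real.pi * t * Complex.I) / 2
  else (k : ℂ) + 1

theorem continuous_halfTwist (n : ℕ) (i : Fin (n - 1)) : Continuous (halfTwist n i) := by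
  refine continuous_pi fun k => ?_
  unfold halfTwist
  split_ifs <;> fun_prop

theorem halfTwist_injective (n : ℕ) (i : Fin (n - 1)) (t : ℝ) :
    Function.Injective (halfTwist n i t) := by
  have key : ∀ (m : ℕ) (c : ℂ), ‖c‖ = 1 → (i : ℂ) + 3 / 2 + c / 2 = (m : ℂ) + 1 →
      m = i ∨ m = i + 1 := by
    intro m c hc h
    have h1 : c = (((2 * m - 2 * i - 1 : ℤ) : ℝ) : ℂ) := by
      push_cast
      linear_combination 2 * h
    rw [h1, Complex.norm_real, Real.norm_eq_abs, ← Int.cast_abs] at hc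
    have h2 : |(2 * m - 2 * i - 1 : ℤ)| = 1 := by exact_mod_cast hc
    rcases abs_eq (zero_le_one' ℤ) |>.1 h2 with h3 | h3 <;> omega
  have he : ‖Complex.exp (Real.pi * t * Complex.I)‖ = 1 := by
    have := Complex.norm_exp_ofReal_mul_I (Real.pi * t)
    push_cast at this
    exact this
  have he' : ‖-Complex.exp (Real.pi * t * Complex.I)‖ = 1 := by rwa [norm_neg]
  have hne : Complex.exp (Real.pi * t * Complex.I) ≠ 0 := Complex.exp_ne_zero _
  intro a b hab
  unfold halfTwist at hab
  generalize Complex.exp (Real.pi * t * Complex.I) = c at *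
  apply Fin.ext
  split_ifs at hab with h1 h2 h3 h4 h5 h6 h7 h8
  · omega
  · exact absurd (by linear_combination -hab) hne
  · rcases key b (-c) he' (by linear_combination hab) with h | h <;> omega
  · exact absurd (by linear_combination hab) hne
  · omega
  · rcases key b c he hab with h | h <;> omega
  · rcases key a (-c) he' (by linear_combination -hab) with h | h <;> omega
  · rcases key a c he hab.symm with h | h <;> omega
  · have h : (a : ℂ) = b := by linear_combination hab
    exact_mod_cast h

theorem ofTuple_halfTwist_zero (n : ℕ) (i : Fin (n - 1)) :
    ofTuple (halfTwist n i 0) = (basePoint n).1 := by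
  change ofTuple _ = ofTuple _
  congr 1
  funext k
  unfold halfTwist
  split_ifs with h1 h2
  · simp [h1]; ring
  · simp [h2]; ring
  · rfl

theorem ofTuple_halfTwist_one (n : ℕ) (i : Fin (n - 1)) :
    ofTuple (halfTwist n i 1) = (basePoint n).1 := by
  have hi := i.2
  change ofTuple _ = ofTuple _
  rw [← ofTuple_comp_perm (fun k : Fin n => (k : ℂ) + 1)
    (Equiv.swap ⟨i, by omega⟩ ⟨i + 1, by omega⟩)]
  congr 1
  funext k
  unfold halfTwist
  simp only [Function.comp_apply, Equiv.swap_apply_def, Fin.ext_iff, Complex.ofReal_one, mul_one,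
    Complex.exp_pi_mul_I]
  split_ifs with h1 h2
  · push_cast; ring
  · ring
  · rfl

/-- The loop in the configuration space that represents the standard generator. With
`z = exp (2 π I t)` it is the unordered tuple of the roots of
`(w ^ 2 - (2 j + 1) w + (j ^ 2 + j + (1 - z) / 4)) * ∏ (w - m)`, `m ≠ j, j + 1`, `j = i + 1`,
where `z` runs counterclockwise through the unit circle. -/
def generatorLoop (n : ℕ) (i : Fin (n - 1)) : Path (basePoint n) (basePoint n) where
  toFun t := ⟨ofTuple (halfTwist n i t), ofTuple_notMem_discriminantLocus
    (halfTwist_injective n i t)⟩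
  continuous_toFun := Continuous.subtype_mk
    (continuous_ofTuple.comp ((continuous_halfTwist n i).comp continuous_subtype_val)) _
  source' := Subtype.ext (ofTuple_halfTwist_zero n i)
  target' := Subtype.ext (ofTuple_halfTwist_one n i)

/-- The braid represented by a loop at the base point. -/
def braidOfLoop {n : ℕ} (l : Path (basePoint n) (basePoint n)) : BraidGroup n :=
  FundamentalGroup.fromPath (Path.Homotopic.Quotient.mk l)

/-- The standard generators `σ_1, …, σ_{n-1}` of `B_n` (indexed from `0`). -/
def sigma (n : ℕ) (i : Fin (n - 1)) : BraidGroup n := braidOfLoop (generatorLoop n i)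

/-- A braid is positive if it is a word in the standard generators without inverses. -/
def IsPositive {n : ℕ} (β : BraidGroup n) : Prop :=
  ∃ l : List (Fin (n - 1)), β = (l.map (sigma n)).prod

/-- A braid is strictly positive if it is a word in the standard generators without inverses
in which each standard generator occurs. -/
def IsStrictlyPositive {n : ℕ} (β : BraidGroup n) : Prop :=
  ∃ l : List (Fin (n - 1)), (∀ i, i ∈ l) ∧ β = (l.map (sigma n)).prod

/-- The closed braid of the loop `l` in the configuration space is the closure of the braid `β`:
for some path `c` from the standard base point to the base point of `l`, the loop
`c · l · c⁻¹` represents `β`. -/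
def IsClosureOf {n : ℕ} {p : Conf n} (l : Path p p) (β : BraidGroup n) : Prop :=
  ∃ c : Path (basePoint n) p, braidOfLoop (c.trans (l.trans c.symm)) = β

/-! ### Local curve, link of the singularity and branches -/

/-- The roots `w` of `f(z, w) = 0` with `|w| < δ`, with multiplicity. The outer variable of
`f : ℂ[X][Y]` is `w`, the inner one is `z`. -/
def localRoots (f : ℂ[X][Y]) (δ : ℝ) (z : ℂ) : Multiset ℂ :=
  open Classical in (f.map (evalRingHom z)).roots.filter (fun w => ‖w‖ < δ)

/-- The link of the singularity of `{f = 0}` at the origin, in the boundary of the bidisk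
`{|z| ≤ ε, |w| ≤ δ}`. -/
def singularityLink (f : ℂ[X][Y]) (ε δ : ℝ) : Set (ℂ × ℂ) :=
  {x | f.evalEval x.1 x.2 = 0} ∩
    frontier (Metric.closedBall (0 : ℂ) ε ×ˢ Metric.closedBall (0 : ℂ) δ)

/-- `t ↦ (t ^ p, α t)`, `|t| ^ p ≤ ε`, is a one-to-one analytic parametrization of a branch at the
origin of the curve `{f = 0}`. -/
structure IsBranch (f : ℂ[X][Y]) (ε : ℝ) (p : ℕ) (α : ℂ → ℂ) : Prop where
  pos : 0 < p
  analytic : AnalyticOnNhd ℂ α {t | ‖t‖ ^ p ≤ ε}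
  origin : α 0 = 0
  injective : Set.InjOn (fun t : ℂ => (t ^ p, α t)) {t | ‖t‖ ^ p ≤ ε}
  onCurve : ∀ t : ℂ, ‖t‖ ^ p ≤ ε → f.evalEval (t ^ p) (α t) = 0

/-- The knot which the branch contributes to the link, lying over the circle `|z| = ε`. -/
def branchKnot (ε : ℝ) (p : ℕ) (α : ℂ → ℂ) : Set (ℂ × ℂ) :=
  (fun t : ℂ => (t ^ p, α t)) '' {t | ‖t‖ ^ p = ε}

/-- The values over `z` of the branch parametrized by `t ↦ (t ^ p, α t)`, as a
`p`-valued function of `z`: all `α t` with `t ^ p = z`. -/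
def sheets (p : ℕ) (α : ℂ → ℂ) (z : ℂ) : Multiset ℂ := (nthRoots p z).map α

/-- The intersection number at the origin of the branches parametrized by `t ↦ (t ^ p, α t)` and
`t ↦ (t ^ q, β t)`: the order at `t = 0` of the (Weierstrass) equation
`g(z, w) = ∏_{s ^ q = z} (w - β s)` of the second branch along the first one. -/
def intersectionNumber (p : ℕ) (α : ℂ → ℂ) (q : ℕ) (β : ℂ → ℂ) : ℕ∞ :=
  analyticOrderAt (fun t : ℂ => ((sheets q β (t ^ p)).map (fun b => α t - b)).prod) 0

/-- The function `g`, on the circle `ℝ / 2πℤ`, is nonvanishing with winding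
number `m` about `0`. -/
def HasWindingNumber (g : ℝ → ℂ) (m : ℤ) : Prop :=
  ∃ φ : ℝ → ℝ, Continuous φ ∧
    (∀ θ, g θ ≠ 0 ∧ g θ = ‖g θ‖ * Complex.exp (φ θ * Complex.I)) ∧
    φ (2 * Real.pi) - φ 0 = 2 * Real.pi * m

/-- The disjoint closed braids over the circle `|z| = ε` which are the graphs of the multivalued
functions `A` and `B` have linking number `m`: the total winding number
of the differences `a - b` of their points, i.e. half the signed number of the crossings
between the two in a braid diagram. -/
def HasLinkingNumber (ε : ℝ) (A B : ℂ → Multiset ℂ) (m : ℤ) : Prop :=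
  HasWindingNumber (fun θ =>
    ((A (ε * Complex.exp (θ * Complex.I))).map (fun a =>
      ((B (ε * Complex.exp (θ * Complex.I))).map (fun b => a - b)).prod)).prod) m

end BraidLink

end

/-! Substitute `z = exp (I τ)`, so that the punctured disk `0 < |z| < exp (-c)` becomes the half
plane `Im τ > c`. A squarefree `f` satisfies `A f + B ∂f/∂w = D(z)` with `D ≠ 0`, hence for small `z
≠ 0` all roots of `f(z, ·)` are simple. By the argument principle exactly `n` of them lie in `|w| <
δ`. These roots form a covering, which is trivial over the half plane: they are `n` holomorphic
functions `w i` without coincidences, they tend to `0` as `Im τ → ∞`, and the translation by `2π`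
permutes them by a monodromy `π`. This is `IsUniformization`; every claim is read off from it.

Turning: a difference `w i - w j` is periodic, so it is a holomorphic function of `t = exp (I τ /
M)` that vanishes at `t = 0` only. Such a function is `t ^ k * exp (L t)` with `k ≥ 1`. On a
horizontal line its argument has derivative `Re (k + t L'(t)) / M`, which is positive once `|t
L'(t)| < 1` (`eventually_turning`).

Positivity: sort the points by real part. When the real parts of two points that turn
counterclockwise agree, the upper point moves to the left and the lower one to the right, as in a
standard generator. Over a short time all crossings are of this kind, and the path of tuples stays
in a convex `crossingCone`. There the path may be replaced by exchanges of neighbours, with an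
induction on the number of inversions (`exists_hasWord_of_mem_crossingCone`). A Lebesgue number
argument joins the short words. If a generator were missing, a proper nonempty set of strings would
stay to the left of the others over a whole period. Then it would do so for all later time, but each
difference turns infinitely often (`IsTurning.mem_of_isTimeWord`).

Branches: a cycle of `π` of length `p` gives a function of `t = exp (I τ / p)`, which parametrizes a
branch, and every branch arises from some `w i`. For two branches with distinct knots, the equation
of the second along the first is again `t ^ m * exp (L t)`. The exponent `m` is its order at `0`,
that is, the intersection number; it is also the total winding number, that is, the linking number
(`exists_hasLinkingNumber`). -/

noncomputable section

namespace BraidLink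

/-! ### Homotopies of paths of unordered tuples -/

section Homotopy

variable {T S : Type*} [TopologicalSpace T] [TopologicalSpace S]

/-- The source of the nontrivial homotopies below. The simply connected space `S` of parameters is a
convex set of tuples, the unit square or the time axis `ℝ`. The factorization is pointwise, so the
end points of the paths need not be written as values of `H`. -/
theorem homotopic_of_factorization [SimplyConnectedSpace S] (H : C(S, T)) {y₀ y₁ : S}
    (δ δ' : Path y₀ y₁) {a b : T} {γ γ' : Path a b} (h : ∀ t, γ t = H (δ t))
    (h' : ∀ t, γ' t = H (δ' t)) : γ.Homotopic γ' := by
  obtain rfl : H y₀ = a := by simpa using (h 0).symm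
  obtain rfl : H y₁ = b := by simpa using (h 1).symm
  have e : γ = δ.map H.continuous := by ext t; simp [h]
  have e' : γ' = δ'.map H.continuous := by ext t; simp [h']
  rw [e, e']
  exact (SimplyConnectedSpace.paths_homotopic δ δ').map H

theorem trans_apply_of_apply {g : S → T} {a b c : T} {y₀ y₁ y₂ : S} {γ₁ : Path a b}
    {γ₂ : Path b c} {δ₁ : Path y₀ y₁} {δ₂ : Path y₁ y₂} (h₁ : ∀ t, γ₁ t = g (δ₁ t))
    (h₂ : ∀ t, γ₂ t = g (δ₂ t)) (t : unitInterval) :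
    (γ₁.trans γ₂) t = g ((δ₁.trans δ₂) t) := by
  rw [Path.trans_apply, Path.trans_apply]
  split_ifs
  · exact h₁ _
  · exact h₂ _

theorem symm_apply_of_apply {g : S → T} {a b : T} {y₀ y₁ : S} {γ : Path a b}
    {δ : Path y₀ y₁} (h : ∀ t, γ t = g (δ t)) (t : unitInterval) :
    γ.symm t = g (δ.symm t) := by
  simpa using h _

/-- The straight path between two points. -/
def linePath {E : Type*} [AddCommGroup E] [TopologicalSpace E] [IsTopologicalAddGroup E]
    [Module ℝ E] [ContinuousSMul ℝ E] (u v : E) : Path u v where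
  toFun t := (1 - (t : ℝ)) • u + (t : ℝ) • v
  source' := by simp
  target' := by simp

theorem linePath_apply {E : Type*} [AddCommGroup E] [TopologicalSpace E] [IsTopologicalAddGroup E]
    [Module ℝ E] [ContinuousSMul ℝ E] (u v : E) (t : unitInterval) :
    linePath u v t = (1 - (t : ℝ)) • u + (t : ℝ) • v := rfl

theorem linePath_mem {E : Type*} [AddCommGroup E] [TopologicalSpace E] [IsTopologicalAddGroup E]
    [Module ℝ E] [ContinuousSMul ℝ E] {K : Set E} (hK : Convex ℝ K) {u v : E} (hu : u ∈ K)
    (hv : v ∈ K) (t : unitInterval) : linePath u v t ∈ K :=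
  hK hu hv (by linarith [t.2.2]) t.2.1 (by ring)

end Homotopy

variable {n : ℕ}

/-- The path `δ` of ordered tuples represents the path `γ` in the configuration space. -/
def IsLift {p q : Conf n} (γ : Path p q) {u v : Fin n → ℂ} (δ : Path u v) : Prop :=
  ∀ t, (γ t).1 = ofTuple (δ t)

theorem IsLift.trans {p q r : Conf n} {γ₁ : Path p q} {γ₂ : Path q r} {u v w : Fin n → ℂ}
    {δ₁ : Path u v} {δ₂ : Path v w} (h₁ : IsLift γ₁ δ₁) (h₂ : IsLift γ₂ δ₂) :
    IsLift (γ₁.trans γ₂) (δ₁.trans δ₂) := by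
  intro t
  rw [Path.trans_apply, Path.trans_apply]
  split_ifs
  · exact h₁ _
  · exact h₂ _

theorem IsLift.source {p q : Conf n} {γ : Path p q} {u v : Fin n → ℂ}
    {δ : Path u v} (h : IsLift γ δ) : p.1 = ofTuple u := by
  simpa using h 0

theorem IsLift.target {p q : Conf n} {γ : Path p q} {u v : Fin n → ℂ}
    {δ : Path u v} (h : IsLift γ δ) : q.1 = ofTuple v := by
  simpa using h 1

theorem exists_isLift {u v : Fin n → ℂ} (δ : Path u v) (hδ : ∀ t, Function.Injective (δ t))
    {p q : Conf n} (hp : p.1 = ofTuple u) (hq : q.1 = ofTuple v) :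
    ∃ γ : Path p q, IsLift γ δ :=
  ⟨{ toFun := fun t => ⟨ofTuple (δ t), ofTuple_notMem_discriminantLocus (hδ t)⟩
     continuous_toFun := (continuous_ofTuple.comp δ.continuous).subtype_mk _
     source' := Subtype.ext (by simp [hp])
     target' := Subtype.ext (by simp [hq]) }, fun _ => rfl⟩

/-- A convex set of injective tuples is contractible and maps continuously to the configuration
space, so only the end points of the lift matter. -/
theorem homotopic_of_isLift_of_convex {K : Set (Fin n → ℂ)} (hK : Convex ℝ K)
    (hinj : ∀ v ∈ K, Function.Injective v) {p q : Conf n} {γ γ' : Path p q} {u v : Fin n → ℂ}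
    {δ δ' : Path u v} (hδ : ∀ t, δ t ∈ K) (hδ' : ∀ t, δ' t ∈ K) (h : IsLift γ δ)
    (h' : IsLift γ' δ') : γ.Homotopic γ' := by
  have hu : u ∈ K := by simpa using hδ 0
  have hv : v ∈ K := by simpa using hδ 1
  have : ContractibleSpace K := hK.contractibleSpace ⟨u, hu⟩
  let H : C(K, Conf n) :=
    ⟨fun x => ⟨ofTuple x.1, ofTuple_notMem_discriminantLocus (hinj _ x.2)⟩,
      (continuous_ofTuple.comp continuous_subtype_val).subtype_mk _⟩
  let lift (ε : Path u v) (hε : ∀ t, ε t ∈ K) : Path (⟨u, hu⟩ : K) ⟨v, hv⟩ :=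
    { toFun := fun t => ⟨ε t, hε t⟩
      continuous_toFun := ε.continuous.subtype_mk _
      source' := Subtype.ext (by simp)
      target' := Subtype.ext (by simp) }
  exact homotopic_of_factorization H (lift δ hδ) (lift δ' hδ') (fun t => Subtype.ext (h t))
    (fun t => Subtype.ext (h' t))

/-! ### Sorted tuples -/

/-- The entries of the tuple have increasing real parts. -/
def IsSorted (v : Fin n → ℂ) : Prop := StrictMono fun i => (v i).re

theorem IsSorted.injective {v : Fin n → ℂ} (h : IsSorted v) : Function.Injective v :=
  fun i j hij => StrictMono.injective h (by simp [hij])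

theorem convex_setOf_isSorted : Convex ℝ {v : Fin n → ℂ | IsSorted v} := by
  intro u hu v hv a b ha hb hab i j hij
  have h1 := hu hij
  have h2 := hv hij
  simp only [Pi.add_apply, Pi.smul_apply, Complex.add_re, Complex.real_smul, Complex.mul_re,
    Complex.ofReal_re, Complex.ofReal_im, zero_mul, sub_zero] at *
  rcases ha.eq_or_lt with rfl | ha
  · have : b = 1 := by linarith
    subst this; linarith
  · nlinarith

theorem mem_toMultiset_ofTuple {v : Fin n → ℂ} {x : ℂ} :
    x ∈ (ofTuple v).toMultiset ↔ ∃ i, v i = x := by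
  simp [ofTuple, UnorderedTuples.toMultiset]

/-- Both tuples list the same real parts, and a strictly increasing enumeration is determined by its
range. Sorted lifts are therefore canonical, which makes the end points of separately chosen lifts
match. -/
theorem IsSorted.eq_of_ofTuple_eq {u v : Fin n → ℂ} (hu : IsSorted u) (hv : IsSorted v)
    (h : ofTuple u = ofTuple v) : u = v := by
  have hmem : ∀ x, (∃ i, u i = x) ↔ ∃ i, v i = x := fun x => by
    rw [← mem_toMultiset_ofTuple, h, mem_toMultiset_ofTuple]
  have hr : (fun i => (u i).re) = fun i => (v i).re := by
    rw [← StrictMono.range_inj hu hv]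
    ext x
    constructor
    · rintro ⟨i, rfl⟩
      obtain ⟨j, hj⟩ := (hmem (u i)).1 ⟨i, rfl⟩
      exact ⟨j, by simp [hj]⟩
    · rintro ⟨i, rfl⟩
      obtain ⟨j, hj⟩ := (hmem (v i)).2 ⟨i, rfl⟩
      exact ⟨j, by simp [hj]⟩
  funext i
  obtain ⟨j, hj⟩ := (hmem (u i)).1 ⟨i, rfl⟩
  have : j = i := StrictMono.injective hv (by
    rw [hj]
    exact congrFun hr i)
  rw [← hj, this]

/-- The standard ordered tuple over the base point. -/
def baseTuple (n : ℕ) : Fin n → ℂ := fun k => (k : ℂ) + 1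

theorem isSorted_baseTuple : IsSorted (baseTuple n) := by
  intro i j hij
  simpa [baseTuple] using hij

/-- A path from the base point that is represented by a path of sorted tuples. -/
def IsSortedPath {p : Conf n} (c : Path (basePoint n) p) : Prop :=
  ∃ (x : Fin n → ℂ) (δ : Path (baseTuple n) x), (∀ t, IsSorted (δ t)) ∧ IsLift c δ

theorem exists_isSortedPath {p : Conf n} {x : Fin n → ℂ} (hx : IsSorted x) (hp : p.1 = ofTuple x) :
    ∃ c : Path (basePoint n) p, IsSortedPath c := by
  have hs := linePath_mem convex_setOf_isSorted isSorted_baseTuple hx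
  obtain ⟨c, hc⟩ := exists_isLift (linePath (baseTuple n) x) (fun t => (hs t).injective)
    (p := basePoint n) (q := p) rfl hp
  exact ⟨c, x, _, hs, hc⟩

/-- Sorted tuples form a convex set, so the way to join a configuration to the base point through
sorted tuples is unique up to homotopy. Words of paths with different end points thereby become well
defined and composable. -/
theorem IsSortedPath.homotopic {p : Conf n} {c d : Path (basePoint n) p} (hc : IsSortedPath c)
    (hd : IsSortedPath d) : c.Homotopic d := by
  obtain ⟨x, δ, hδ, hcδ⟩ := hc
  obtain ⟨y, δ', hδ', hdδ⟩ := hd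
  obtain rfl : x = y := IsSorted.eq_of_ofTuple_eq (by simpa using hδ 1) (by simpa using hδ' 1)
    (hcδ.target.symm.trans hdδ.target)
  exact homotopic_of_isLift_of_convex convex_setOf_isSorted (fun v hv => hv.injective) hδ hδ' hcδ
    hdδ

/-! ### Braid words of paths -/

/-- The path `γ`, whose end points are tuples with distinct real parts, represents the word `l`
when its ends are joined to the base point through tuples with distinct real parts. -/
def HasWord (l : List (Fin (n - 1))) {p q : Conf n} (γ : Path p q) : Prop :=
  ∃ (c : Path (basePoint n) p) (d : Path (basePoint n) q), IsSortedPath c ∧ IsSortedPath d ∧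
    braidOfLoop (c.trans (γ.trans d.symm)) = (l.map (sigma n)).prod

theorem HasWord.congr {l : List (Fin (n - 1))} {p q : Conf n} {γ γ' : Path p q}
    (h : HasWord l γ) (hγ : γ.Homotopic γ') : HasWord l γ' := by
  obtain ⟨c, d, hc, hd, hw⟩ := h
  refine ⟨c, d, hc, hd, hw ▸ ?_⟩
  unfold braidOfLoop
  rw [Path.Homotopic.Quotient.eq.2]
  exact (Path.Homotopic.refl c).hcomp (hγ.symm.hcomp (Path.Homotopic.refl _))

/-- The lists appear in reverse order because a product in the fundamental group runs through its
second factor first. The two sorted paths at the middle point are homotopic and cancel. -/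
theorem HasWord.trans {l₁ l₂ : List (Fin (n - 1))} {p q r : Conf n} {γ₁ : Path p q}
    {γ₂ : Path q r} (h₁ : HasWord l₁ γ₁) (h₂ : HasWord l₂ γ₂) :
    HasWord (l₂ ++ l₁) (γ₁.trans γ₂) := by
  obtain ⟨c₁, d₁, hc₁, hd₁, hw₁⟩ := h₁
  obtain ⟨c₂, d₂, hc₂, hd₂, hw₂⟩ := h₂
  refine ⟨c₁, d₂, hc₁, hd₂, ?_⟩
  have hcd := Path.Homotopic.Quotient.eq.2 (hd₁.homotopic hc₂)
  rw [List.map_append, List.prod_append, ← hw₁, ← hw₂, FundamentalGroup.mul_def]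
  unfold braidOfLoop
  simp only [Path.Homotopic.Quotient.mk_trans, Path.Homotopic.Quotient.mk_symm, hcd,
    FundamentalGroup.fromPath, FundamentalGroup.fromArrow]
  simp only [Path.Homotopic.Quotient.trans_assoc]
  congr 2
  rw [← Path.Homotopic.Quotient.trans_assoc (Path.Homotopic.Quotient.symm _),
    Path.Homotopic.Quotient.symm_trans, Path.Homotopic.Quotient.refl_trans]

theorem hasWord_nil {p q : Conf n} {γ : Path p q} {u v : Fin n → ℂ} {δ : Path u v}
    (hδ : ∀ t, IsSorted (δ t)) (h : IsLift γ δ) : HasWord [] γ := by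
  obtain ⟨c, hc⟩ := exists_isSortedPath (p := p) (by simpa using hδ 0) h.source
  have hc' := hc
  obtain ⟨x, ε, hε, hcε⟩ := hc
  obtain rfl : x = u := IsSorted.eq_of_ofTuple_eq (by simpa using hε 1) (by simpa using hδ 0)
    (hcε.target.symm.trans h.source)
  -- The path `γ` itself prolongs the sorted path `c`, and with this choice of the final sorted path
  -- the loop contracts.
  refine ⟨c, c.trans γ, hc', ⟨_, _, ?_, hcε.trans h⟩, ?_⟩
  · intro t
    rw [Path.trans_apply]
    split_ifs
    exacts [hε _, hδ _]
  · unfold braidOfLoop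
    simp only [Path.Homotopic.Quotient.mk_trans, Path.Homotopic.Quotient.mk_symm]
    rw [← Path.Homotopic.Quotient.trans_assoc, ← Path.Homotopic.Quotient.mk_trans,
      Path.Homotopic.Quotient.trans_symm]
    rfl

/-! ### A positive crossing of two neighbouring points -/

theorem re_combination (a b : ℝ) (u v : Fin n → ℂ) (i : Fin n) :
    ((a • u + b • v) i).re = a * (u i).re + b * (v i).re := by simp

theorem im_combination (a b : ℝ) (u v : Fin n → ℂ) (i : Fin n) :
    ((a • u + b • v) i).im = a * (u i).im + b * (v i).im := by simp

theorem combination_lt {a b x x' y y' : ℝ} (ha : 0 ≤ a) (hb : 0 ≤ b) (hab : a + b = 1)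
    (hx : x < x') (hy : y < y') : a * x + b * y < a * x' + b * y' := by
  rcases ha.eq_or_lt with rfl | ha
  · obtain rfl : b = 1 := by linarith
    linarith
  · nlinarith

/-- The left one of the two points that the generator `k` exchanges. -/
def leftIndex (k : Fin (n - 1)) : Fin n := ⟨k, by omega⟩

/-- The right one of the two points that the generator `k` exchanges. -/
def rightIndex (k : Fin (n - 1)) : Fin n := ⟨k + 1, by omega⟩

theorem leftIndex_lt_rightIndex (k : Fin (n - 1)) : leftIndex k < rightIndex k := by
  simp [leftIndex, rightIndex, Fin.lt_def]

/-- The transposition of the generator `k`. -/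
def adjSwap (k : Fin (n - 1)) : Equiv.Perm (Fin n) := Equiv.swap (leftIndex k) (rightIndex k)

theorem adjSwap_adjSwap (k : Fin (n - 1)) (i : Fin n) : adjSwap k (adjSwap k i) = i :=
  Equiv.swap_apply_self _ _ _

theorem adjSwap_lt (k : Fin (n - 1)) {i j : Fin n} (hij : i < j)
    (h : ¬ (i = leftIndex k ∧ j = rightIndex k)) : adjSwap k i < adjSwap k j := by
  simp only [adjSwap, Equiv.swap_apply_def]
  simp only [leftIndex, rightIndex, Fin.ext_iff, Fin.lt_def] at *
  split_ifs <;> simp_all <;> omega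

/-- Only the transposition `k` itself moves points across the cut behind position `k`. This records
which cuts a word without the generator `m` respects. -/
theorem adjSwap_le_iff {k m : Fin (n - 1)} (hkm : m ≠ k) (i : Fin n) :
    (adjSwap k i : ℕ) ≤ m ↔ (i : ℕ) ≤ m := by
  have hkm' : (m : ℕ) ≠ k := fun h => hkm (Fin.ext h)
  simp only [adjSwap, Equiv.swap_apply_def]
  split_ifs with h1 h2
  · subst h1; simp [leftIndex, rightIndex]; omega
  · subst h2; simp [leftIndex, rightIndex]; omega
  · rfl

/-- Exchange the real parts of two neighbouring points. -/
def swapRe (k : Fin (n - 1)) (x : Fin n → ℂ) : Fin n → ℂ := fun i => ⟨(x (adjSwap k i)).re, (x i).im⟩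

theorem isSorted_swapRe_comp {x : Fin n → ℂ} (hx : IsSorted x) (k : Fin (n - 1)) :
    IsSorted (swapRe k x ∘ adjSwap k) := by
  intro i j hij
  simpa [swapRe, adjSwap_adjSwap] using hx hij

theorem halfTwist_one_comp (k : Fin (n - 1)) :
    halfTwist n k 1 ∘ adjSwap k = baseTuple n := by
  funext i
  simp only [Function.comp_apply, halfTwist, adjSwap, Equiv.swap_apply_def, baseTuple, leftIndex,
    rightIndex, Complex.ofReal_one, mul_one, Complex.exp_pi_mul_I, Fin.ext_iff]
  split_ifs <;> simp_all <;> ring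

theorem halfTwist_zero_eq (k : Fin (n - 1)) : halfTwist n k 0 = baseTuple n := by
  funext i
  unfold halfTwist baseTuple
  split_ifs with h1 h2
  · simp [h1]; ring
  · simp [h2]; ring
  · rfl

/-- The two turning points keep their real parts between `k + 1` and `k + 2`, and the fixed points
lie outside this strip. -/
theorem halfTwist_re_lt (k : Fin (n - 1)) (t : ℝ) {i j : Fin n} (hij : i < j)
    (h : ¬ (i = leftIndex k ∧ j = rightIndex k)) :
    (halfTwist n k t i).re < (halfTwist n k t j).re := by
  have he : Complex.exp (Real.pi * t * Complex.I) = Complex.exp ((Real.pi * t : ℝ) * Complex.I) := by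
    push_cast; rfl
  have h1 := Real.neg_one_le_cos (Real.pi * t)
  have h2 := Real.cos_le_one (Real.pi * t)
  have hre : ∀ l : Fin n, (halfTwist n k t l).re =
      if (l : ℕ) = k then (k : ℝ) + 3 / 2 - Real.cos (Real.pi * t) / 2
      else if (l : ℕ) = k + 1 then (k : ℝ) + 3 / 2 + Real.cos (Real.pi * t) / 2
      else (l : ℝ) + 1 := by
    intro l
    unfold halfTwist
    rw [he]
    have hd : ∀ z : ℂ, (z / 2).re = z.re / 2 := fun z => by
      simp
    split_ifs <;>
      simp [hd, Complex.exp_ofReal_mul_I_re, -Complex.ofReal_mul]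
  rw [hre, hre]
  simp only [leftIndex, rightIndex, Fin.ext_iff, Fin.lt_def] at *
  have c1 : ∀ {a b : ℕ}, a < b → (a : ℝ) + 1 ≤ b := fun hab => by exact_mod_cast hab
  split_ifs with a1 a2 a3 a4 a5 a6 a7 a8
  · omega
  · omega
  · have : (k : ℕ) + 1 < j := by omega
    have := c1 this; push_cast at this; linarith
  · omega
  · omega
  · have : (k : ℕ) + 1 < j := by omega
    have := c1 this; push_cast at this; linarith
  · have : (i : ℕ) < k := by omega
    have := c1 this; linarith
  · have : (i : ℕ) < k := by omega
    have := c1 this; linarith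
  · have := c1 hij; linarith

/-- This fixes the sign of a positive crossing: the point that starts on the left passes below,
since `sin (π t) ≥ 0`. -/
theorem halfTwist_im_le (k : Fin (n - 1)) (t : unitInterval) :
    (halfTwist n k t (leftIndex k)).im ≤ (halfTwist n k t (rightIndex k)).im := by
  have he : Complex.exp (Real.pi * (t : ℝ) * Complex.I) =
      Complex.exp ((Real.pi * t : ℝ) * Complex.I) := by push_cast; rfl
  have hs : 0 ≤ Real.sin (Real.pi * t) := by
    apply Real.sin_nonneg_of_nonneg_of_le_pi
    · have := t.2.1; positivity
    · have := t.2.2; nlinarith [Real.pi_pos]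
  have hd : ∀ z : ℂ, (z / 2).im = z.im / 2 := fun z => by
    simp
  simp [halfTwist, leftIndex, rightIndex, he, hd, Complex.exp_ofReal_mul_I_im,
    -Complex.ofReal_mul]
  linarith

/-- Pairs other than the exchanged one keep their order of real parts in the half twist and in the
straight exchange, and the exchanged pair has the same vertical order in both. Both properties
survive convex combinations. -/
theorem injective_combination_halfTwist {x : Fin n → ℂ} (hx : IsSorted x) (k : Fin (n - 1))
    (him : (x (leftIndex k)).im < (x (rightIndex k)).im) (s t : unitInterval) :
    Function.Injective ((1 - (s : ℝ)) • halfTwist n k t +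
      (s : ℝ) • linePath x (swapRe k x) t) := by
  have hs1 : 0 ≤ 1 - (s : ℝ) := by linarith [s.2.2]
  have ht1 : 0 ≤ 1 - (t : ℝ) := by linarith [t.2.2]
  refine .of_lt_imp_ne fun i j hij heq => ?_
  by_cases h : i = leftIndex k ∧ j = rightIndex k
  · obtain ⟨rfl, rfl⟩ := h
    -- The half twist gives only a weak vertical inequality, which becomes an equality at its ends;
    -- the strict one comes from the straight path and needs `s > 0`.
    rcases s.2.1.eq_or_lt with hs | hs
    · rw [← hs] at heq
      refine (halfTwist_injective n k t).ne hij.ne ?_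
      simpa using heq
    · have h1 := congrArg Complex.im heq
      rw [im_combination, im_combination, linePath_apply, im_combination, im_combination] at h1
      simp only [swapRe] at h1
      have h2 := halfTwist_im_le k t
      nlinarith
  · have h1 := congrArg Complex.re heq
    rw [re_combination, re_combination, linePath_apply, re_combination, re_combination] at h1
    refine (combination_lt hs1 s.2.1 (by ring) (halfTwist_re_lt k t hij h) ?_).ne h1
    refine combination_lt ht1 t.2.1 (by ring) (hx hij) ?_
    exact hx (adjSwap_lt k hij h)

/-- The square `H` interpolates between the half twist and the straight exchange of real parts. Its
two remaining sides are the straight sorted paths from the base point to the ends of `γ`. -/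
theorem hasWord_singleton {x : Fin n → ℂ} (hx : IsSorted x) (k : Fin (n - 1))
    (him : (x (leftIndex k)).im < (x (rightIndex k)).im) {p q : Conf n} {γ : Path p q}
    (h : IsLift γ (linePath x (swapRe k x))) : HasWord [k] γ := by
  let H : C(unitInterval × unitInterval, Conf n) :=
    ⟨fun a => ⟨ofTuple ((1 - (a.1 : ℝ)) • halfTwist n k a.2 +
        (a.1 : ℝ) • linePath x (swapRe k x) a.2),
      ofTuple_notMem_discriminantLocus (injective_combination_halfTwist hx k him a.1 a.2)⟩, by
      refine (continuous_ofTuple.comp ?_).subtype_mk _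
      have := continuous_halfTwist n k
      have := (linePath x (swapRe k x)).continuous
      fun_prop⟩
  have hsort := isSorted_swapRe_comp hx k
  have hs := linePath_mem convex_setOf_isSorted isSorted_baseTuple hx
  have hs' := linePath_mem convex_setOf_isSorted isSorted_baseTuple hsort
  obtain ⟨c, hc⟩ := exists_isLift (linePath (baseTuple n) x) (fun t => (hs t).injective)
    (p := basePoint n) (q := p) rfl h.source
  obtain ⟨d, hd⟩ := exists_isLift (linePath (baseTuple n) (swapRe k x ∘ adjSwap k))
    (fun t => (hs' t).injective) (p := basePoint n) (q := q) rfl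
    (by rw [h.target, ofTuple_comp_perm])
  refine ⟨c, d, ⟨_, _, hs, hc⟩, ⟨_, _, hs', hd⟩, ?_⟩
  simp only [List.map_cons, List.map_nil, List.prod_singleton, sigma, braidOfLoop]
  rw [Path.Homotopic.Quotient.eq.2]
  -- The sides of the unit square: `e'` gives the generator, and the way round along `c'`, `g'` and
  -- the reverse of `d'` gives the based path.
  let c' : Path ((0, 0) : unitInterval × unitInterval) (1, 0) := ⟨⟨fun t => (t, 0), by fun_prop⟩, rfl, rfl⟩
  let g' : Path ((1, 0) : unitInterval × unitInterval) (1, 1) := ⟨⟨fun t => (1, t), by fun_prop⟩, rfl, rfl⟩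
  let d' : Path ((0, 1) : unitInterval × unitInterval) (1, 1) := ⟨⟨fun t => (t, 1), by fun_prop⟩, rfl, rfl⟩
  let e' : Path ((0, 0) : unitInterval × unitInterval) (0, 1) := ⟨⟨fun t => (0, t), by fun_prop⟩, rfl, rfl⟩
  have : ContractibleSpace unitInterval :=
    (convex_Icc (0 : ℝ) 1).contractibleSpace ⟨0, by simp⟩
  refine homotopic_of_factorization H (c'.trans (g'.trans d'.symm)) e' ?_ ?_
  · refine trans_apply_of_apply ?_ (trans_apply_of_apply ?_ (symm_apply_of_apply ?_))
    · intro t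
      apply Subtype.ext
      rw [hc t]
      change ofTuple _ = ofTuple ((1 - (t : ℝ)) • halfTwist n k ((0 : unitInterval) : ℝ) +
        (t : ℝ) • linePath x (swapRe k x) 0)
      rw [Path.source, Set.Icc.coe_zero, halfTwist_zero_eq, linePath_apply]
    · intro t
      apply Subtype.ext
      rw [h t]
      change ofTuple _ = ofTuple ((1 - ((1 : unitInterval) : ℝ)) • halfTwist n k t +
        ((1 : unitInterval) : ℝ) • linePath x (swapRe k x) t)
      simp
    · intro t
      apply Subtype.ext
      rw [hd t]
      change ofTuple _ = ofTuple ((1 - (t : ℝ)) • halfTwist n k ((1 : unitInterval) : ℝ) +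
        (t : ℝ) • linePath x (swapRe k x) 1)
      rw [Path.target, Set.Icc.coe_one, linePath_apply, ← halfTwist_one_comp k]
      exact ofTuple_comp_perm ((1 - (t : ℝ)) • halfTwist n k 1 + (t : ℝ) • swapRe k x) (adjSwap k)
  · intro t
    apply Subtype.ext
    change ofTuple _ = ofTuple ((1 - ((0 : unitInterval) : ℝ)) • halfTwist n k t +
        ((0 : unitInterval) : ℝ) • linePath x (swapRe k x) t)
    simp

/-! ### Simultaneous positive crossings -/

/-- The tuples in which the pairs of points that are in increasing order in `v` are in increasing
order, and the pairs that are not are in increasing vertical order. -/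
def crossingCone (v : Fin n → ℂ) : Set (Fin n → ℂ) :=
  {x | ∀ i j, i < j →
    ((v i).re < (v j).re → (x i).re < (x j).re) ∧ (¬ (v i).re < (v j).re → (x i).im < (x j).im)}

theorem convex_crossingCone (v : Fin n → ℂ) : Convex ℝ (crossingCone v) := by
  intro x hx y hy a b ha hb hab i j hij
  constructor
  · intro h
    rw [re_combination, re_combination]
    exact combination_lt ha hb hab ((hx i j hij).1 h) ((hy i j hij).1 h)
  · intro h
    rw [im_combination, im_combination]
    exact combination_lt ha hb hab ((hx i j hij).2 h) ((hy i j hij).2 h)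

theorem injective_of_mem_crossingCone {v x : Fin n → ℂ} (hx : x ∈ crossingCone v) :
    Function.Injective x := by
  refine .of_lt_imp_ne fun i j hij heq => ?_
  by_cases h : (v i).re < (v j).re
  · exact ((hx i j hij).1 h).ne (by rw [heq])
  · exact ((hx i j hij).2 h).ne (by rw [heq])

theorem mem_crossingCone_of_isSorted {v x : Fin n → ℂ} (hv : IsSorted v) :
    x ∈ crossingCone v ↔ IsSorted x :=
  ⟨fun h _ _ hij => (h _ _ hij).1 (hv hij), fun h _ _ hij => ⟨fun _ => h hij, fun h' =>
    absurd (hv hij) h'⟩⟩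

theorem swapRe_mem_crossingCone {u v : Fin n → ℂ} (hu : IsSorted u) (huv : u ∈ crossingCone v)
    (k : Fin (n - 1)) (hk : ¬ (v (leftIndex k)).re < (v (rightIndex k)).re) :
    swapRe k u ∈ crossingCone v := by
  intro i j hij
  refine ⟨fun h => ?_, fun h => (huv i j hij).2 h⟩
  refine hu (adjSwap_lt k hij ?_)
  rintro ⟨rfl, rfl⟩
  exact hk h

/-- Once the pair `k` has been exchanged, relabelling the strings puts it back in order, and the
remaining motion is of the same kind with fewer inversions. -/
theorem comp_adjSwap_mem_crossingCone {x v : Fin n → ℂ} (hx : x ∈ crossingCone v)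
    (k : Fin (n - 1)) (hk : (v (rightIndex k)).re < (v (leftIndex k)).re)
    (hxk : (x (rightIndex k)).re < (x (leftIndex k)).re) :
    x ∘ adjSwap k ∈ crossingCone (v ∘ adjSwap k) := by
  intro i j hij
  by_cases h : i = leftIndex k ∧ j = rightIndex k
  · obtain ⟨rfl, rfl⟩ := h
    simp only [Function.comp_apply, adjSwap, Equiv.swap_apply_left, Equiv.swap_apply_right]
    exact ⟨fun _ => hxk, fun h => absurd hk h⟩
  · exact hx _ _ (adjSwap_lt k hij h)

/-- The pairs of points that are in decreasing order. -/
def inversions (v : Fin n → ℂ) : Finset (Fin n × Fin n) :=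
  open Classical in {p | p.1 < p.2 ∧ (v p.2).re < (v p.1).re}

/-- The transposition maps the inversions of the new tuple injectively to those of the old one and
misses the pair `k`. -/
theorem card_inversions_comp_lt {v : Fin n → ℂ} (k : Fin (n - 1))
    (hk : (v (rightIndex k)).re < (v (leftIndex k)).re) :
    (inversions (v ∘ adjSwap k)).card < (inversions v).card := by
  classical
  rw [← Finset.card_image_of_injective (f := Prod.map (adjSwap k) (adjSwap k)) _
    ((adjSwap k).injective.prodMap (adjSwap k).injective)]
  apply Finset.card_lt_card
  rw [Finset.ssubset_iff_of_subset]
  · refine ⟨(leftIndex k, rightIndex k), ?_, ?_⟩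
    · simpa [inversions] using ⟨leftIndex_lt_rightIndex k, hk⟩
    · intro hmem
      obtain ⟨⟨i, j⟩, hij, heq⟩ := Finset.mem_image.1 hmem
      simp only [inversions, Finset.mem_filter, Finset.mem_univ, true_and] at hij
      simp only [Prod.map_apply, Prod.mk.injEq] at heq
      have hi : i = rightIndex k := by
        rw [← adjSwap_adjSwap k i, heq.1, adjSwap, Equiv.swap_apply_left]
      have hj : j = leftIndex k := by
        rw [← adjSwap_adjSwap k j, heq.2, adjSwap, Equiv.swap_apply_right]
      subst hi hj
      exact lt_asymm hij.1 (leftIndex_lt_rightIndex k)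
  · intro p hp
    obtain ⟨⟨i, j⟩, hij, rfl⟩ := Finset.mem_image.1 hp
    simp only [inversions, Finset.mem_filter, Finset.mem_univ, true_and, Function.comp_apply,
      Prod.map_apply] at hij ⊢
    refine ⟨adjSwap_lt k hij.1 ?_, hij.2⟩
    rintro ⟨rfl, rfl⟩
    simp only [adjSwap, Equiv.swap_apply_left, Equiv.swap_apply_right] at hij
    exact lt_asymm hk hij.2

theorem isSorted_iff_adjacent {v : Fin n → ℂ} :
    IsSorted v ↔ ∀ k : Fin (n - 1), (v (leftIndex k)).re < (v (rightIndex k)).re := by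
  refine ⟨fun h k => h (leftIndex_lt_rightIndex k), fun h => ?_⟩
  rcases n with _ | n
  · exact fun i => i.elim0
  · exact Fin.strictMono_iff_lt_succ.2 fun i => h i

/-- A path of tuples in which all crossings are positive is a positive word. -/
theorem exists_hasWord_of_mem_crossingCone {u v : Fin n → ℂ} (hu : IsSorted u)
    (hv : Function.Injective fun i => (v i).re) {δ : Path u v} (hδ : ∀ t, δ t ∈ crossingCone v)
    {p q : Conf n} {γ : Path p q} (h : IsLift γ δ) :
    ∃ l, HasWord l γ ∧ ∀ m, m ∉ l → ∀ i j : Fin n, (i : ℕ) ≤ m → (m : ℕ) < j →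
      (v i).re < (v j).re := by
  induction hN : (inversions v).card using Nat.strong_induction_on generalizing u v p q with
  | _ N ih =>
  by_cases hs : IsSorted v
  · exact ⟨[], hasWord_nil (fun t => (mem_crossingCone_of_isSorted hs).1 (hδ t)) h,
      fun m _ i j hi hj => hs (Fin.lt_def.2 (hi.trans_lt hj))⟩
  rw [isSorted_iff_adjacent] at hs
  push Not at hs
  obtain ⟨k, hk⟩ := hs
  have hk : (v (rightIndex k)).re < (v (leftIndex k)).re :=
    lt_of_le_of_ne hk (hv.ne (leftIndex_lt_rightIndex k).ne')
  have huK : u ∈ crossingCone v := by simpa using hδ 0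
  have hvK : v ∈ crossingCone v := by simpa using hδ 1
  -- Some neighbouring pair `k` is inverted at the end. The path is rerouted through the tuple in
  -- which this pair alone has been exchanged; the detour stays in the convex cone, so it does not
  -- change the homotopy class.
  have hmK := swapRe_mem_crossingCone hu huK k hk.not_gt
  have hl₁ := linePath_mem (convex_crossingCone v) huK hmK
  have hl₂ := linePath_mem (convex_crossingCone v) hmK hvK
  let r : Conf n := ⟨ofTuple (swapRe k u),
    ofTuple_notMem_discriminantLocus (injective_of_mem_crossingCone hmK)⟩
  obtain ⟨γ₁, h₁⟩ := exists_isLift _ (fun t => injective_of_mem_crossingCone (hl₁ t))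
    (p := p) (q := r) h.source rfl
  obtain ⟨γ₂, h₂⟩ := exists_isLift _ (fun t => injective_of_mem_crossingCone (hl₂ t))
    (p := r) (q := q) rfl h.target
  have hw₁ : HasWord [k] γ₁ :=
    hasWord_singleton hu k ((huK _ _ (leftIndex_lt_rightIndex k)).2 hk.not_gt) h₁
  have hγ : (γ₁.trans γ₂).Homotopic γ := by
    refine homotopic_of_isLift_of_convex (convex_crossingCone v)
      (fun x hx => injective_of_mem_crossingCone hx) ?_ hδ (h₁.trans h₂) h
    intro t
    rw [Path.trans_apply]
    split_ifs
    exacts [hl₁ _, hl₂ _]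
  have hmre : (swapRe k u (rightIndex k)).re < (swapRe k u (leftIndex k)).re := by
    simpa [swapRe, adjSwap] using hu (leftIndex_lt_rightIndex k)
  obtain ⟨l, hl, hl'⟩ := ih _ (hN ▸ card_inversions_comp_lt k hk) (isSorted_swapRe_comp hu k)
    (v := v ∘ adjSwap k) (hv.comp (adjSwap k).injective)
    (δ := linePath (swapRe k u ∘ adjSwap k) (v ∘ adjSwap k))
    (linePath_mem (convex_crossingCone _) (comp_adjSwap_mem_crossingCone hmK k hk hmre)
      (comp_adjSwap_mem_crossingCone hvK k hk hk)) (γ := γ₂)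
    (fun t => by rw [h₂ t, ← ofTuple_comp_perm _ (adjSwap k)]; rfl) rfl
  -- The crossing `k` happens first and so stands last. A generator `m` missing from the word
  -- differs from `k`, so relabelling by the transposition respects the cut at `m`.
  refine ⟨l ++ [k], (hw₁.trans hl).congr hγ, fun m hm i j hi hj => ?_⟩
  simp only [List.mem_append, List.mem_singleton, not_or] at hm
  have := hl' m hm.1 (adjSwap k i) (adjSwap k j) ((adjSwap_le_iff hm.2 i).2 hi)
    (not_le.1 fun h' => absurd ((adjSwap_le_iff hm.2 j).1 h') hj.not_ge)
  simpa [adjSwap_adjSwap] using this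

/-! ### Strings whose differences turn counterclockwise -/

/-- The differences of the strings are nonzero, and turn counterclockwise infinitely often. -/
structure IsTurning (w : Fin n → ℝ → ℂ) : Prop where
  continuous : ∀ i, Continuous (w i)
  turning : ∀ i j, i ≠ j → ∃ φ : ℝ → ℝ, Continuous φ ∧ StrictMono φ ∧ (∀ B, ∃ θ, B < φ θ) ∧
    ∀ θ, w i θ ≠ w j θ ∧ w i θ - w j θ = ‖w i θ - w j θ‖ * Complex.exp (φ θ * Complex.I)

theorem IsTurning.injective {w : Fin n → ℝ → ℂ} (hw : IsTurning w) (θ : ℝ) :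
    Function.Injective fun i => w i θ := by
  intro i j hij
  by_contra hne
  obtain ⟨φ, -, -, -, h⟩ := hw.turning i j hne
  exact (h θ).1 hij

theorem re_eq_norm_mul_cos {z : ℂ} {x : ℝ} (h : z = ‖z‖ * Complex.exp (x * Complex.I)) :
    z.re = ‖z‖ * Real.cos x := by
  conv_lhs => rw [h]
  rw [Complex.re_ofReal_mul, Complex.exp_ofReal_mul_I_re]

theorem im_eq_norm_mul_sin {z : ℂ} {x : ℝ} (h : z = ‖z‖ * Complex.exp (x * Complex.I)) :
    z.im = ‖z‖ * Real.sin x := by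
  conv_lhs => rw [h]
  rw [Complex.im_ofReal_mul, Complex.exp_ofReal_mul_I_im]

/-- Near a time at which one point is above another, the real part of the difference
decreases through zero. -/
theorem eventually_crossing {φ : ℝ → ℝ} (hφ : Continuous φ) (hmono : StrictMono φ) {d : ℝ → ℂ}
    (hd : ∀ θ, d θ ≠ 0 ∧ d θ = ‖d θ‖ * Complex.exp (φ θ * Complex.I)) {θ₀ : ℝ}
    (hre : (d θ₀).re = 0) (him : 0 < (d θ₀).im) :
    ∀ᶠ θ in nhds θ₀, (θ < θ₀ → 0 < (d θ).re) ∧ (θ₀ < θ → (d θ).re < 0) := by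
  have hn : ∀ θ, 0 < ‖d θ‖ := fun θ => norm_pos_iff.2 (hd θ).1
  have hcos : Real.cos (φ θ₀) = 0 := by
    rw [re_eq_norm_mul_cos (hd θ₀).2] at hre
    exact (mul_eq_zero.1 hre).resolve_left (hn _).ne'
  have hsin : 0 < Real.sin (φ θ₀) := by
    rw [im_eq_norm_mul_sin (hd θ₀).2] at him
    exact pos_of_mul_pos_right him (hn _).le
  have hsin1 : Real.sin (φ θ₀) = 1 := by
    nlinarith [Real.sin_sq_add_cos_sq (φ θ₀)]
  -- With `cos = 0` and `sin = 1` at time `θ₀`, the cosine is minus the sine of the increment of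
  -- `φ`, whose sign is known while the increment is less than `π` in absolute value.
  have hc : ∀ x, Real.cos x = - Real.sin (x - φ θ₀) := by
    intro x
    rw [Real.sin_sub, hcos, hsin1]; ring
  have hnear : ∀ᶠ θ in nhds θ₀, |φ θ - φ θ₀| < Real.pi := by
    have : Filter.Tendsto (fun θ => |φ θ - φ θ₀|) (nhds θ₀) (nhds |φ θ₀ - φ θ₀|) :=
      ((hφ.sub continuous_const).abs).tendsto _
    exact this.eventually_lt_const (by simpa using Real.pi_pos)
  filter_upwards [hnear] with θ hθ
  rw [abs_lt] at hθ
  rw [re_eq_norm_mul_cos (hd θ).2, hc]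
  constructor
  · intro hlt
    have := hmono hlt
    have hs : Real.sin (φ θ - φ θ₀) < 0 :=
      Real.sin_neg_of_neg_of_neg_pi_lt (by linarith) (by linarith)
    have := hn θ
    nlinarith
  · intro hlt
    have := hmono hlt
    have hs : 0 < Real.sin (φ θ - φ θ₀) :=
      Real.sin_pos_of_pos_of_lt_pi (by linarith) (by linarith)
    have := hn θ
    nlinarith

/-- The position of the strings `i` and `j` at a time `θ` near `θ₀`. -/
def CrossesNear (w : Fin n → ℝ → ℂ) (θ₀ : ℝ) (i j : Fin n) (θ : ℝ) : Prop :=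
  ((w i θ₀).re < (w j θ₀).re → (w i θ).re < (w j θ).re) ∧
  ((w i θ₀).re = (w j θ₀).re → (w j θ₀).im < (w i θ₀).im →
    (w j θ).im < (w i θ).im ∧ (θ < θ₀ → (w j θ).re < (w i θ).re) ∧
      (θ₀ < θ → (w i θ).re < (w j θ).re))

theorem IsTurning.eventually_crossesNear {w : Fin n → ℝ → ℂ} (hw : IsTurning w) (θ₀ : ℝ) :
    ∀ᶠ θ in nhds θ₀, ∀ i j, CrossesNear w θ₀ i j θ := by
  rw [Filter.eventually_all]; intro i
  rw [Filter.eventually_all]; intro j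
  have hr : ∀ i, Continuous fun θ => (w i θ).re := fun i => Complex.continuous_re.comp (hw.continuous i)
  have hi : ∀ i, Continuous fun θ => (w i θ).im := fun i => Complex.continuous_im.comp (hw.continuous i)
  have h1 : ∀ᶠ θ in nhds θ₀, (w i θ₀).re < (w j θ₀).re → (w i θ).re < (w j θ).re := by
    by_cases h : (w i θ₀).re < (w j θ₀).re
    · filter_upwards [(hr i).continuousAt.eventually_lt (hr j).continuousAt h] with θ hθ _ using hθ
    · exact Filter.Eventually.of_forall fun θ h' => absurd h' h
  have h2 : ∀ᶠ θ in nhds θ₀, (w i θ₀).re = (w j θ₀).re → (w j θ₀).im < (w i θ₀).im →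
    (w j θ).im < (w i θ).im ∧ (θ < θ₀ → (w j θ).re < (w i θ).re) ∧
      (θ₀ < θ → (w i θ).re < (w j θ).re) := by
    by_cases h : (w i θ₀).re = (w j θ₀).re ∧ (w j θ₀).im < (w i θ₀).im
    · have hij : i ≠ j := by rintro rfl; exact lt_irrefl _ h.2
      obtain ⟨φ, hφ, hmono, -, hd⟩ := hw.turning i j hij
      filter_upwards [(hi j).continuousAt.eventually_lt (hi i).continuousAt h.2,
        eventually_crossing hφ hmono (d := fun θ => w i θ - w j θ)
          (fun θ => ⟨sub_ne_zero.2 (hd θ).1, (hd θ).2⟩) (by simp [h.1]) (by simpa using h.2)]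
        with θ h3 h4 _ _
      simp only [Complex.sub_re, sub_pos, sub_neg] at h4
      exact ⟨h3, h4⟩
    · exact Filter.Eventually.of_forall fun θ h' h'' => absurd ⟨h', h''⟩ h
  filter_upwards [h1, h2] with θ h3 h4 using ⟨h3, h4⟩

/-- At the time `θ` the strings have distinct real parts. -/
def IsRegularTime (w : Fin n → ℝ → ℂ) (θ : ℝ) : Prop := Function.Injective fun i => (w i θ).re

theorem IsTurning.lt_or_lt_im {w : Fin n → ℝ → ℂ} (hw : IsTurning w) {θ : ℝ} {i j : Fin n}
    (hij : i ≠ j) (h : (w i θ).re = (w j θ).re) :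
    (w i θ).im < (w j θ).im ∨ (w j θ).im < (w i θ).im :=
  lt_or_gt_of_ne fun h' => hij (hw.injective θ (Complex.ext h h'))

/-- Two strings with equal real parts at `θ₀` are one above the other, and by the turning they have
different real parts immediately before and after. So the times that are not regular are isolated.
-/
theorem IsTurning.eventually_isRegularTime {w : Fin n → ℝ → ℂ} (hw : IsTurning w) (θ₀ : ℝ) :
    ∀ᶠ θ in nhdsWithin θ₀ {θ₀}ᶜ, IsRegularTime w θ := by
  rw [eventually_nhdsWithin_iff]
  filter_upwards [hw.eventually_crossesNear θ₀] with θ hθ hne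
  intro i j hij
  by_contra hne'
  have hij : (w i θ).re = (w j θ).re := hij
  rcases lt_trichotomy (w i θ₀).re (w j θ₀).re with h | h | h
  · exact ((hθ i j).1 h).ne hij
  · rcases hw.lt_or_lt_im hne' h with h' | h' <;> rcases lt_or_gt_of_ne hne with h3 | h3
    · exact (((hθ j i).2 h.symm h').2.1 h3).ne hij
    · exact (((hθ j i).2 h.symm h').2.2 h3).ne' hij
    · exact (((hθ i j).2 h h').2.1 h3).ne' hij
    · exact (((hθ i j).2 h h').2.2 h3).ne hij
  · exact ((hθ j i).1 h).ne' hij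

theorem IsTurning.exists_isRegularTime {w : Fin n → ℝ → ℂ} (hw : IsTurning w) {a b : ℝ}
    (hab : a < b) : ∃ θ ∈ Set.Ioo a b, IsRegularTime w θ := by
  have h1 := hw.eventually_isRegularTime ((a + b) / 2)
  have h2 : ∀ᶠ θ in nhdsWithin ((a + b) / 2) {(a + b) / 2}ᶜ, θ ∈ Set.Ioo a b :=
    nhdsWithin_le_nhds (Ioo_mem_nhds (by linarith) (by linarith))
  obtain ⟨θ, h3, h4⟩ := (h2.and h1).exists
  exact ⟨θ, h3, h4⟩

/-- The path of the strings between two times. -/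
def timePath {w : Fin n → ℝ → ℂ} (hw : ∀ i, Continuous (w i)) (a b : ℝ) :
    Path (fun i => w i a) (fun i => w i b) :=
  ((linePath a b).map (f := fun θ i => w i θ) (continuous_pi hw))

/-- A word for the strings between two times, which controls the exchanges of the strings. -/
def IsTimeWord {w : Fin n → ℝ → ℂ} (hw : ∀ i, Continuous (w i)) (a b : ℝ)
    (l : List (Fin (n - 1))) : Prop :=
  (∀ (p q : Conf n) (γ : Path p q), IsLift γ (timePath hw a b) → HasWord l γ) ∧
  ∀ m, m ∉ l → ∃ A : Finset (Fin n), A.card = m + 1 ∧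
    ∀ i ∈ A, ∀ j ∉ A, ∀ θ ∈ Set.Icc a b, (w i θ).re ≤ (w j θ).re

theorem linePath_mem_Icc {a b : ℝ} (hab : a ≤ b) (t : unitInterval) :
    linePath a b t ∈ Set.Icc a b :=
  linePath_mem (convex_Icc a b) (Set.left_mem_Icc.2 hab) (Set.right_mem_Icc.2 hab) t

theorem exists_linePath_eq {a b : ℝ} {θ : ℝ} (hθ : θ ∈ Set.Icc a b) :
    ∃ t : unitInterval, linePath a b t = θ := by
  have := (linePath a b).continuous
  have h := intermediate_value_Icc (a := (0 : ℝ)) (b := 1) zero_le_one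
    (f := fun t => (1 - t) * a + t * b) (by fun_prop)
  simp only [sub_zero, one_mul, zero_mul, add_zero, sub_self, zero_add] at h
  obtain ⟨t, ht, h⟩ := h hθ
  exact ⟨⟨t, ht⟩, by simpa [linePath_apply] using h⟩

/-- Within the interval a pair can have equal real parts only at `θ₀`, where the upper string passes
to the left. Labelled by their order at time `a`, the strings therefore stay in the crossing cone of
their final positions. -/
theorem IsTurning.exists_isTimeWord_of_crossesNear {w : Fin n → ℝ → ℂ} (hw : IsTurning w)
    {θ₀ a b : ℝ} (hab : a ≤ b) (ha : IsRegularTime w a) (hb : IsRegularTime w b)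
    (hnear : ∀ θ ∈ Set.Icc a b, ∀ i j, CrossesNear w θ₀ i j θ) :
    ∃ l, IsTimeWord hw.continuous a b l := by
  classical
  have hcross : ∀ i j, (w i a).re < (w j a).re → ∀ θ ∈ Set.Icc a b,
      ((w i b).re < (w j b).re → (w i θ).re < (w j θ).re) ∧
      (¬ (w i b).re < (w j b).re → (w i θ).im < (w j θ).im) := by
    intro i j hij θ hθ
    have hne : i ≠ j := by rintro rfl; exact lt_irrefl _ hij
    have hA := hnear a (Set.left_mem_Icc.2 hab)
    have hB := hnear b (Set.right_mem_Icc.2 hab)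
    have hT := hnear θ hθ
    rcases lt_trichotomy (w i θ₀).re (w j θ₀).re with h | h | h
    · exact ⟨fun _ => (hT i j).1 h, fun h' => absurd ((hB i j).1 h) h'⟩
    · have haθ : a ≠ θ₀ := by rintro rfl; exact hne (ha h)
      have hbθ : b ≠ θ₀ := by rintro rfl; exact hne (hb h)
      -- A string `i` below `j` at `θ₀` is to the left of `j` before `θ₀` and to the right
      -- afterwards. If `i` is above, it is to the left only after `θ₀`, so the interval starts
      -- after `θ₀` and the pair is not exchanged.
      rcases hw.lt_or_lt_im hne h with h' | h'
      · refine ⟨fun h'' => ((hT j i).2 h.symm h').2.1 ?_, fun _ => ((hT j i).2 h.symm h').1⟩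
        by_contra hle
        have : θ₀ < b := lt_of_le_of_ne ((not_lt.1 hle).trans hθ.2) hbθ.symm
        exact lt_asymm h'' (((hB j i).2 h.symm h').2.2 this)
      · have h1 : θ₀ < a := by
          refine lt_of_le_of_ne (not_lt.1 fun hlt => ?_) haθ.symm
          exact lt_asymm hij (((hA i j).2 h h').2.1 hlt)
        exact ⟨fun _ => ((hT i j).2 h h').2.2 (h1.trans_le hθ.1),
          fun h'' => absurd (((hB i j).2 h h').2.2 (h1.trans_le hab)) h''⟩
    · exact absurd ((hA j i).1 h) hij.not_gt
  let e : Equiv.Perm (Fin n) := Tuple.sort fun i => (w i a).re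
  have hsort : IsSorted fun i => w (e i) a :=
    (Tuple.monotone_sort fun i => (w i a).re).strictMono_of_injective (ha.comp e.injective)
  let δ : Path (fun i => w (e i) a) (fun i => w (e i) b) :=
    timePath (fun i => hw.continuous (e i)) a b
  have hδ : ∀ t, δ t ∈ crossingCone (fun i => w (e i) b) := fun t i j hij =>
    hcross _ _ (hsort hij) _ (linePath_mem_Icc hab t)
  have key : ∀ (p q : Conf n) (γ : Path p q), IsLift γ (timePath hw.continuous a b) →
      IsLift γ δ := fun p q γ h t => by
    rw [h t, ← ofTuple_comp_perm _ e]; rfl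
  let P : ℝ → Conf n := fun θ => ⟨ofTuple fun i => w i θ,
    ofTuple_notMem_discriminantLocus (hw.injective θ)⟩
  obtain ⟨γ₀, hγ₀⟩ := exists_isLift (timePath hw.continuous a b) (fun t => hw.injective _)
    (p := P a) (q := P b) rfl rfl
  obtain ⟨l, hl, hl'⟩ := exists_hasWord_of_mem_crossingCone hsort (hb.comp e.injective) hδ
    (key _ _ _ hγ₀)
  refine ⟨l, ?_, fun m hm => ?_⟩
  · intro p q γ hγ
    obtain rfl : p = P a := Subtype.ext hγ.source
    obtain rfl : q = P b := Subtype.ext hγ.target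
    refine hl.congr ?_
    have : γ₀ = γ := Path.ext (funext fun t => Subtype.ext ((hγ₀ t).trans (hγ t).symm))
    rw [this]
  -- The separating set consists of the `m + 1` strings that are leftmost at time `a`.
  · refine ⟨(Finset.univ.filter fun i : Fin n => (i : ℕ) ≤ m).image e, ?_, ?_⟩
    · rw [Finset.card_image_of_injective _ e.injective]
      have : (Finset.univ.filter fun i : Fin n => (i : ℕ) ≤ m) = Finset.Iic (leftIndex m) := by
        ext i; simp [leftIndex, Fin.le_def]
      rw [this, Fin.card_Iic]; rfl
    · intro i hi j hj θ hθ
      obtain ⟨i, hi, rfl⟩ := Finset.mem_image.1 hi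
      obtain ⟨j, rfl⟩ := e.surjective j
      have hi : (i : ℕ) ≤ m := by simpa using hi
      have hj : (m : ℕ) < j := by simpa using hj
      obtain ⟨t, rfl⟩ := exists_linePath_eq hθ
      exact ((hδ t i j (Fin.lt_def.2 (hi.trans_lt hj))).1 (hl' m hm i j hi hj)).le

/-- Two initial segments of the same size for an injective function agree. -/
theorem eq_of_card_eq_of_separated {f : Fin n → ℝ} (hf : Function.Injective f)
    {A B : Finset (Fin n)} (hcard : A.card = B.card) (hA : ∀ i ∈ A, ∀ j ∉ A, f i ≤ f j)
    (hB : ∀ i ∈ B, ∀ j ∉ B, f i ≤ f j) : A = B := by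
  by_contra hne
  have h1 : ∃ i ∈ A, i ∉ B := by
    by_contra! h
    exact hne (Finset.eq_of_subset_of_card_le h hcard.ge)
  have h2 : ∃ j ∈ B, j ∉ A := by
    by_contra! h
    exact hne (Finset.eq_of_subset_of_card_le h hcard.le).symm
  obtain ⟨i, hi, hi'⟩ := h1
  obtain ⟨j, hj, hj'⟩ := h2
  have : i = j := hf (le_antisymm (hA i hi j hj') (hB j hj i hi'))
  exact hi' (this ▸ hj)

/-- For a generator missing from both words, the two separating sets are initial segments of equal
size at the regular time `b`, where real parts are distinct. Hence they coincide, and one set serves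
for the whole interval. -/
theorem IsTimeWord.trans {w : Fin n → ℝ → ℂ} (hw : IsTurning w) {a b c : ℝ}
    {l₁ l₂ : List (Fin (n - 1))} (hab : a ≤ b) (hbc : b ≤ c) (hb : IsRegularTime w b)
    (h₁ : IsTimeWord hw.continuous a b l₁) (h₂ : IsTimeWord hw.continuous b c l₂) :
    IsTimeWord hw.continuous a c (l₂ ++ l₁) := by
  let P : C(ℝ, Conf n) := ⟨fun θ => ⟨ofTuple fun i => w i θ,
    ofTuple_notMem_discriminantLocus (hw.injective θ)⟩,
    (continuous_ofTuple.comp (continuous_pi hw.continuous)).subtype_mk _⟩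
  refine ⟨fun p q γ hγ => ?_, fun m hm => ?_⟩
  · obtain ⟨γ₁, hγ₁⟩ := exists_isLift (timePath hw.continuous a b) (fun t => hw.injective _)
      (p := p) (q := P b) hγ.source rfl
    obtain ⟨γ₂, hγ₂⟩ := exists_isLift (timePath hw.continuous b c) (fun t => hw.injective _)
      (p := P b) (q := q) rfl hγ.target
    refine ((h₁.1 _ _ _ hγ₁).trans (h₂.1 _ _ _ hγ₂)).congr ?_
    refine homotopic_of_factorization P ((linePath a b).trans (linePath b c)) (linePath a c) ?_
      fun t => Subtype.ext (hγ t)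
    exact trans_apply_of_apply (fun t => Subtype.ext (hγ₁ t)) (fun t => Subtype.ext (hγ₂ t))
  · simp only [List.mem_append, not_or] at hm
    obtain ⟨A, hA, hA'⟩ := h₁.2 m hm.2
    obtain ⟨B, hB, hB'⟩ := h₂.2 m hm.1
    obtain rfl : A = B := eq_of_card_eq_of_separated hb (hA.trans hB.symm)
      (fun i hi j hj => hA' i hi j hj b (Set.right_mem_Icc.2 hab))
      (fun i hi j hj => hB' i hi j hj b (Set.left_mem_Icc.2 hbc))
    refine ⟨A, hA, fun i hi j hj θ hθ => ?_⟩
    rcases le_total θ b with h | h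
    · exact hA' i hi j hj θ ⟨hθ.1, h⟩
    · exact hB' i hi j hj θ ⟨h, hθ.2⟩

/-- A Lebesgue number `η` for the neighbourhoods of simultaneous crossings reduces to intervals
shorter than `η`. The cuts have to be regular times, which exist in every open interval. -/
theorem IsTurning.exists_isTimeWord {w : Fin n → ℝ → ℂ} (hw : IsTurning w) {a b : ℝ}
    (hab : a ≤ b) (ha : IsRegularTime w a) (hb : IsRegularTime w b) :
    ∃ l, IsTimeWord hw.continuous a b l := by
  choose U hU hUw using fun θ₀ => Filter.eventually_iff_exists_mem.1 (hw.eventually_crossesNear θ₀)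
  obtain ⟨η, hη, hcover⟩ := lebesgue_number_lemma_of_metric (isCompact_Icc (a := a) (b := b))
    (c := fun θ₀ => interior (U θ₀)) (fun _ => isOpen_interior)
    (fun θ _ => Set.mem_iUnion.2 ⟨θ, mem_interior_iff_mem_nhds.2 (hU θ)⟩)
  have hshort : ∀ x ∈ Set.Icc a b, ∀ y, x ≤ y → y < x + η → IsRegularTime w x →
      IsRegularTime w y → ∃ l, IsTimeWord hw.continuous x y l := by
    intro x hx y hxy hyη hx' hy'
    obtain ⟨θ₀, hθ₀⟩ := hcover x hx
    refine hw.exists_isTimeWord_of_crossesNear (θ₀ := θ₀) hxy hx' hy' fun θ hθ => ?_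
    refine hUw θ₀ θ (interior_subset (hθ₀ ?_))
    rw [Metric.mem_ball, Real.dist_eq, abs_of_nonneg (by linarith [hθ.1])]
    linarith [hθ.2]
  have hall : ∀ k : ℕ, ∀ x ∈ Set.Icc a b, ∀ y ∈ Set.Icc a b, x ≤ y → y < x + (k + 1) * (η / 2) →
      IsRegularTime w x → IsRegularTime w y → ∃ l, IsTimeWord hw.continuous x y l := by
    intro k
    induction k with
    | zero =>
      intro x hx y _ hxy hyη
      exact hshort x hx y hxy (by push_cast at hyη; linarith)
    | succ k ih =>
      intro x hx y hy hxy hyη hx' hy'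
      by_cases hs : y < x + η
      · exact hshort x hx y hxy hs hx' hy'
      -- A cut between `η / 2` and `η` keeps the piece short and still advances by at least `η / 2`,
      -- so the induction on the number of half steps closes.
      obtain ⟨c, hc, hc'⟩ := hw.exists_isRegularTime (a := x + η / 2) (b := x + η) (by linarith)
      have hxc : x ≤ c := by linarith [hc.1]
      have hcy : c ≤ y := by linarith [hc.2]
      obtain ⟨l₁, h₁⟩ := hshort x hx c hxc hc.2 hx' hc'
      obtain ⟨l₂, h₂⟩ := ih c ⟨hx.1.trans hxc, hcy.trans hy.2⟩ y hy hcy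
        (by push_cast at hyη; linarith [hc.1]) hc' hy'
      exact ⟨_, IsTimeWord.trans hw hxc hcy hc' h₁ h₂⟩
  obtain ⟨k, hk⟩ := exists_nat_gt ((b - a) / (η / 2))
  rw [div_lt_iff₀ (by positivity)] at hk
  exact hall k a (Set.left_mem_Icc.2 hab) b (Set.right_mem_Icc.2 hab) hab
    (by nlinarith) ha hb

/-- The argument of the difference later passes a multiple of `2π`, and there the difference is a
positive real number. -/
theorem IsTurning.exists_re_lt {w : Fin n → ℝ → ℂ} (hw : IsTurning w) {i j : Fin n} (hij : i ≠ j)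
    (a : ℝ) : ∃ θ, a ≤ θ ∧ (w j θ).re < (w i θ).re := by
  obtain ⟨φ, hφ, hmono, hunb, hd⟩ := hw.turning i j hij
  obtain ⟨K, hK⟩ := exists_nat_gt (φ a / (2 * Real.pi))
  rw [div_lt_iff₀ Real.two_pi_pos] at hK
  obtain ⟨b, hb⟩ := hunb (K * (2 * Real.pi))
  have hab : a ≤ b := by
    by_contra h
    have := hmono (not_le.1 h)
    linarith
  obtain ⟨θ, hθ, hθ'⟩ := intermediate_value_Icc hab hφ.continuousOn ⟨hK.le, hb.le⟩
  refine ⟨θ, hθ.1, ?_⟩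
  have h1 := re_eq_norm_mul_cos (hd θ).2
  rw [hθ', Real.cos_nat_mul_two_pi, mul_one] at h1
  have h2 := norm_pos_iff.2 (sub_ne_zero.2 (hd θ).1)
  rw [Complex.sub_re] at h1
  linarith

/-- A missing generator yields a set `A` of strings that stay weakly to the left over one period.
The monodromy preserves `A`, so they stay to the left for all later times, against the turning of a
difference. -/
theorem IsTurning.mem_of_isTimeWord {w : Fin n → ℝ → ℂ} (hw : IsTurning w)
    (π : Equiv.Perm (Fin n)) {T : ℝ} (hT : 0 < T) (hper : ∀ i θ, w i (θ + T) = w (π i) θ) {a : ℝ}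
    (ha : IsRegularTime w a) {l : List (Fin (n - 1))}
    (hl : IsTimeWord hw.continuous a (a + T) l) (m : Fin (n - 1)) : m ∈ l := by
  classical
  by_contra hm
  obtain ⟨A, hA, hA'⟩ := hl.2 m hm
  have haT : IsRegularTime w (a + T) := by
    have : (fun i => (w i (a + T)).re) = (fun i => (w i a).re) ∘ π := by
      funext i; simp [hper]
    unfold IsRegularTime
    rw [this]
    exact ha.comp π.injective
  -- At time `a + T` the leftmost `m + 1` strings are `A`, by separation there, and also the
  -- preimage of `A` under `π`, by separation at time `a`.
  have hπ : A = A.image π.symm := by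
    refine eq_of_card_eq_of_separated haT
      (Finset.card_image_of_injective _ π.symm.injective).symm
      (fun i hi j hj => hA' i hi j hj _ (Set.right_mem_Icc.2 (by linarith))) ?_
    intro i hi j hj
    obtain ⟨i, hiA, rfl⟩ := Finset.mem_image.1 hi
    obtain ⟨j, rfl⟩ := π.symm.surjective j
    simp only [hper, Equiv.apply_symm_apply]
    refine hA' i hiA j (fun h => hj (Finset.mem_image_of_mem _ h)) _ (Set.left_mem_Icc.2 (by linarith))
  have hmem : ∀ i, π i ∈ A ↔ i ∈ A := by
    intro i
    conv_rhs => rw [hπ]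
    rw [Finset.mem_image]
    exact ⟨fun h => ⟨π i, h, by simp⟩, by rintro ⟨j, hj, rfl⟩; simpa using hj⟩
  have hall : ∀ k : ℕ, ∀ i ∈ A, ∀ j ∉ A, ∀ θ, a ≤ θ → θ ≤ a + (k + 1) * T →
      (w i θ).re ≤ (w j θ).re := by
    intro k
    induction k with
    | zero =>
      intro i hi j hj θ h1 h2
      exact hA' i hi j hj θ ⟨h1, by simpa using h2⟩
    | succ k ih =>
      intro i hi j hj θ h1 h2
      by_cases h3 : θ ≤ a + T
      · exact hA' i hi j hj θ ⟨h1, h3⟩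
      have h4 : θ = (θ - T) + T := by ring
      rw [h4, hper, hper]
      refine ih _ ((hmem i).2 hi) _ (fun h => hj ((hmem j).1 h)) _ (by linarith) ?_
      push_cast at h2
      linarith
  -- Since `0 < m + 1 < n`, neither `A` nor its complement is empty.
  obtain ⟨i, hi⟩ : A.Nonempty := by rw [← Finset.card_pos]; omega
  obtain ⟨j, hj⟩ : ∃ j, j ∉ A := by
    by_contra! h
    have : A = Finset.univ := Finset.eq_univ_iff_forall.2 h
    rw [this, Finset.card_univ, Fintype.card_fin] at hA
    omega
  obtain ⟨θ, h1, h2⟩ := hw.exists_re_lt (i := i) (j := j) (by rintro rfl; exact hj hi) a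
  obtain ⟨k, hk⟩ := exists_nat_gt ((θ - a) / T)
  rw [div_lt_iff₀ hT] at hk
  exact (hall k i hi j hj θ h1 (by nlinarith)).not_gt h2

/-- Closed braids whose strings turn counterclockwise about each other are strictly positive. -/
theorem IsTurning.exists_isStrictlyPositive {w : Fin n → ℝ → ℂ} (hw : IsTurning w)
    (π : Equiv.Perm (Fin n)) (hper : ∀ i θ, w i (θ + 2 * Real.pi) = w (π i) θ) {p : Conf n}
    {l : Path p p} (hl : ∀ t : unitInterval, (l t).1 = ofTuple fun i => w i (2 * Real.pi * t)) :
    ∃ β : BraidGroup n, IsPositive β ∧ IsStrictlyPositive β ∧ IsClosureOf l β := by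
  let P : C(ℝ, Conf n) := ⟨fun θ => ⟨ofTuple fun i => w i θ,
    ofTuple_notMem_discriminantLocus (hw.injective θ)⟩,
    (continuous_ofTuple.comp (continuous_pi hw.continuous)).subtype_mk _⟩
  have hP : ∀ θ, P (θ + 2 * Real.pi) = P θ := by
    intro θ
    apply Subtype.ext
    change ofTuple _ = ofTuple _
    rw [← ofTuple_comp_perm (fun i => w i θ) π]
    congr 1
    funext i
    exact hper i θ
  -- Time `0` need not be regular. The word is read over a period from a regular time `a`, and the
  -- path `η` from time `a` back to time `0` accounts for the change of base point.
  obtain ⟨a, -, ha⟩ := hw.exists_isRegularTime (zero_lt_one' ℝ)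
  have ha' : IsRegularTime w (a + 2 * Real.pi) := by
    have : (fun i => (w i (a + 2 * Real.pi)).re) = (fun i => (w i a).re) ∘ π := by
      funext i; simp [hper]
    unfold IsRegularTime
    rw [this]
    exact ha.comp π.injective
  obtain ⟨L, hL⟩ := hw.exists_isTimeWord (by linarith [Real.two_pi_pos]) ha ha'
  have hmem := hw.mem_of_isTimeWord π Real.two_pi_pos hper ha hL
  refine ⟨(L.map (sigma n)).prod, ⟨L, rfl⟩, ⟨L, hmem, rfl⟩, ?_⟩
  obtain ⟨γ, hγ⟩ := exists_isLift (timePath hw.continuous a (a + 2 * Real.pi))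
    (fun t => hw.injective _) (p := P a) (q := P a) rfl (by rw [← hP a]; rfl)
  obtain ⟨c, d, hc, hd, hcd⟩ := hL.1 _ _ γ hγ
  have hp : p = P 0 := Subtype.ext ((congrArg Subtype.val l.source.symm).trans ((hl 0).trans (by simp [P])))
  obtain ⟨η, hη⟩ := exists_isLift (timePath hw.continuous a 0)
    (fun t => hw.injective _) (p := P a) (q := p) rfl (by rw [hp]; rfl)
  refine ⟨c.trans η, ?_⟩
  rw [← hcd]
  -- All pieces are traced by the strings along the time axis: from `a` to `0`, then to `2π`, and
  -- the reverse of `η`, read one period later, from `2π` to `a + 2π`. Paths in `ℝ` with the same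
  -- ends are homotopic.
  have hηl : (η.trans (l.trans η.symm)).Homotopic γ := by
    refine homotopic_of_factorization P
      ((linePath a 0).trans ((linePath 0 (2 * Real.pi)).trans
        (linePath (2 * Real.pi) (a + 2 * Real.pi)))) (linePath a (a + 2 * Real.pi)) ?_
      fun t => Subtype.ext (hγ t)
    refine trans_apply_of_apply (fun t => Subtype.ext (hη t)) (trans_apply_of_apply ?_ ?_)
    · intro t
      refine Subtype.ext ((hl t).trans ?_)
      simp [P, linePath_apply, mul_comm]
    · intro t
      rw [Path.symm_apply, Function.comp_apply]
      have h1 : η (unitInterval.symm t) = P (linePath a 0 (unitInterval.symm t)) :=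
        Subtype.ext (hη _)
      rw [h1, ← hP]
      congr 1
      simp [linePath_apply]
      ring
  have h1 := Path.Homotopic.Quotient.eq.2 hηl
  have h2 := Path.Homotopic.Quotient.eq.2 (hc.homotopic hd)
  unfold braidOfLoop
  simp only [Path.trans_symm, Path.Homotopic.Quotient.mk_trans, Path.Homotopic.Quotient.mk_symm] at h1 ⊢
  rw [← h1, ← h2]
  simp only [Path.Homotopic.Quotient.trans_assoc]

/-! ### Squarefree bivariate polynomials -/

/-- Gauss's lemma: the primitive part of a square factor with denominators cleared has a square that
is primitive, and this square already divides `f` over `R`. -/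
theorem squarefree_map_fractionRing {R : Type*} [CommRing R] [IsDomain R]
    [NormalizedGCDMonoid R] {f : R[X]} (hf : Squarefree f) :
    Squarefree (f.map (algebraMap R (FractionRing R))) := by
  intro x hx
  have hf0 : f.map (algebraMap R (FractionRing R)) ≠ 0 :=
    (Polynomial.map_ne_zero_iff (IsFractionRing.injective R (FractionRing R))).2 hf.ne_zero
  have hx0 : x ≠ 0 := by
    rintro rfl
    exact hf0 (by simpa using hx)
  set g := IsLocalization.integerNormalization (nonZeroDivisors R) x with hg
  obtain ⟨b, hb, hbx⟩ := IsLocalization.integerNormalization_spec (nonZeroDivisors R) x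
  have hb0 : algebraMap R (FractionRing R) b ≠ 0 :=
    IsFractionRing.to_map_ne_zero_of_mem_nonZeroDivisors hb
  have hdvd : g.primPart.map (algebraMap R (FractionRing R)) ∣ x := by
    have h1 : g.primPart.map (algebraMap R (FractionRing R)) ∣
        C (algebraMap R (FractionRing R) b) * x := by
      rw [← smul_eq_C_mul, algebraMap_smul, ← hbx]
      exact Polynomial.map_dvd _ g.primPart_dvd
    exact (isUnit_C.2 hb0.isUnit).dvd_mul_left.1 h1
  have hsq : g.primPart * g.primPart ∣ f := by
    refine (g.isPrimitive_primPart.mul g.isPrimitive_primPart).dvd_of_fraction_map_dvd_fraction_map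
      (K := FractionRing R) ?_
    rw [Polynomial.map_mul]
    exact (mul_dvd_mul hdvd hdvd).trans hx
  exact isUnit_or_eq_zero_of_isUnit_integerNormalization_primPart hx0 (hf _ hsq)

/-- In characteristic zero squarefree means separable over the fraction field; clearing the
denominators of the Bézout identity leaves a constant `D`. It plays the role of the discriminant:
where it does not vanish, the roots are simple. -/
theorem exists_mul_add_mul_derivative_eq_C {R : Type*} [CommRing R] [IsDomain R] [CharZero R]
    [NormalizedGCDMonoid R] {f : R[X]} (hf : Squarefree f) :
    ∃ (A B : R[X]) (D : R), D ≠ 0 ∧ A * f + B * derivative f = C D := by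
  have : CharZero (FractionRing R) :=
    charZero_of_injective_algebraMap (IsFractionRing.injective R (FractionRing R))
  obtain ⟨a, b, hab⟩ := PerfectField.separable_iff_squarefree.2 (squarefree_map_fractionRing hf)
  obtain ⟨c, hc, hca⟩ := IsLocalization.integerNormalization_spec (nonZeroDivisors R) a
  obtain ⟨d, hd, hdb⟩ := IsLocalization.integerNormalization_spec (nonZeroDivisors R) b
  refine ⟨C d * IsLocalization.integerNormalization (nonZeroDivisors R) a,
    C c * IsLocalization.integerNormalization (nonZeroDivisors R) b, d * c,
    mul_ne_zero (nonZeroDivisors.ne_zero hd) (nonZeroDivisors.ne_zero hc), ?_⟩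
  apply Polynomial.map_injective _ (IsFractionRing.injective R (FractionRing R))
  rw [derivative_map] at hab
  simp only [Polynomial.map_add, Polynomial.map_mul, hca, hdb, Polynomial.map_C, map_mul]
  rw [← algebraMap_smul (FractionRing R) c a, ← algebraMap_smul (FractionRing R) d b,
    smul_eq_C_mul, smul_eq_C_mul]
  linear_combination (C (algebraMap R (FractionRing R) d) * C (algebraMap R (FractionRing R) c)) * hab

/-! ### Bivariate polynomials as functions -/

theorem contDiff_evalEval (f : ℂ[X][Y]) :
    ContDiff ℂ 1 fun x : ℂ × ℂ => f.evalEval x.1 x.2 := by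
  induction f using Polynomial.induction_on' with
  | add p q hp hq => simpa [evalEval_add] using! hp.add hq
  | monomial k a =>
    have : (fun x : ℂ × ℂ => (monomial k a : ℂ[X][Y]).evalEval x.1 x.2) =
        fun x => a.eval x.1 * x.2 ^ k := by
      funext x; simp [evalEval, eval_monomial]
    rw [this]
    have ha : ContDiff ℂ 1 fun z => a.eval z := by
      simpa using Polynomial.contDiff_aeval a (𝕜 := ℂ) 1
    exact (ha.comp contDiff_fst).mul (contDiff_snd.pow k)

theorem continuous_evalEval (f : ℂ[X][Y]) :
    Continuous fun x : ℂ × ℂ => f.evalEval x.1 x.2 := (contDiff_evalEval f).continuous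

theorem hasDerivAt_evalEval (f : ℂ[X][Y]) (z w : ℂ) :
    HasDerivAt (fun w => f.evalEval z w) ((derivative f).evalEval z w) w := by
  have h := (f.map (evalRingHom z)).hasDerivAt w
  rw [derivative_map, map_evalRingHom_eval] at h
  simpa only [map_evalRingHom_eval] using h

/-- A simple root depends analytically on the parameter. -/
theorem exists_implicit_root (f : ℂ[X][Y]) {z₀ w₀ : ℂ} (h0 : f.evalEval z₀ w₀ = 0)
    (h1 : (derivative f).evalEval z₀ w₀ ≠ 0) :
    ∃ s : ℂ → ℂ, s z₀ = w₀ ∧ DifferentiableAt ℂ s z₀ ∧ (∃ U ∈ nhds z₀, ContinuousOn s U) ∧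
      ∀ᶠ z in nhds z₀, f.evalEval z (s z) = 0 := by
  let g : ℂ × ℂ → ℂ := fun x => f.evalEval x.1 x.2
  have hg : HasStrictFDerivAt g (fderiv ℂ g (z₀, w₀)) (z₀, w₀) :=
    (contDiff_evalEval f).contDiffAt.hasStrictFDerivAt one_ne_zero
  have hd : (fderiv ℂ g (z₀, w₀) ∘L .inr ℂ ℂ ℂ) =
      ContinuousLinearMap.toSpanSingleton ℂ ((derivative f).evalEval z₀ w₀) := by
    have h2 : HasFDerivAt (fun w => f.evalEval z₀ w) (fderiv ℂ g (z₀, w₀) ∘L .inr ℂ ℂ ℂ) w₀ :=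
      HasFDerivAt.comp (g := g) (f := fun w => (z₀, w)) w₀ hg.hasFDerivAt
        (hasFDerivAt_prodMk_right z₀ w₀)
    exact h2.unique (hasDerivAt_evalEval f z₀ w₀).hasFDerivAt
  have hinv : (fderiv ℂ g (z₀, w₀) ∘L .inr ℂ ℂ ℂ).IsInvertible := by
    refine ⟨ContinuousLinearEquiv.unitsEquivAut ℂ (Units.mk0 _ h1), ?_⟩
    rw [hd]
    ext
    simp
  have hs := hg.hasStrictFDerivAt_implicitFunctionOfProdDomain hinv
  refine ⟨hg.implicitFunctionOfProdDomain hinv, ?_, hs.differentiableAt, ?_, ?_⟩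
  · exact (hg.eventually_apply_eq_iff_implicitFunctionOfProdDomain hinv).self_of_nhds.1 rfl
  · obtain ⟨K, U, hU, hK⟩ := hs.exists_lipschitzOnWith
    exact ⟨U, hU, hK.continuousOn⟩
  · filter_upwards [hg.eventually_apply_implicitFunctionOfProdDomain hinv] with z hz
    rw [← h0]
    exact hz

/-! ### The number of roots in a disk -/

theorem circleIntegral_sub_inv_of_lt_norm {δ : ℝ} (hδ : 0 ≤ δ) {r : ℂ} (hr : δ < ‖r‖) :
    (∮ w in C(0, δ), (w - r)⁻¹) = 0 := by
  have hne : ∀ w ∈ Metric.closedBall (0 : ℂ) δ, w - r ≠ 0 := by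
    intro w hw h
    rw [sub_eq_zero.1 h] at hw
    exact absurd hr (by simpa using hw)
  refine DiffContOnCl.circleIntegral_eq_zero hδ (DifferentiableOn.diffContOnCl ?_)
  intro w hw
  have := hne w (Metric.closure_ball_subset_closedBall hw)
  exact ((differentiableAt_id.sub_const r).inv this).differentiableWithinAt

/-- Continuity on the circle is carried through the induction because splitting the integral of the
sum needs integrability. -/
theorem circleIntegral_sum_sub_inv {δ : ℝ} (hδ : 0 < δ) (s : Multiset ℂ)
    (hs : ∀ r ∈ s, ‖r‖ ≠ δ) :
    ContinuousOn (fun w => (s.map fun r => (w - r)⁻¹).sum) (Metric.sphere 0 δ) ∧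
    (∮ w in C(0, δ), (s.map fun r => (w - r)⁻¹).sum) =
      2 * Real.pi * Complex.I * (s.filter fun r => ‖r‖ < δ).card := by
  induction s using Multiset.induction_on with
  | empty => simp [continuousOn_const, circleIntegral]
  | cons r s ih =>
    obtain ⟨ih1, ih2⟩ := ih fun r hr => hs r (Multiset.mem_cons_of_mem hr)
    have hr := hs r (Multiset.mem_cons_self r s)
    have hc : ContinuousOn (fun w => (w - r)⁻¹) (Metric.sphere 0 δ) := by
      refine ContinuousOn.inv₀ (by fun_prop) fun w hw h => hr ?_
      rw [← sub_eq_zero.1 h]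
      simpa using hw
    simp only [Multiset.map_cons, Multiset.sum_cons]
    refine ⟨hc.add ih1, ?_⟩
    rw [circleIntegral.integral_add (hc.circleIntegrable hδ.le) (ih1.circleIntegrable hδ.le), ih2]
    rcases lt_or_gt_of_ne hr with h | h
    · rw [circleIntegral.integral_sub_inv_of_mem_ball (by simpa using h),
        Multiset.filter_cons_of_pos (p := fun r : ℂ => ‖r‖ < δ) _ h, Multiset.card_cons]
      push_cast
      ring
    · rw [circleIntegral_sub_inv_of_lt_norm hδ.le h,
        Multiset.filter_cons_of_neg (p := fun r : ℂ => ‖r‖ < δ) _ h.not_gt, zero_add]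

/-- The argument principle for polynomials: the logarithmic derivative is the sum of `1 / (w - r)`
over all roots. -/
theorem card_localRoots_eq (f : ℂ[X][Y]) {δ : ℝ} (hδ : 0 < δ) {z : ℂ}
    (h : ∀ w, ‖w‖ = δ → f.evalEval z w ≠ 0) :
    (∮ w in C(0, δ), (derivative f).evalEval z w / f.evalEval z w) =
      2 * Real.pi * Complex.I * (localRoots f δ z).card := by
  have hroots : ∀ r ∈ (f.map (evalRingHom z)).roots, ‖r‖ ≠ δ := by
    intro r hr hrδ
    refine h r hrδ ?_
    rw [← map_evalRingHom_eval]
    exact (mem_roots'.1 hr).2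
  have := (circleIntegral_sum_sub_inv hδ _ hroots).2
  unfold localRoots
  convert! this using 1
  refine circleIntegral.integral_congr hδ.le fun w hw => ?_
  have hw' := h w (by simpa using hw)
  rw [← map_evalRingHom_eval] at hw'
  have h2 := (IsAlgClosed.splits (f.map (evalRingHom z))).eval_derivative_div_eval_of_ne_zero hw'
  rw [derivative_map, map_evalRingHom_eval, map_evalRingHom_eval] at h2
  simpa only [one_div] using! h2

/-- The integral that counts the roots depends continuously on `z` at `0`, and a continuous count
with integer values is locally constant. -/
theorem eventually_card_localRoots_eq (f : ℂ[X][Y]) {δ : ℝ} (hδ : 0 < δ)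
    (h : ∀ w, ‖w‖ = δ → f.evalEval 0 w ≠ 0) :
    ∀ᶠ z in nhds (0 : ℂ), (∀ w, ‖w‖ = δ → f.evalEval z w ≠ 0) ∧
      (localRoots f δ z).card = (localRoots f δ 0).card := by
  have hsph : ∀ w, w ∈ Metric.sphere (0 : ℂ) δ ↔ ‖w‖ = δ := by simp
  have h1 : ∀ᶠ z in nhds (0 : ℂ), ∀ w ∈ Metric.sphere (0 : ℂ) δ, f.evalEval z w ≠ 0 := by
    refine (isCompact_sphere 0 δ).eventually_forall_of_forall_eventually fun w hw => ?_
    exact (continuous_evalEval f).continuousAt.eventually_ne (h w ((hsph w).1 hw))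
  have h2 : TendstoUniformlyOn (fun z w => (derivative f).evalEval z w / f.evalEval z w)
      (fun w => (derivative f).evalEval 0 w / f.evalEval 0 w) (nhds 0) (Metric.sphere 0 δ) := by
    rw [Metric.tendstoUniformlyOn_iff]
    intro η hη
    refine (isCompact_sphere 0 δ).eventually_forall_of_forall_eventually fun w hw => ?_
    have hw' := h w ((hsph w).1 hw)
    have c1 : ContinuousAt (fun x : ℂ × ℂ => (derivative f).evalEval x.1 x.2 / f.evalEval x.1 x.2)
        (0, w) := (continuous_evalEval _).continuousAt.div (continuous_evalEval _).continuousAt hw'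
    have c2 : ContinuousAt (fun x : ℂ × ℂ => (derivative f).evalEval 0 x.2 / f.evalEval 0 x.2)
        (0, w) := by
      refine ContinuousAt.div ?_ ?_ hw'
      · exact ((continuous_evalEval (derivative f)).comp (by fun_prop :
          Continuous fun x : ℂ × ℂ => ((0 : ℂ), x.2))).continuousAt
      · exact ((continuous_evalEval f).comp (by fun_prop :
          Continuous fun x : ℂ × ℂ => ((0 : ℂ), x.2))).continuousAt
    have := Filter.Tendsto.dist c2 c1
    simp only [dist_self] at this
    exact this.eventually_lt_const hη
  have h3 : ∀ᶠ z in nhds (0 : ℂ), ContinuousOn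
      (fun w => (derivative f).evalEval z w / f.evalEval z w) (Metric.sphere 0 δ) := by
    filter_upwards [h1] with z hz
    refine ContinuousOn.div ?_ ?_ hz
    · exact ((continuous_evalEval (derivative f)).comp (by fun_prop :
          Continuous fun w : ℂ => (z, w))).continuousOn
    · exact ((continuous_evalEval f).comp (by fun_prop :
          Continuous fun w : ℂ => (z, w))).continuousOn
  have h4 := h2.tendsto_circleIntegral_of_continuousOn hδ.le h3
  rw [card_localRoots_eq f hδ h] at h4
  have h5 : Filter.Tendsto (fun z => ((localRoots f δ z).card : ℂ)) (nhds 0)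
      (nhds ((localRoots f δ 0).card : ℂ)) := by
    have h6 := h4.const_mul (2 * Real.pi * Complex.I)⁻¹
    rw [inv_mul_cancel_left₀ Complex.two_pi_I_ne_zero] at h6
    refine h6.congr' ?_
    filter_upwards [h1] with z hz
    rw [card_localRoots_eq f hδ fun w hw => hz w ((hsph w).2 hw),
      inv_mul_cancel_left₀ Complex.two_pi_I_ne_zero]
  have h7 : ∀ᶠ z in nhds (0 : ℂ),
      dist ((localRoots f δ z).card : ℂ) ((localRoots f δ 0).card : ℂ) < 1 :=
    Metric.tendsto_nhds.1 h5 1 one_pos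
  filter_upwards [h1, h7] with z hz hz'
  refine ⟨fun w hw => hz w ((hsph w).2 hw), ?_⟩
  rw [Complex.dist_eq, ← Int.cast_natCast, ← Int.cast_natCast (R := ℂ), ← Int.cast_sub,
    Complex.norm_intCast] at hz'
  have : |((localRoots f δ z).card : ℤ) - (localRoots f δ 0).card| < 1 := by exact_mod_cast hz'
  rw [Int.abs_lt_one_iff] at this
  omega

/-! ### Local and global sections of a multivalued function -/

/-- A selection from finitely many continuous functions with distinct values is constant. -/
theorem exists_eqOn_of_forall_exists_eq {A ι : Type*} [TopologicalSpace A] [Finite ι] {S : Set A}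
    (hS : IsPreconnected S) (hne : S.Nonempty) {u : A → ℂ} {w : ι → A → ℂ} (hu : ContinuousOn u S)
    (hw : ∀ i, ContinuousOn (w i) S) (hinj : ∀ a ∈ S, Function.Injective fun i => w i a)
    (h : ∀ a ∈ S, ∃ i, u a = w i a) : ∃ i, ∀ a ∈ S, u a = w i a := by
  classical
  obtain ⟨a₀, ha₀⟩ := hne
  obtain ⟨i₀, hi₀⟩ := h a₀ ha₀
  let idx : A → ι := fun a => if ha : a ∈ S then (h a ha).choose else i₀
  have hidx : ∀ a ∈ S, u a = w (idx a) a := by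
    intro a ha
    simp only [idx, ha, dif_pos]
    exact (h a ha).choose_spec
  -- With discrete indices the selection is continuous: at nearby points `u` still differs from
  -- every branch other than the selected one.
  let : TopologicalSpace ι := ⊥
  have : DiscreteTopology ι := ⟨rfl⟩
  have hcont : ContinuousOn idx S := by
    intro a ha
    rw [ContinuousWithinAt, nhds_discrete, Filter.tendsto_pure]
    have h1 : ∀ᶠ b in nhdsWithin a S, ∀ i, i ≠ idx a → u b ≠ w i b := by
      rw [Filter.eventually_all]
      intro i
      by_cases hi : i = idx a
      · exact Filter.Eventually.of_forall fun b hb => absurd hi hb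
      · have hne : u a - w i a ≠ 0 := by
          rw [hidx a ha]
          exact sub_ne_zero.2 ((hinj a ha).ne (Ne.symm hi))
        filter_upwards [((hu a ha).sub (hw i a ha)).eventually_ne hne] with b hb _
        exact sub_ne_zero.1 hb
    filter_upwards [h1, self_mem_nhdsWithin] with b hb hbS
    by_contra hcon
    exact hb _ hcon (hidx b hbS)
  refine ⟨idx a₀, fun a ha => ?_⟩
  rw [hidx a ha, hS.constant hcont ha ha₀]

/-- The sheets are the graphs of the local sections. The sheet number of a point is locally
constant, because being off the finitely many other graphs is an open condition. -/
theorem isCoveringMap_of_local_sections {A : Type*} [TopologicalSpace A] {n : ℕ} {R : A → Set ℂ}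
    (hloc : ∀ a₀, ∃ U ∈ nhds a₀, ∃ s : Fin n → A → ℂ, (∀ j, ContinuousOn (s j) U) ∧
      ∀ a ∈ U, (Function.Injective fun j => s j a) ∧ R a = Set.range fun j => s j a) :
    IsCoveringMap fun x : {x : A × ℂ // x.2 ∈ R x.1} => x.1.1 := by
  intro a₀
  obtain ⟨V, hV, s, hs, hR⟩ := hloc a₀
  obtain ⟨U, hUV, hU, haU⟩ := mem_nhds_iff.1 hV
  apply IsEvenlyCovered.to_isEvenlyCovered_preimage (I := Fin n)
  let p : {x : A × ℂ // x.2 ∈ R x.1} → A := fun x => x.1.1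
  have hp : Continuous p := by fun_prop
  have hmem : ∀ x : p ⁻¹' U, ∃ j, s j x.1.1.1 = x.1.1.2 := by
    intro x
    have h1 := x.1.2
    rw [(hR _ (hUV x.2)).2] at h1
    exact h1
  choose idx hidx using hmem
  have hsU : ∀ j, Continuous fun x : p ⁻¹' U => s j x.1.1.1 := fun j =>
    (hs j).comp_continuous (by fun_prop) fun x => hUV x.2
  have hcidx : Continuous idx := by
    rw [continuous_discrete_rng]
    intro j
    have : idx ⁻¹' {j} = ⋂ i ∈ {i : Fin n | i ≠ j}, {x : p ⁻¹' U | s i x.1.1.1 ≠ x.1.1.2} := by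
      ext x
      simp only [Set.mem_preimage, Set.mem_singleton_iff, Set.mem_iInter, Set.mem_ofPred_eq]
      refine ⟨?_, fun h => ?_⟩
      · rintro rfl i hi h
        exact hi ((hR _ (hUV x.2)).1 (h.trans (hidx x).symm))
      · by_contra hne
        exact h _ hne (hidx x)
    rw [this]
    refine (Set.toFinite _).isOpen_biInter fun i _ => ?_
    exact isOpen_ne_fun (hsU i) (by fun_prop)
  refine ⟨inferInstance, U, haU, hU, hU.preimage hp, ?_⟩
  refine ⟨{ toFun := fun x => (⟨x.1.1.1, x.2⟩, idx x)
            invFun := fun y => ⟨⟨(y.1.1, s y.2 y.1.1), ?_⟩, y.1.2⟩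
            left_inv := ?_
            right_inv := ?_
            continuous_toFun := ?_
            continuous_invFun := ?_ }, fun x => rfl⟩
  · rw [(hR _ (hUV y.1.2)).2]
    exact ⟨y.2, rfl⟩
  · intro x
    apply Subtype.ext
    apply Subtype.ext
    exact Prod.ext rfl (hidx x)
  · intro y
    refine Prod.ext rfl ?_
    exact (hR _ (hUV y.1.2)).1 (hidx _)
  · exact Continuous.prodMk (by fun_prop) hcidx
  · refine Continuous.subtype_mk (Continuous.subtype_mk (Continuous.prodMk (by fun_prop) ?_) _) _
    refine continuous_prod_of_discrete_right.2 fun j => ?_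
    exact (hs j).comp_continuous (by fun_prop) fun x => hUV x.2

/-- The identity of the simply connected base lifts through the covering, starting at each of the
`n` points over `a₀`. Uniqueness of lifts keeps them distinct, and counting shows that they exhaust
every fibre. -/
theorem exists_global_sections {A : Type*} [TopologicalSpace A] [SimplyConnectedSpace A]
    [LocallyPathConnectedSpace A] {n : ℕ} {R : A → Set ℂ}
    (hloc : ∀ a₀, ∃ U ∈ nhds a₀, ∃ s : Fin n → A → ℂ, (∀ j, ContinuousOn (s j) U) ∧
      ∀ a ∈ U, (Function.Injective fun j => s j a) ∧ R a = Set.range fun j => s j a) :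
    ∃ w : Fin n → A → ℂ, (∀ j, Continuous (w j)) ∧
      ∀ a, (Function.Injective fun j => w j a) ∧ R a = Set.range fun j => w j a := by
  have hcov := isCoveringMap_of_local_sections hloc
  obtain ⟨a₀⟩ : Nonempty A := inferInstance
  obtain ⟨U, hU, s, -, hs⟩ := hloc a₀
  have hs₀ := hs a₀ (mem_of_mem_nhds hU)
  have hex : ∀ j, ∃ F : C(A, {x : A × ℂ // x.2 ∈ R x.1}), (F a₀).1 = (a₀, s j a₀) ∧
      ∀ a, (F a).1.1 = a := by
    intro j
    obtain ⟨F, ⟨h1, h2⟩, -⟩ := hcov.existsUnique_continuousMap_lifts (ContinuousMap.id A) a₀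
      ⟨(a₀, s j a₀), by rw [hs₀.2]; exact ⟨j, rfl⟩⟩ rfl
    exact ⟨F, by rw [h1], fun a => congrFun h2 a⟩
  choose F hF₀ hF using hex
  have hinj : ∀ a, Function.Injective fun j => (F j a).1.2 := by
    intro a i j hij
    have h1 : F i a = F j a := Subtype.ext (Prod.ext ((hF i a).trans (hF j a).symm) hij)
    have h2 : (F i : A → _) = F j := hcov.eq_of_comp_eq (F i).continuous (F j).continuous
      (funext fun b => (hF i b).trans (hF j b).symm) a h1
    refine hs₀.1 ?_
    have h3 := hF₀ i
    rw [h2, hF₀ j] at h3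
    exact (congrArg Prod.snd h3).symm
  refine ⟨fun j a => (F j a).1.2, fun j => by fun_prop, fun a => ⟨hinj a, ?_⟩⟩
  obtain ⟨V, hV, t, -, ht⟩ := hloc a
  have ht := ht a (mem_of_mem_nhds hV)
  have hfin : (R a).Finite := by rw [ht.2]; exact Set.finite_range _
  symm
  refine Set.eq_of_subset_of_ncard_le ?_ ?_ hfin
  · rintro _ ⟨j, rfl⟩
    have := (F j a).2
    rwa [hF j a] at this
  · rw [ht.2, ← Set.image_univ, ← Set.image_univ, Set.ncard_image_of_injective _ ht.1,
      Set.ncard_image_of_injective _ (hinj a)]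

/-! ### The roots near the origin -/

theorem exists_tuple_of_card_eq {m : Multiset ℂ} (hm : m.card = n) :
    ∃ r : Fin n → ℂ, (Finset.univ : Finset (Fin n)).val.map r = m := by
  subst hm
  refine ⟨fun i => m.toList[i]'(by simp), ?_⟩
  conv_rhs => rw [← m.coe_toList]
  rw [Fin.univ_val_map]
  congr 1
  apply List.ext_getElem <;> simp

theorem nodup_map_univ_iff {r : Fin n → ℂ} :
    ((Finset.univ : Finset (Fin n)).val.map r).Nodup ↔ Function.Injective r := by
  refine ⟨fun h i j hij => ?_, fun h => Finset.univ.nodup.map h⟩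
  exact Multiset.inj_on_of_nodup_map h i (Finset.mem_univ i) j (Finset.mem_univ j) hij

theorem mem_localRoots {f : ℂ[X][Y]} {δ : ℝ} {z w : ℂ} :
    w ∈ localRoots f δ z ↔ f.map (evalRingHom z) ≠ 0 ∧ f.evalEval z w = 0 ∧ ‖w‖ < δ := by
  unfold localRoots
  rw [Multiset.mem_filter, mem_roots', IsRoot, map_evalRingHom_eval, and_assoc]

theorem nodup_localRoots {f : ℂ[X][Y]} {δ : ℝ} {z : ℂ}
    (h : ∀ w, f.evalEval z w = 0 → (derivative f).evalEval z w ≠ 0) : (localRoots f δ z).Nodup := by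
  classical
  unfold localRoots
  refine Multiset.Nodup.filter _ ?_
  by_cases h0 : f.map (evalRingHom z) = 0
  · simp [h0]
  rw [Multiset.nodup_iff_count_le_one]
  intro w
  rw [count_roots]
  by_contra hlt
  rw [not_le, one_lt_rootMultiplicity_iff_isRoot h0, IsRoot, IsRoot, derivative_map,
    map_evalRingHom_eval, map_evalRingHom_eval] at hlt
  exact h w hlt.1 hlt.2

/-- Each simple root continues by the implicit function theorem. The continuations are `n` distinct
roots in the disk, and the constant count leaves room for no others. -/
theorem exists_local_roots {f : ℂ[X][Y]} {δ : ℝ} {z₀ : ℂ}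
    (hcard : ∀ᶠ z in nhds z₀, (localRoots f δ z).card = n)
    (hsimple : ∀ w, f.evalEval z₀ w = 0 → (derivative f).evalEval z₀ w ≠ 0) :
    ∃ s : Fin n → ℂ → ℂ, (∀ j, DifferentiableAt ℂ (s j) z₀) ∧ ∃ U ∈ nhds z₀,
      (∀ j, ContinuousOn (s j) U) ∧ ∀ z ∈ U, (Function.Injective fun j => s j z) ∧
        localRoots f δ z = (Finset.univ : Finset (Fin n)).val.map fun j => s j z := by
  obtain ⟨r, hr⟩ := exists_tuple_of_card_eq hcard.self_of_nhds
  have hrinj : Function.Injective r := by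
    rw [← nodup_map_univ_iff, hr]
    exact nodup_localRoots hsimple
  have hmem : ∀ j, f.evalEval z₀ (r j) = 0 ∧ ‖r j‖ < δ := fun j =>
    (mem_localRoots.1 (hr ▸ Multiset.mem_map_of_mem r (Finset.mem_univ j))).2
  choose s hs₀ hsd hsU hsr using fun j =>
    exists_implicit_root f (hmem j).1 (hsimple _ (hmem j).1)
  choose U hU hUc using hsU
  have h1 : ∀ᶠ z in nhds z₀, ∀ j, z ∈ U j := Filter.eventually_all.2 fun j => hU j
  have h2 : ∀ᶠ z in nhds z₀, ∀ j, ‖s j z‖ < δ := Filter.eventually_all.2 fun j =>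
    (hsd j).continuousAt.norm.eventually_lt_const (by
      change ‖s j z₀‖ < δ
      rw [hs₀]
      exact (hmem j).2)
  have h3 : ∀ᶠ z in nhds z₀, ∀ j, f.evalEval z (s j z) = 0 := Filter.eventually_all.2 hsr
  have h4 : ∀ᶠ z in nhds z₀, ∀ i j, i ≠ j → s i z - s j z ≠ 0 := by
    refine Filter.eventually_all.2 fun i => Filter.eventually_all.2 fun j => ?_
    by_cases hij : i = j
    · exact Filter.Eventually.of_forall fun z h => absurd hij h
    · have hne : (s i - s j) z₀ ≠ 0 := by
        rw [Pi.sub_apply, hs₀, hs₀]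
        exact sub_ne_zero.2 (hrinj.ne hij)
      filter_upwards [((hsd i).continuousAt.sub (hsd j).continuousAt).eventually_ne hne]
        with z hz _ using hz
  refine ⟨s, hsd, _, (h1.and (h2.and (h3.and (h4.and hcard)))), ?_, ?_⟩
  · exact fun j z hz => (hUc j z (hz.1 j)).mono fun z hz => hz.1 j
  · rintro z ⟨-, hz2, hz3, hz4, hz5⟩
    have hinj : Function.Injective fun j => s j z := by
      intro i j hij
      by_contra hne
      exact hz4 i j hne (sub_eq_zero.2 hij)
    refine ⟨hinj, ?_⟩
    symm
    refine Multiset.eq_of_le_of_card_le ?_ (by rw [hz5]; simp)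
    rw [Multiset.le_iff_subset (nodup_map_univ_iff.2 hinj)]
    intro w hw
    obtain ⟨j, -, rfl⟩ := Multiset.mem_map.1 hw
    refine mem_localRoots.2 ⟨fun h0 => ?_, hz3 j, hz2 j⟩
    have : localRoots f δ z = 0 := by simp [localRoots, h0]
    rw [this] at hz5
    have := j.2
    simp at hz5
    omega

/-- The coordinate `τ`, `z = exp (I τ)`, uniformizes the roots near the origin: over the half plane
`c < Im τ` they are the `n` functions `w i`, and `π` is their monodromy. -/
structure IsUniformization (f : ℂ[X][Y]) (δ c : ℝ) (w : Fin n → ℂ → ℂ)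
    (π : Equiv.Perm (Fin n)) : Prop where
  differentiableAt : ∀ i τ, c < τ.im → DifferentiableAt ℂ (w i) τ
  injective : ∀ τ, c < τ.im → Function.Injective fun i => w i τ
  roots : ∀ τ, c < τ.im → localRoots f δ (Complex.exp (Complex.I * τ)) =
    (Finset.univ : Finset (Fin n)).val.map fun i => w i τ
  period : ∀ i τ, w i (τ + 2 * Real.pi) = w (π i) τ
  tendsto_zero : ∀ i, Filter.Tendsto (w i) (Filter.comap Complex.im Filter.atTop) (nhds 0)
  boundary : ∀ z w, ‖z‖ < Real.exp (-c) → ‖w‖ = δ → f.evalEval z w ≠ 0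
  center : localRoots f δ 0 = Multiset.replicate n 0

theorem convex_halfPlane (c : ℝ) : Convex ℝ {τ : ℂ | c < τ.im} :=
  convex_halfSpace_im_gt c

theorem norm_exp_I_mul (τ : ℂ) : ‖Complex.exp (Complex.I * τ)‖ = Real.exp (-τ.im) := by
  rw [Complex.norm_exp]; simp

theorem tendsto_exp_I_mul :
    Filter.Tendsto (fun τ => Complex.exp (Complex.I * τ))
      (Filter.comap Complex.im Filter.atTop) (nhds 0) := by
  rw [tendsto_zero_iff_norm_tendsto_zero]
  simp only [norm_exp_I_mul]
  exact Real.tendsto_exp_neg_atTop_nhds_zero.comp Filter.tendsto_comap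

/-- The half plane is simply connected, so the local roots, pulled back by `z = exp (I τ)`, glue to
global functions. -/
theorem exists_isUniformization_of_card {f : ℂ[X][Y]} {δ c : ℝ}
    (hcard : ∀ z, ‖z‖ < Real.exp (-c) → (localRoots f δ z).card = n)
    (hsimple : ∀ z w, z ≠ 0 → ‖z‖ < Real.exp (-c) → f.evalEval z w = 0 →
      (derivative f).evalEval z w ≠ 0)
    (hboundary : ∀ z w, ‖z‖ < Real.exp (-c) → ‖w‖ = δ → f.evalEval z w ≠ 0)
    (hcenter : localRoots f δ 0 = Multiset.replicate n 0)
    (hsmall : ∀ η > 0, ∀ᶠ z in nhds (0 : ℂ), ∀ w ∈ localRoots f δ z, ‖w‖ < η) :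
    ∃ (w : Fin n → ℂ → ℂ) (π : Equiv.Perm (Fin n)), IsUniformization f δ c w π := by
  classical
  let H : Set ℂ := {τ : ℂ | c < τ.im}
  have hHo : IsOpen H := isOpen_lt continuous_const Complex.continuous_im
  have hHc : Convex ℝ H := convex_halfPlane c
  have hHne : H.Nonempty := ⟨(c + 1 : ℝ) * Complex.I, by simp [H]⟩
  have hnorm : ∀ τ ∈ H, ‖Complex.exp (Complex.I * τ)‖ < Real.exp (-c) := by
    intro τ hτ
    rw [norm_exp_I_mul]
    exact Real.exp_lt_exp.2 (neg_lt_neg hτ)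
  have hexp : Continuous fun τ : ℂ => Complex.exp (Complex.I * τ) := by fun_prop
  have hloc : ∀ τ₀ ∈ H, ∃ s : Fin n → ℂ → ℂ, (∀ j, DifferentiableAt ℂ (s j)
      (Complex.exp (Complex.I * τ₀))) ∧ ∃ U ∈ nhds (Complex.exp (Complex.I * τ₀)),
      (∀ j, ContinuousOn (s j) U) ∧ ∀ z ∈ U, (Function.Injective fun j => s j z) ∧
        localRoots f δ z = (Finset.univ : Finset (Fin n)).val.map fun j => s j z := by
    intro τ₀ hτ₀
    refine exists_local_roots ?_ fun w => hsimple _ w (Complex.exp_ne_zero _) (hnorm _ hτ₀)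
    filter_upwards [(isOpen_lt continuous_norm continuous_const).mem_nhds (hnorm _ hτ₀)] with z hz
    exact hcard z hz
  have : ContractibleSpace H := hHc.contractibleSpace hHne
  have : LocallyPathConnectedSpace H := hHo.locallyPathConnectedSpace
  obtain ⟨v, hvc, hv⟩ := exists_global_sections (A := H) (n := n)
    (R := fun τ => {w | w ∈ localRoots f δ (Complex.exp (Complex.I * τ.1))}) (by
      intro τ₀
      obtain ⟨s, -, U, hU, hsc, hs⟩ := hloc τ₀.1 τ₀.2
      refine ⟨(fun τ : H => Complex.exp (Complex.I * τ.1)) ⁻¹' U,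
        (hexp.comp continuous_subtype_val).continuousAt hU,
        fun j τ => s j (Complex.exp (Complex.I * τ.1)), ?_, ?_⟩
      · exact fun j => (hsc j).comp (hexp.comp continuous_subtype_val).continuousOn
          fun τ hτ => hτ
      · intro τ hτ
        refine ⟨(hs _ hτ).1, ?_⟩
        ext w
        rw [Set.mem_ofPred_eq, (hs _ hτ).2]
        simp)
  -- The translation by `2π` preserves the half plane, so the value `0` outside it makes the rule
  -- `period` hold for every `τ`.
  let w : Fin n → ℂ → ℂ := fun i τ => if h : τ ∈ H then v i ⟨τ, h⟩ else 0
  have hwv : ∀ i (τ : H), w i τ = v i τ := fun i τ => by simp [w]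
  have hwc : ∀ i, ContinuousOn (w i) H := fun i => by
    rw [continuousOn_iff_continuous_domRestrict]
    exact (hvc i).congr fun τ => (hwv i τ).symm
  have hinj : ∀ τ ∈ H, Function.Injective fun i => w i τ := by
    intro τ hτ
    have := (hv ⟨τ, hτ⟩).1
    simpa only [← hwv] using this
  have hmem : ∀ τ ∈ H, ∀ x, x ∈ localRoots f δ (Complex.exp (Complex.I * τ)) ↔ ∃ i, w i τ = x := by
    intro τ hτ x
    have := Set.ext_iff.1 (hv ⟨τ, hτ⟩).2 x
    simpa only [← hwv, Set.mem_ofPred_eq, Set.mem_range] using this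
  have hroots : ∀ τ ∈ H, localRoots f δ (Complex.exp (Complex.I * τ)) =
      (Finset.univ : Finset (Fin n)).val.map fun i => w i τ := by
    intro τ hτ
    refine (Multiset.Nodup.ext (nodup_localRoots fun w =>
      hsimple _ w (Complex.exp_ne_zero _) (hnorm _ hτ)) (nodup_map_univ_iff.2 (hinj τ hτ))).2 ?_
    intro x
    rw [hmem τ hτ]
    simp
  -- Near `τ` the global function agrees with one local root. Local roots are only known to be
  -- differentiable at the centre of their neighbourhood, so they are taken afresh at each `τ`.
  have hdiff : ∀ i, ∀ τ ∈ H, DifferentiableAt ℂ (w i) τ := by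
    intro i τ hτ
    obtain ⟨s, hsd, U, hU, hsc, hs⟩ := hloc τ hτ
    have hU' : ∀ᶠ σ in nhds τ, Complex.exp (Complex.I * σ) ∈ U := hexp.continuousAt hU
    have hrange : ∀ σ ∈ H, Complex.exp (Complex.I * σ) ∈ U →
        ∃ j, s j (Complex.exp (Complex.I * σ)) = w i σ := by
      intro σ hσ hσU
      have h1 := (hmem σ hσ (w i σ)).2 ⟨i, rfl⟩
      rw [(hs _ hσU).2] at h1
      simpa using h1
    obtain ⟨j, hj⟩ := hrange τ hτ (mem_of_mem_nhds hU)
    have hne : ∀ᶠ σ in nhds τ, ∀ k, k ≠ j → s k (Complex.exp (Complex.I * σ)) ≠ w i σ := by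
      rw [Filter.eventually_all]
      intro k
      by_cases hk : k = j
      · exact Filter.Eventually.of_forall fun σ h => absurd hk h
      · have h1 : s k (Complex.exp (Complex.I * τ)) - w i τ ≠ 0 := by
          rw [← hj]
          exact sub_ne_zero.2 ((hs _ (mem_of_mem_nhds hU)).1.ne hk)
        have h2 : ContinuousAt (fun σ => s k (Complex.exp (Complex.I * σ)) - w i σ) τ :=
          (ContinuousAt.comp (f := fun σ => Complex.exp (Complex.I * σ)) (hsd k).continuousAt
            hexp.continuousAt).sub ((hwc i).continuousAt (hHo.mem_nhds hτ))
        filter_upwards [h2.eventually_ne h1] with σ hσ _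
        exact sub_ne_zero.1 hσ
    have heq : w i =ᶠ[nhds τ] fun σ => s j (Complex.exp (Complex.I * σ)) := by
      filter_upwards [hne, hU', hHo.mem_nhds hτ] with σ h1 h2 h3
      obtain ⟨k, hk⟩ := hrange σ h3 h2
      by_cases hkj : k = j
      · rw [← hk, hkj]
      · exact absurd hk (h1 k hkj)
    refine DifferentiableAt.congr_of_eventuallyEq ?_ heq
    exact DifferentiableAt.fun_comp' τ (hsd j) (by fun_prop)
  have hshift : ∀ τ : ℂ, τ + 2 * Real.pi ∈ H ↔ τ ∈ H := by
    intro τ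
    simp [H]
  have hperiod : ∀ i, ∃ j, ∀ τ ∈ H, w i (τ + 2 * Real.pi) = w j τ := by
    intro i
    refine exists_eqOn_of_forall_exists_eq hHc.isPreconnected hHne
      (u := fun τ => w i (τ + 2 * Real.pi)) (w := w) ?_ hwc hinj ?_
    · exact (hwc i).comp (by fun_prop) fun τ hτ => (hshift τ).2 hτ
    · intro τ hτ
      have h1 := (hmem _ ((hshift τ).2 hτ) (w i (τ + 2 * Real.pi))).2 ⟨i, rfl⟩
      have h2 : Complex.exp (Complex.I * (τ + 2 * Real.pi)) = Complex.exp (Complex.I * τ) := by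
        rw [mul_add, show Complex.I * (2 * Real.pi) = 2 * Real.pi * Complex.I by ring,
          Complex.exp_add, Complex.exp_two_pi_mul_I, mul_one]
      rw [h2, hmem τ hτ] at h1
      obtain ⟨j, hj⟩ := h1
      exact ⟨j, hj.symm⟩
  choose ρ hρ using hperiod
  have hρinj : Function.Injective ρ := by
    intro i j hij
    obtain ⟨τ, hτ⟩ := hHne
    refine hinj _ ((hshift τ).2 hτ) ?_
    change w i _ = w j _
    rw [hρ i τ hτ, hρ j τ hτ, hij]
  refine ⟨w, Equiv.ofBijective ρ (Finite.injective_iff_bijective.1 hρinj),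
    { differentiableAt := hdiff
      injective := hinj
      roots := hroots
      period := fun i τ => ?_
      tendsto_zero := fun i => ?_
      boundary := hboundary
      center := hcenter }⟩
  · by_cases hτ : τ ∈ H
    · exact hρ i τ hτ
    · have h1 : w i (τ + 2 * Real.pi) = 0 := dif_neg fun h => hτ ((hshift τ).1 h)
      have h2 : w (ρ i) τ = 0 := dif_neg hτ
      exact h1.trans h2.symm
  · rw [Metric.tendsto_nhds]
    intro η hη
    filter_upwards [tendsto_exp_I_mul.eventually (hsmall η hη),
      Filter.tendsto_comap.eventually (Filter.eventually_gt_atTop c)] with τ h1 h2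
    simpa using h1 _ ((hmem τ h2 (w i τ)).2 ⟨i, rfl⟩)

theorem map_evalRingHom_zero_ne_zero {f : ℂ[X][Y]} (hz : ¬ ((C X : ℂ[X][Y]) ∣ f)) :
    f.map (evalRingHom (0 : ℂ)) ≠ 0 := by
  intro h
  refine hz ((C_dvd_iff_dvd_coeff _ _).2 fun i => X_dvd_iff.2 ?_)
  have := congrArg (fun p => p.coeff i) h
  simpa [coeff_map, coeff_zero_eq_eval_zero] using this

/-- The radius `δ₀` isolates the root `0` of `f(0, w)`. For given `δ`, the radius `r = exp (-c)` is
such that `D` has no zero with `0 < |z| < r` and the number of roots remains `n`. -/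
theorem exists_isUniformization {f : ℂ[X][Y]} (hsq : Squarefree f) (hz : ¬ ((C X : ℂ[X][Y]) ∣ f))
    (hn : n = (f.map (evalRingHom (0 : ℂ))).rootMultiplicity 0) :
    ∃ δ₀ : ℝ, 0 < δ₀ ∧ ∀ δ : ℝ, 0 < δ → δ ≤ δ₀ →
      ∃ (c : ℝ) (w : Fin n → ℂ → ℂ) (π : Equiv.Perm (Fin n)), IsUniformization f δ c w π := by
  classical
  have h0 := map_evalRingHom_zero_ne_zero hz
  obtain ⟨A, B, D, hD, hAB⟩ := by
    letI : NormalizedGCDMonoid ℂ[X] := Nonempty.some inferInstance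
    exact exists_mul_add_mul_derivative_eq_C hsq
  have hfin : {w : ℂ | f.evalEval 0 w = 0 ∧ w ≠ 0}.Finite := by
    refine ((f.map (evalRingHom (0 : ℂ))).roots.toFinset.finite_toSet).subset fun w hw => ?_
    rw [Finset.mem_coe, Multiset.mem_toFinset, mem_roots', IsRoot, map_evalRingHom_eval]
    exact ⟨h0, hw.1⟩
  obtain ⟨δ₁, hδ₁, hball⟩ := Metric.isOpen_iff.1 hfin.isClosed.isOpen_compl 0 (by simp)
  have hiso : ∀ w : ℂ, ‖w‖ ≤ δ₁ / 2 → f.evalEval 0 w = 0 → w = 0 := by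
    intro w hw hw0
    by_contra hne
    exact hball (show w ∈ Metric.ball 0 δ₁ by rw [mem_ball_zero_iff]; linarith) ⟨hw0, hne⟩
  have hcenter : ∀ δ, 0 < δ → δ ≤ δ₁ / 2 → localRoots f δ 0 = Multiset.replicate n 0 := by
    intro δ hδ hδ'
    unfold localRoots
    rw [hn, ← count_roots, ← Multiset.filter_eq']
    refine Multiset.filter_congr fun w hw => ⟨fun h => ?_, fun h => by simpa [h] using hδ⟩
    refine hiso w (h.le.trans hδ') ?_
    rw [← map_evalRingHom_eval]
    exact (mem_roots'.1 hw).2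
  have hcard : ∀ δ, 0 < δ → δ ≤ δ₁ / 2 → ∀ᶠ z in nhds (0 : ℂ),
      (∀ w, ‖w‖ = δ → f.evalEval z w ≠ 0) ∧ (localRoots f δ z).card = n := by
    intro δ hδ hδ'
    have := eventually_card_localRoots_eq f hδ fun w hw h => by
      have := hiso w (hw.le.trans hδ') h
      rw [this, norm_zero] at hw
      exact hδ.ne hw
    simpa [hcenter δ hδ hδ'] using this
  refine ⟨δ₁ / 2, by positivity, fun δ hδ hδ' => ?_⟩
  have hDev : ∀ᶠ z in nhds (0 : ℂ), z ≠ 0 → D.eval z ≠ 0 := by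
    have hfinD : {z : ℂ | D.eval z = 0 ∧ z ≠ 0}.Finite := by
      refine (D.roots.toFinset.finite_toSet).subset fun z hz => ?_
      rw [Finset.mem_coe, Multiset.mem_toFinset, mem_roots']
      exact ⟨hD, hz.1⟩
    filter_upwards [hfinD.isClosed.isOpen_compl.mem_nhds (show (0 : ℂ) ∈ _ by simp)] with z h1 h2 h3
    exact h1 ⟨h3, h2⟩
  obtain ⟨r, hr, hr'⟩ := Metric.eventually_nhds_iff_ball.1 (hDev.and (hcard δ hδ hδ'))
  have hr' : ∀ z : ℂ, ‖z‖ < r → _ := fun z hz => hr' z (by simpa using hz)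
  refine ⟨-Real.log r, ?_⟩
  have hexp : Real.exp (- -Real.log r) = r := by rw [neg_neg, Real.exp_log hr]
  refine exists_isUniformization_of_card (fun z h => ?_) (fun z w hz0 h hw hw' => ?_)
    (fun z w h => ?_) (hcenter δ hδ hδ') (fun η hη => ?_)
  · exact (hr' z (hexp ▸ h)).2.2
  · refine (hr' z (hexp ▸ h)).1 hz0 ?_
    have h1 := congrArg (fun p => p.evalEval z w) hAB
    simp only [evalEval_add, evalEval_mul, hw, hw', mul_zero, add_zero, evalEval_C] at h1
    exact h1.symm
  · exact (hr' z (hexp ▸ h)).2.1 w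
  -- Roots are small for small `z`: the disk of radius `min η δ` also contains `n` roots, hence all
  -- those counted in the disk of radius `δ`.
  · have hm : 0 < min η δ := lt_min hη hδ
    filter_upwards [hcard δ hδ hδ', hcard (min η δ) hm ((min_le_right _ _).trans hδ')]
      with z h1 h2 w hw
    have hle : localRoots f (min η δ) z ≤ localRoots f δ z := by
      unfold localRoots
      exact Multiset.monotone_filter_right _ fun w hw => lt_of_lt_of_le hw (min_le_right _ _)
    have heq := Multiset.eq_of_le_of_card_le hle (by rw [h1.2, h2.2])
    rw [← heq] at hw
    exact lt_of_lt_of_le (mem_localRoots.1 hw).2.2 (min_le_left _ _)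

/-! ### Periodic functions on a half plane -/

/-- A function on a half plane with period `2 π M` that vanishes at infinity is an analytic function
of `t = exp (I τ / M)`. -/
theorem exists_eq_comp_exp {W : ℂ → ℂ} {c : ℝ} {M : ℕ} (hM : 0 < M)
    (hd : ∀ τ : ℂ, c < τ.im → DifferentiableAt ℂ W τ)
    (hper : ∀ τ, W (τ + 2 * Real.pi * M) = W τ)
    (hlim : Filter.Tendsto W (Filter.comap Complex.im Filter.atTop) (nhds 0)) :
    ∃ G : ℂ → ℂ, DifferentiableOn ℂ G (Metric.ball 0 (Real.exp (-c / M))) ∧ G 0 = 0 ∧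
      ∀ τ, G (Complex.exp (Complex.I * τ / M)) = W τ := by
  have hM' : (0 : ℝ) < M := by exact_mod_cast hM
  have hMC : (M : ℂ) ≠ 0 := by exact_mod_cast hM.ne'
  let h : ℝ := 2 * Real.pi * M
  have hh : 0 < h := by positivity
  have hW : Function.Periodic W (h : ℝ) := fun τ => by
    simpa [h] using hper τ
  have hq : ∀ τ, Function.Periodic.qParam h τ = Complex.exp (Complex.I * τ / M) := by
    intro τ
    unfold Function.Periodic.qParam
    congr 1
    have : (Real.pi : ℂ) ≠ 0 := by exact_mod_cast Real.pi_ne_zero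
    simp only [h]
    push_cast
    field_simp
  have hev : ∀ᶠ τ in Filter.comap Complex.im Filter.atTop, DifferentiableAt ℂ W τ := by
    filter_upwards [Filter.tendsto_comap.eventually (Filter.eventually_gt_atTop c)] with τ hτ
    exact hd τ hτ
  -- For the period `h = 2πM` the cusp parameter is `exp (I τ / M)`. The singularity at `t = 0` is
  -- removable, and the value there is the limit `0`.
  refine ⟨Function.Periodic.cuspFunction h W, ?_, ?_, ?_⟩
  · intro t ht
    refine DifferentiableAt.differentiableWithinAt ?_
    by_cases ht0 : t = 0
    · subst ht0
      refine Function.Periodic.differentiableAt_cuspFunction_zero hh hW hev ?_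
      exact Filter.ZeroAtFilter.boundedAtFilter hlim
    · rw [← Function.Periodic.qParam_right_inv hh.ne' ht0]
      refine Function.Periodic.differentiableAt_cuspFunction hh.ne' hW (hd _ ?_)
      rw [Function.Periodic.im_invQParam]
      have h1 : -h / (2 * Real.pi) = -M := by
        simp only [h]
        field_simp
      rw [h1]
      have h2 : Real.log ‖t‖ < -c / M := by
        rw [Real.log_lt_iff_lt_exp (norm_pos_iff.2 ht0)]
        simpa using ht
      rw [lt_div_iff₀ hM'] at h2
      linarith
  · exact Function.Periodic.cuspFunction_zero_of_zero_at_inf hh hlim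
  · intro τ
    rw [← hq]
    exact Function.Periodic.eq_cuspFunction hh.ne' hW τ

/-- An analytic function on a disk with its only zero at the center is a power times an
exponential. -/
theorem exists_eq_pow_mul_exp {G : ℂ → ℂ} {R : ℝ} (hR : 0 < R)
    (hG : DifferentiableOn ℂ G (Metric.ball 0 R)) (h0 : G 0 = 0)
    (hne : ∀ t ∈ Metric.ball (0 : ℂ) R, t ≠ 0 → G t ≠ 0) :
    ∃ k : ℕ, 0 < k ∧ analyticOrderAt G 0 = k ∧ ∃ L : ℂ → ℂ,
      DifferentiableOn ℂ L (Metric.ball 0 R) ∧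
      ∀ t ∈ Metric.ball (0 : ℂ) R, G t = t ^ k * Complex.exp (L t) := by
  have hmem : (0 : ℂ) ∈ Metric.ball (0 : ℂ) R := by simpa using hR
  have hnhds : Metric.ball (0 : ℂ) R ∈ nhds (0 : ℂ) := Metric.ball_mem_nhds _ hR
  have han : AnalyticAt ℂ G 0 := hG.analyticAt hnhds
  have hfin : analyticOrderAt G 0 ≠ ⊤ := by
    rw [Ne, analyticOrderAt_eq_top]
    intro hz
    have h1 : ∀ᶠ t in nhdsWithin (0 : ℂ) {0}ᶜ, G t = 0 := nhdsWithin_le_nhds hz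
    have h2 : ∀ᶠ t in nhdsWithin (0 : ℂ) {0}ᶜ, t ∈ Metric.ball (0 : ℂ) R := nhdsWithin_le_nhds hnhds
    have h3 : ∀ᶠ t in nhdsWithin (0 : ℂ) {0}ᶜ, t ≠ 0 := self_mem_nhdsWithin
    obtain ⟨t, ht1, ht2, ht3⟩ := (h1.and (h2.and h3)).exists
    exact hne t ht2 ht3 ht1
  obtain ⟨k, hk⟩ := ENat.ne_top_iff_exists.1 hfin
  obtain ⟨g, hg, hg0, hgG⟩ := (han.analyticOrderAt_eq_natCast).1 hk.symm
  simp only [sub_zero, smul_eq_mul] at hgG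
  have hkpos : 0 < k := by
    rcases Nat.eq_zero_or_pos k with rfl | hk
    · have := hgG.self_of_nhds
      rw [h0, pow_zero, one_mul] at this
      exact absurd this.symm hg0
    · exact hk
  -- The quotient `G / t ^ k`, completed at `0`, has no zeros on the disk. A primitive of `u' / u`
  -- with the right value at `0` is a logarithm of it.
  let u : ℂ → ℂ := Function.update (fun t => G t / t ^ k) 0 (g 0)
  have hu : ∀ t, t ≠ 0 → u t = G t / t ^ k := fun t ht => Function.update_of_ne ht _ _
  have hu0 : u 0 = g 0 := Function.update_self _ _ _
  have hug : u =ᶠ[nhds 0] g := by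
    filter_upwards [hgG] with t ht
    by_cases h : t = 0
    · rw [h, hu0]
    · rw [hu t h, ht]
      field_simp
  have hud : DifferentiableOn ℂ u (Metric.ball 0 R) := by
    intro t ht
    refine DifferentiableAt.differentiableWithinAt ?_
    by_cases h : t = 0
    · rw [h]
      exact hg.differentiableAt.congr_of_eventuallyEq hug
    · have h1 : u =ᶠ[nhds t] fun t => G t / t ^ k := by
        filter_upwards [isOpen_ne.mem_nhds h] with s hs using hu s hs
      refine DifferentiableAt.congr_of_eventuallyEq ?_ h1
      exact ((hG t ht).differentiableAt (Metric.isOpen_ball.mem_nhds ht)).div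
        (by fun_prop) (pow_ne_zero _ h)
  have hune : ∀ t ∈ Metric.ball (0 : ℂ) R, u t ≠ 0 := by
    intro t ht
    by_cases h : t = 0
    · rw [h, hu0]; exact hg0
    · rw [hu t h]
      exact div_ne_zero (hne t ht h) (pow_ne_zero _ h)
  have hquot : DifferentiableOn ℂ (fun t => deriv u t / u t) (Metric.ball 0 R) :=
    (hud.deriv Metric.isOpen_ball).div hud hune
  obtain ⟨L, hL0, hL⟩ := hquot.isExactOn_ball.with_val_at 0 (Complex.log (u 0))
  have hLd : DifferentiableOn ℂ L (Metric.ball 0 R) := fun t ht =>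
    (hL t ht).differentiableAt.differentiableWithinAt
  have hconst : ∀ t ∈ Metric.ball (0 : ℂ) R, u t * Complex.exp (-L t) = 1 := by
    intro t ht
    have h1 : ∀ s ∈ Metric.ball (0 : ℂ) R,
        HasDerivAt (fun s => u s * Complex.exp (-L s)) 0 s := by
      intro s hs
      have h2 := ((hud s hs).differentiableAt (Metric.isOpen_ball.mem_nhds hs)).hasDerivAt
      have h3 := h2.mul (hL s hs).neg.cexp
      refine h3.congr_deriv ?_
      have := hune s hs
      field_simp
      ring
    have h2 := Metric.isOpen_ball.is_const_of_deriv_eq_zero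
      (convex_ball (0 : ℂ) R).isPreconnected
      (f := fun s => u s * Complex.exp (-L s))
      (fun s hs => (h1 s hs).differentiableAt.differentiableWithinAt)
      (fun s hs => (h1 s hs).deriv) ht hmem
    rw [h2, hL0, Complex.exp_neg, Complex.exp_log (hune 0 hmem), mul_inv_cancel₀ (hune 0 hmem)]
  refine ⟨k, hkpos, hk.symm, L, hLd, fun t ht => ?_⟩
  have h1 : u t = Complex.exp (L t) := by
    have := hconst t ht
    rw [Complex.exp_neg] at this
    exact (mul_inv_eq_one₀ (Complex.exp_ne_zero _)).1 this
  rw [← h1]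
  by_cases h : t = 0
  · rw [h, h0, zero_pow hkpos.ne', zero_mul]
  · rw [hu t h]
    field_simp

theorem exp_eq_norm_mul_exp (z : ℂ) :
    Complex.exp z = ‖Complex.exp z‖ * Complex.exp (z.im * Complex.I) := by
  rw [Complex.norm_exp, Complex.ofReal_exp, ← Complex.exp_add, Complex.re_add_im]

theorem norm_exp_I_mul_div (τ : ℂ) (M : ℕ) :
    ‖Complex.exp (Complex.I * τ / M)‖ = Real.exp (-τ.im / M) := by
  rw [Complex.norm_exp]
  congr 1
  have : Complex.I * τ / M = Complex.I * (τ / M) := by ring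
  rw [this, Complex.I_mul_re, ← Complex.ofReal_natCast, Complex.div_ofReal_im]
  ring

theorem exists_exp_I_mul_div_eq {t : ℂ} (ht : t ≠ 0) {M : ℕ} (hM : 0 < M) :
    ∃ τ : ℂ, Complex.exp (Complex.I * τ / M) = t ∧ τ.im = -(M * Real.log ‖t‖) := by
  have hMC : (M : ℂ) ≠ 0 := by exact_mod_cast hM.ne'
  refine ⟨-Complex.I * (M * Complex.log t), ?_, ?_⟩
  · rw [show Complex.I * (-Complex.I * (M * Complex.log t)) / M =
      -(Complex.I * Complex.I) * (Complex.log t) * (M / M) by ring, Complex.I_mul_I,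
      div_self hMC, mul_one, neg_neg, one_mul, Complex.exp_log ht]
  · rw [neg_mul, Complex.neg_im, Complex.I_mul_im, ← Complex.ofReal_natCast,
      Complex.re_ofReal_mul, Complex.log_re]

/-- Near infinity, a nonvanishing periodic function that vanishes at infinity turns
counterclockwise on horizontal lines. -/
theorem eventually_turning {W : ℂ → ℂ} {c : ℝ} {M : ℕ} (hM : 0 < M)
    (hd : ∀ τ : ℂ, c < τ.im → DifferentiableAt ℂ W τ)
    (hper : ∀ τ, W (τ + 2 * Real.pi * M) = W τ)
    (hlim : Filter.Tendsto W (Filter.comap Complex.im Filter.atTop) (nhds 0))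
    (hne : ∀ τ : ℂ, c < τ.im → W τ ≠ 0) :
    ∀ᶠ y : ℝ in Filter.atTop, ∃ φ : ℝ → ℝ, (∀ B, ∃ θ, B < φ θ) ∧ ∀ θ : ℝ,
      W (θ + y * Complex.I) = ‖W (θ + y * Complex.I)‖ * Complex.exp (φ θ * Complex.I) ∧
      ∃ d : ℝ, 0 < d ∧ HasDerivAt φ d θ := by
  have hM' : (0 : ℝ) < M := by exact_mod_cast hM
  have hMC : (M : ℂ) ≠ 0 := by exact_mod_cast hM.ne'
  obtain ⟨G, hG, hG0, hGW⟩ := exists_eq_comp_exp hM hd hper hlim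
  have hR := Real.exp_pos (-c / M)
  obtain ⟨k, hk, -, L, hL, hGL⟩ := exists_eq_pow_mul_exp hR hG hG0 (by
    intro t ht ht0
    obtain ⟨τ, rfl, hτ⟩ := exists_exp_I_mul_div_eq ht0 hM
    rw [hGW]
    refine hne τ ?_
    rw [mem_ball_zero_iff, norm_exp_I_mul_div, Real.exp_lt_exp, div_lt_div_iff_of_pos_right hM'] at ht
    linarith)
  -- The bound `1` is at most `k`, which makes the real part of `k + t L'(t)` positive.
  have hsmall : ∀ᶠ t in nhds (0 : ℂ), ‖t * deriv L t‖ < 1 ∧ t ∈ Metric.ball (0 : ℂ) (Real.exp (-c / M)) := by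
    refine Filter.Eventually.and ?_ (Metric.ball_mem_nhds _ hR)
    have h1 : ContinuousAt (fun t => ‖t * deriv L t‖) 0 :=
      (continuousAt_id.mul ((hL.deriv Metric.isOpen_ball).continuousOn.continuousAt
        (Metric.ball_mem_nhds _ hR))).norm
    exact h1.eventually_lt_const (by simp)
  obtain ⟨ρ, hρ, hρL⟩ := Metric.eventually_nhds_iff_ball.1 hsmall
  filter_upwards [Filter.eventually_gt_atTop (-(M * Real.log ρ)), Filter.eventually_gt_atTop c]
    with y hy hyc
  let t : ℝ → ℂ := fun θ => Complex.exp (Complex.I * (θ + y * Complex.I) / M)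
  have ht : ∀ θ, t θ ∈ Metric.ball (0 : ℂ) ρ := by
    intro θ
    rw [mem_ball_zero_iff, norm_exp_I_mul_div, ← Real.lt_log_iff_exp_lt hρ, div_lt_iff₀ hM']
    simp
    linarith
  -- A continuous logarithm of `W` along the line; its imaginary part is the argument `φ`. Over `m`
  -- periods of length `2πM` it grows by `2πkm`, so it is unbounded.
  let Λ : ℝ → ℂ := fun θ => k * (Complex.I * (θ + y * Complex.I) / M) + L (t θ)
  have hWΛ : ∀ θ : ℝ, W (θ + y * Complex.I) = Complex.exp (Λ θ) := by
    intro θ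
    rw [← hGW, hGL _ (hρL _ (ht θ)).2, Complex.exp_add, ← Complex.exp_nat_mul]
  have hΛd : ∀ θ, HasDerivAt Λ (k * (Complex.I / M) + deriv L (t θ) * (t θ * (Complex.I / M))) θ := by
    intro θ
    have h1 : HasDerivAt (fun θ : ℝ => Complex.I * ((θ : ℂ) + y * Complex.I) / M)
        (Complex.I / M) θ := by
      have := (((hasDerivAt_id θ).ofReal_comp.add_const (y * Complex.I)).const_mul
        Complex.I).div_const (M : ℂ)
      simpa using! this
    have h2 : HasDerivAt t (t θ * (Complex.I / M)) θ := h1.cexp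
    have h3 : HasDerivAt L (deriv L (t θ)) (t θ) :=
      ((hL _ (hρL _ (ht θ)).2).differentiableAt
        (Metric.isOpen_ball.mem_nhds (hρL _ (ht θ)).2)).hasDerivAt
    exact (h1.const_mul (k : ℂ)).add (h3.comp θ h2)
  refine ⟨fun θ => (Λ θ).im, ?_, fun θ => ⟨?_, ?_⟩⟩
  · have hshift : ∀ m : ℕ, Λ (m * (2 * Real.pi * M)) = Λ 0 + k * m * (2 * Real.pi * Complex.I) := by
      intro m
      have h1 : Complex.I * (((m * (2 * Real.pi * M) : ℝ) : ℂ) + y * Complex.I) / M =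
          Complex.I * ((0 : ℝ) + y * Complex.I) / M + m * (2 * Real.pi * Complex.I) := by
        push_cast
        field_simp
        ring
      have h2 : t (m * (2 * Real.pi * M)) = t 0 := by
        simp only [t]
        rw [h1, Complex.exp_add, Complex.exp_nat_mul_two_pi_mul_I, mul_one]
      simp only [Λ]
      rw [h2, h1]
      ring
    intro B
    obtain ⟨m, hm⟩ := exists_nat_gt ((B - (Λ 0).im) / (2 * Real.pi))
    rw [div_lt_iff₀ Real.two_pi_pos] at hm
    refine ⟨m * (2 * Real.pi * M), ?_⟩
    change B < (Λ (m * (2 * Real.pi * M) : ℝ)).im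
    rw [hshift]
    have h3 : ((k : ℂ) * m * (2 * Real.pi * Complex.I)).im = k * m * (2 * Real.pi) := by
      have : (k : ℂ) * m * (2 * Real.pi * Complex.I) =
        ((k * m * (2 * Real.pi) : ℝ) : ℂ) * Complex.I := by push_cast; ring
      rw [this, Complex.im_ofReal_mul, Complex.I_im, mul_one]
    rw [Complex.add_im, h3]
    have hk1 : (1 : ℝ) ≤ k := by exact_mod_cast hk
    have h4 : (m : ℝ) * (2 * Real.pi) ≤ k * m * (2 * Real.pi) := by
      have : (0 : ℝ) ≤ m * (2 * Real.pi) := by positivity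
      nlinarith
    linarith
  · rw [hWΛ]
    exact exp_eq_norm_mul_exp _
  · refine ⟨_, ?_, (Complex.imCLM.hasFDerivAt.comp_hasDerivAt θ (hΛd θ))⟩
    have h1 : (k : ℂ) * (Complex.I / M) + deriv L (t θ) * (t θ * (Complex.I / M)) =
        Complex.I * ((k + t θ * deriv L (t θ)) / M) := by ring
    rw [h1, Complex.imCLM_apply, Complex.I_mul_im, ← Complex.ofReal_natCast M,
      Complex.div_ofReal_re, Complex.add_re, Complex.natCast_re]
    have h2 := (hρL _ (ht θ)).1
    have h3 := (abs_le.1 (Complex.abs_re_le_norm (t θ * deriv L (t θ)))).1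
    have hk1 : (1 : ℝ) ≤ k := by exact_mod_cast hk
    apply div_pos _ hM'
    linarith

/-! ### The multivalued function of the roots -/

/-- The roots near the origin as an unordered tuple. -/
def rootFunction (f : ℂ[X][Y]) (δ : ℝ) (n : ℕ) (z : ℂ) : UnorderedTuples n :=
  open Classical in if h : (localRoots f δ z).card = n then ⟨localRoots f δ z, h⟩ else ofTuple 0

theorem differentiable_coeff_prod {ι : Type*} [Fintype ι] (s : Finset ι) (k : ℕ) :
    Differentiable ℂ fun v : ι → ℂ => (∏ i ∈ s, (X - C (v i) : ℂ[X])).coeff k := by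
  classical
  induction s using Finset.induction_on generalizing k with
  | empty => simp
  | insert a s ha ih =>
    simp only [Finset.prod_insert ha, sub_mul, coeff_sub, coeff_C_mul]
    have h1 : Differentiable ℂ fun v : ι → ℂ => v a := by fun_prop
    cases k with
    | zero =>
      simp only [coeff_X_mul_zero]
      exact (differentiable_const _).sub (h1.mul (ih 0))
    | succ k =>
      simp only [coeff_X_mul]
      exact (ih k).sub (h1.mul (ih (k + 1)))

theorem prod_map_ofTuple (v : Fin n → ℂ) :
    ((ofTuple v).toMultiset.map fun r => (X - C r : ℂ[X])).prod = ∏ i, (X - C (v i)) := by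
  change ((Finset.univ.val.map v).map _).prod = _
  rw [Multiset.map_map]
  rfl

theorem continuous_coeff_prod (k : ℕ) : Continuous fun s : UnorderedTuples n =>
    ((s.toMultiset.map fun r => (X - C r : ℂ[X])).prod).coeff k := by
  refine continuous_coinduced_dom.2 ?_
  refine (differentiable_coeff_prod (Finset.univ : Finset (Fin n)) k).continuous.congr fun v => ?_
  exact congrArg (fun p => p.coeff k) (prod_map_ofTuple v).symm

theorem ofTuple_zero_toMultiset : (ofTuple (0 : Fin n → ℂ)).toMultiset = Multiset.replicate n 0 := by
  change (Finset.univ : Finset (Fin n)).val.map (fun _ => (0 : ℂ)) = _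
  rw [Multiset.map_const']
  simp

theorem toMultiset_injective : Function.Injective (UnorderedTuples.toMultiset (n := n)) :=
  fun _ _ h => Subtype.ext h

namespace IsUniformization

variable {f : ℂ[X][Y]} {δ c : ℝ} {w : Fin n → ℂ → ℂ} {π : Equiv.Perm (Fin n)}

theorem exists_exp_eq {z : ℂ} (hz : z ≠ 0) (hzc : ‖z‖ < Real.exp (-c)) :
    ∃ τ : ℂ, c < τ.im ∧ Complex.exp (Complex.I * τ) = z := by
  obtain ⟨τ, h1, h2⟩ := exists_exp_I_mul_div_eq hz one_pos
  refine ⟨τ, ?_, by simpa using h1⟩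
  have := (Real.log_lt_iff_lt_exp (norm_pos_iff.2 hz)).2 hzc
  rw [h2, Nat.cast_one]
  linarith

theorem toMultiset_rootFunction (U : IsUniformization f δ c w π) {z : ℂ}
    (hz : ‖z‖ < Real.exp (-c)) : (rootFunction f δ n z).toMultiset = localRoots f δ z := by
  have hcard : (localRoots f δ z).card = n := by
    by_cases h0 : z = 0
    · rw [h0, U.center, Multiset.card_replicate]
    · obtain ⟨τ, h1, rfl⟩ := exists_exp_eq h0 hz
      rw [U.roots τ h1]
      simp
  simp [rootFunction, hcard, UnorderedTuples.toMultiset]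

theorem norm_exp_lt {τ : ℂ} (hτ : c < τ.im) : ‖Complex.exp (Complex.I * τ)‖ < Real.exp (-c) := by
  rw [norm_exp_I_mul, Real.exp_lt_exp]
  linarith

theorem rootFunction_exp (U : IsUniformization f δ c w π) {τ : ℂ} (hτ : c < τ.im) :
    rootFunction f δ n (Complex.exp (Complex.I * τ)) = ofTuple fun i => w i τ :=
  toMultiset_injective (by
    rw [U.toMultiset_rootFunction (norm_exp_lt hτ), U.roots τ hτ]
    rfl)

theorem rootFunction_zero (U : IsUniformization f δ c w π) :
    rootFunction f δ n 0 = ofTuple 0 :=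
  toMultiset_injective (by
    rw [U.toMultiset_rootFunction (by simpa using Real.exp_pos _), U.center,
      ofTuple_zero_toMultiset])

/-- Away from the origin the unordered tuple of roots is locally an ordered tuple of differentiable
functions. -/
theorem exists_eventually_rootFunction_eq (U : IsUniformization f δ c w π) {z : ℂ} (hz : z ≠ 0)
    (hzc : ‖z‖ < Real.exp (-c)) : ∃ v : ℂ → Fin n → ℂ, DifferentiableAt ℂ v z ∧
      ∀ᶠ x in nhds z, rootFunction f δ n x = ofTuple (v x) := by
  obtain ⟨τ, hτ, hτz⟩ := exists_exp_eq hz hzc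
  -- The local inverse of `exp (I τ)` through the chosen `τ`; since `x / z` is near `1`, the
  -- principal logarithm applies.
  let σ : ℂ → ℂ := fun x => τ - Complex.I * Complex.log (x / z)
  have hσz : σ z = τ := by simp [σ, hz]
  have hσ : DifferentiableAt ℂ σ z := by
    have h1 : DifferentiableAt ℂ (fun x => x / z) z := differentiableAt_id.div_const z
    have h2 : z / z ∈ Complex.slitPlane := by simp [hz]
    exact (differentiableAt_const _).sub ((h1.clog h2).const_mul _)
  have him : ∀ᶠ x in nhds z, c < (σ x).im := by
    have h1 : ContinuousAt (fun x => (σ x).im) z :=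
      Complex.continuous_im.continuousAt.comp hσ.continuousAt
    exact h1.eventually (lt_mem_nhds (by simpa only [hσz] using hτ))
  refine ⟨fun x i => w i (σ x), differentiableAt_pi.2 fun i => ?_, ?_⟩
  · have : DifferentiableAt ℂ (w i) (σ z) := U.differentiableAt i _ (by rwa [hσz])
    exact this.comp z hσ
  · filter_upwards [him, isOpen_ne.mem_nhds hz] with x hx hx0
    have : Complex.exp (Complex.I * σ x) = x := by
      have h1 : Complex.I * σ x = Complex.I * τ + Complex.log (x / z) := by
        simp only [σ]
        linear_combination -(Complex.log (x / z)) * Complex.I_mul_I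
      rw [h1, Complex.exp_add, hτz, Complex.exp_log (div_ne_zero hx0 hz), mul_div_cancel₀ _ hz]
    conv_lhs => rw [← this]
    exact U.rootFunction_exp hx

theorem eventually_norm_lt (U : IsUniformization f δ c w π) {η : ℝ} (hη : 0 < η) :
    ∃ y, ∀ τ : ℂ, y < τ.im → ∀ i, ‖w i τ‖ < η := by
  have : ∀ᶠ τ in Filter.comap Complex.im Filter.atTop, ∀ i, ‖w i τ‖ < η :=
    Filter.eventually_all.2 fun i => by
      simpa using (U.tendsto_zero i).eventually (Metric.ball_mem_nhds 0 hη)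
  obtain ⟨y, hy⟩ := Filter.eventually_atTop.1 (Filter.eventually_comap.1 this)
  exact ⟨y, fun τ hτ => hy _ hτ.le τ rfl⟩

theorem continuousAt_rootFunction (U : IsUniformization f δ c w π) {z : ℂ}
    (hzc : ‖z‖ < Real.exp (-c)) : ContinuousAt (rootFunction f δ n) z := by
  by_cases hz : z = 0
  · subst hz
    unfold ContinuousAt
    rw [U.rootFunction_zero]
    intro V hV
    have h1 := continuous_ofTuple.continuousAt.preimage_mem_nhds hV
    obtain ⟨η, hη, hηV⟩ := Metric.mem_nhds_iff.1 h1
    obtain ⟨y, hy⟩ := U.eventually_norm_lt hη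
    have h2 : Metric.ball (0 : ℂ) (Real.exp (-(max c y))) ∈ nhds 0 :=
      Metric.ball_mem_nhds _ (Real.exp_pos _)
    refine Filter.mem_map.2 ?_
    filter_upwards [h2] with x hx
    by_cases hx0 : x = 0
    · rw [Set.mem_preimage, hx0, U.rootFunction_zero]
      exact mem_of_mem_nhds hV
    · obtain ⟨τ, hτ, rfl⟩ := exists_exp_eq hx0 (mem_ball_zero_iff.1 hx)
      rw [max_lt_iff] at hτ
      rw [Set.mem_preimage, U.rootFunction_exp hτ.1]
      refine hηV (mem_ball_zero_iff.2 ((pi_norm_lt_iff hη).2 fun i => hy τ hτ.2 i))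
  · obtain ⟨v, hv, hFv⟩ := U.exists_eventually_rootFunction_eq hz hzc
    exact (continuous_ofTuple.continuousAt.comp hv.continuousAt).congr
      (hFv.mono fun _ h => h.symm)

/-- The coefficients are polynomials in the roots, so they are differentiable away from `0`. At `0`
they are continuous, and the singularity is removable. -/
theorem isAnalyticMultivaluedOn (U : IsUniformization f δ c w π) :
    IsAnalyticMultivaluedOn (rootFunction f δ n) (Metric.ball 0 (Real.exp (-c))) := by
  intro k
  have hd : ∀ z ∈ Metric.ball (0 : ℂ) (Real.exp (-c)), z ≠ 0 → DifferentiableAt ℂ (fun z =>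
      (((rootFunction f δ n z).toMultiset.map fun r => (X - C r : ℂ[X])).prod).coeff k) z := by
    intro z hz hz0
    obtain ⟨v, hv, hFv⟩ := U.exists_eventually_rootFunction_eq hz0 (mem_ball_zero_iff.1 hz)
    have h1 := (differentiable_coeff_prod (Finset.univ : Finset (Fin n)) k).differentiableAt.comp z
      hv
    refine h1.congr_of_eventuallyEq ?_
    filter_upwards [hFv] with x hx
    rw [hx, prod_map_ofTuple]
    rfl
  intro z hz
  have hnhds := Metric.isOpen_ball.mem_nhds hz
  apply Complex.analyticAt_of_differentiable_on_punctured_nhds_of_continuousAt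
  · by_cases hz0 : z = 0
    · subst hz0
      filter_upwards [mem_nhdsWithin_of_mem_nhds hnhds, self_mem_nhdsWithin] with x h1 h2
      exact hd x h1 h2
    · filter_upwards [mem_nhdsWithin_of_mem_nhds hnhds,
        mem_nhdsWithin_of_mem_nhds (isOpen_ne.mem_nhds hz0)] with x h1 h2
      exact hd x h1 h2
  · exact (continuous_coeff_prod k).continuousAt.comp
      (U.continuousAt_rootFunction (mem_ball_zero_iff.1 hz))

theorem rootFunction_notMem_discriminantLocus (U : IsUniformization f δ c w π) {z : ℂ}
    (hz : z ≠ 0) (hzc : ‖z‖ < Real.exp (-c)) :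
    rootFunction f δ n z ∉ discriminantLocus n := by
  obtain ⟨τ, hτ, rfl⟩ := exists_exp_eq hz hzc
  rw [U.rootFunction_exp hτ]
  exact ofTuple_notMem_discriminantLocus (U.injective τ hτ)

theorem mem_localRoots_iff (U : IsUniformization f δ c w π) (hδ : 0 < δ) {z x : ℂ}
    (hz : ‖z‖ < Real.exp (-c)) : x ∈ localRoots f δ z ↔ f.evalEval z x = 0 ∧ ‖x‖ < δ := by
  rw [mem_localRoots]
  refine and_iff_right fun h => ?_
  refine U.boundary z δ hz (by simp [hδ.le]) ?_
  rw [← map_evalRingHom_eval, h, eval_zero]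

/-- The curve does not meet the part `|w| = δ` of the boundary of the bidisk, so only the part over
`|z| = ε` contributes. -/
theorem singularityLink_eq (U : IsUniformization f δ c w π) (hδ : 0 < δ) {ε : ℝ} (hε : 0 < ε)
    (hεc : ε < Real.exp (-c)) : singularityLink f ε δ =
      {x : ℂ × ℂ | ‖x.1‖ = ε ∧ x.2 ∈ (rootFunction f δ n x.1).toMultiset} := by
  ext ⟨z, x⟩
  simp only [singularityLink, frontier_prod_eq, frontier_closedBall _ hε.ne',
    frontier_closedBall _ hδ.ne', Metric.isClosed_closedBall.closure_eq, Set.mem_inter_iff,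
    Set.mem_ofPred_eq, Set.mem_union, Set.mem_prod, mem_closedBall_zero_iff, mem_sphere_zero_iff_norm]
  constructor
  · rintro ⟨h1, ⟨h2, h3⟩ | ⟨h2, h3⟩⟩
    · exact absurd h1 (U.boundary z x (h2.trans_lt hεc) h3)
    · have hzc : ‖z‖ < Real.exp (-c) := h2.trans_lt hεc
      rw [U.toMultiset_rootFunction hzc, U.mem_localRoots_iff hδ hzc]
      exact ⟨h2, h1, h3.lt_of_ne fun h => U.boundary z x hzc h h1⟩
  · rintro ⟨h1, h2⟩
    have hzc : ‖z‖ < Real.exp (-c) := h1.trans_lt hεc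
    rw [U.toMultiset_rootFunction hzc, U.mem_localRoots_iff hδ hzc] at h2
    exact ⟨h2.1, Or.inr ⟨h1, h2.2.le⟩⟩

end IsUniformization

/-! ### Monodromy and turning of the roots -/

theorem exp_I_mul_add_int (τ : ℂ) (k : ℤ) :
    Complex.exp (Complex.I * (τ + 2 * Real.pi * k)) = Complex.exp (Complex.I * τ) := by
  rw [show Complex.I * (τ + 2 * Real.pi * k) = Complex.I * τ + k * (2 * Real.pi * Complex.I) by
    ring, Complex.exp_add, Complex.exp_int_mul_two_pi_mul_I, mul_one]

theorem exp_I_mul_eq_iff {τ σ : ℂ} : Complex.exp (Complex.I * τ) = Complex.exp (Complex.I * σ) ↔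
    ∃ k : ℤ, τ = σ + 2 * Real.pi * k := by
  rw [Complex.exp_eq_exp_iff_exists_int]
  refine exists_congr fun k => ⟨fun h => ?_, fun h => by rw [h]; ring⟩
  apply mul_left_cancel₀ Complex.I_ne_zero
  rw [h]
  ring

theorem exp_I_mul_div_pow (τ : ℂ) {p : ℕ} (hp : 0 < p) :
    Complex.exp (Complex.I * τ / p) ^ p = Complex.exp (Complex.I * τ) := by
  have : (p : ℂ) ≠ 0 := by exact_mod_cast hp.ne'
  rw [← Complex.exp_nat_mul, mul_div_cancel₀ _ this]

theorem exists_exp_I_mul_div_eq_of_norm_pow_le {t : ℂ} (ht : t ≠ 0) {p : ℕ} (hp : 0 < p) {r : ℝ}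
    (htr : ‖t‖ ^ p ≤ r) :
    ∃ τ : ℂ, Complex.exp (Complex.I * τ / p) = t ∧ -Real.log r ≤ τ.im := by
  obtain ⟨τ, h1, h2⟩ := exists_exp_I_mul_div_eq ht hp
  refine ⟨τ, h1, ?_⟩
  have h3 : 0 < ‖t‖ := norm_pos_iff.2 ht
  rw [h2, ← Real.log_pow]
  exact neg_le_neg (Real.log_le_log (by positivity) htr)

theorem norm_exp_I_mul_div_pow_le {τ : ℂ} {p : ℕ} (hp : 0 < p) {r : ℝ} (hr : 0 < r)
    (hτ : -Real.log r ≤ τ.im) : ‖Complex.exp (Complex.I * τ / p)‖ ^ p ≤ r := by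
  rw [← norm_pow, exp_I_mul_div_pow τ hp, norm_exp_I_mul, ← Real.le_log_iff_exp_le hr]
  linarith

theorem ofReal_mul_exp_eq {r : ℝ} (hr : 0 < r) (θ : ℂ) : r * Complex.exp (θ * Complex.I) =
    Complex.exp (Complex.I * (θ + (-Real.log r : ℝ) * Complex.I)) := by
  have : Complex.I * (θ + (-Real.log r : ℝ) * Complex.I) = Real.log r + θ * Complex.I := by
    push_cast
    linear_combination -(Real.log r : ℂ) * Complex.I_mul_I
  rw [this, Complex.exp_add, ← Complex.ofReal_exp, Real.exp_log hr]

namespace IsUniformization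

variable {f : ℂ[X][Y]} {δ c : ℝ} {w : Fin n → ℂ → ℂ} {π : Equiv.Perm (Fin n)}

theorem period_pow (U : IsUniformization f δ c w π) (k : ℕ) (i : Fin n) (τ : ℂ) :
    w i (τ + 2 * Real.pi * k) = w ((π ^ k) i) τ := by
  induction k generalizing i with
  | zero => simp
  | succ k ih =>
    rw [show τ + 2 * Real.pi * ((k + 1 : ℕ) : ℂ) = τ + 2 * Real.pi * k + 2 * Real.pi by
      push_cast; ring, U.period, ih, pow_succ, Equiv.Perm.mul_apply]

theorem period_zpow (U : IsUniformization f δ c w π) (k : ℤ) (i : Fin n) (τ : ℂ) :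
    w i (τ + 2 * Real.pi * k) = w ((π ^ k) i) τ := by
  obtain ⟨m, rfl | rfl⟩ := k.eq_nat_or_neg
  · simpa using U.period_pow m i τ
  · have := U.period_pow m ((π ^ (-(m : ℤ))) i) (τ + 2 * Real.pi * ((-(m : ℤ) : ℤ) : ℂ))
    rw [← zpow_natCast π m, ← Equiv.Perm.mul_apply, ← zpow_add, add_neg_cancel, zpow_zero,
      Equiv.Perm.one_apply] at this
    rw [← this]
    congr 1
    push_cast
    ring

/-- The order of `π` gives a common period `2πM` for all differences. Finitely many pairs allow one
height `c₁` above which every horizontal line works. -/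
theorem exists_turning (U : IsUniformization f δ c w π) : ∃ c₁, c < c₁ ∧ ∀ y, c₁ ≤ y →
    ∀ i j, i ≠ j → ∃ φ : ℝ → ℝ, (∀ B, ∃ θ, B < φ θ) ∧ ∀ θ : ℝ,
      w i (θ + y * Complex.I) - w j (θ + y * Complex.I) =
        ‖w i (θ + y * Complex.I) - w j (θ + y * Complex.I)‖ * Complex.exp (φ θ * Complex.I) ∧
      ∃ d : ℝ, 0 < d ∧ HasDerivAt φ d θ := by
  have hper : ∀ i τ, w i (τ + 2 * Real.pi * orderOf π) = w i τ := fun i τ => by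
    rw [U.period_pow, pow_orderOf_eq_one, Equiv.Perm.one_apply]
  have key : ∀ᶠ y : ℝ in Filter.atTop, ∀ i j, i ≠ j → ∃ φ : ℝ → ℝ, (∀ B, ∃ θ, B < φ θ) ∧
      ∀ θ : ℝ, w i (θ + y * Complex.I) - w j (θ + y * Complex.I) =
        ‖w i (θ + y * Complex.I) - w j (θ + y * Complex.I)‖ * Complex.exp (φ θ * Complex.I) ∧
      ∃ d : ℝ, 0 < d ∧ HasDerivAt φ d θ := by
    refine Filter.eventually_all.2 fun i => Filter.eventually_all.2 fun j => ?_
    by_cases hij : i = j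
    · exact Filter.Eventually.of_forall fun y h => absurd hij h
    · refine (eventually_turning (W := fun τ => w i τ - w j τ) (c := c) (orderOf_pos π)
        (fun τ hτ => (U.differentiableAt i τ hτ).sub (U.differentiableAt j τ hτ))
        (fun τ => by rw [hper, hper])
        (by simpa using (U.tendsto_zero i).sub (U.tendsto_zero j))
        (fun τ hτ h => hij (U.injective τ hτ (sub_eq_zero.1 h)))).mono fun y hy _ => hy
  obtain ⟨y₀, hy₀⟩ := Filter.eventually_atTop.1 key
  exact ⟨max y₀ (c + 1), by simp, fun y hy => hy₀ y (le_trans (le_max_left _ _) hy)⟩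

theorem im_line (θ y : ℝ) : ((θ : ℂ) + y * Complex.I).im = y := by simp

theorem continuous_line (U : IsUniformization f δ c w π) {y : ℝ} (hy : c < y) (i : Fin n) :
    Continuous fun θ : ℝ => w i (θ + y * Complex.I) := by
  refine continuous_iff_continuousAt.2 fun θ => ?_
  have h := (U.differentiableAt i (θ + y * Complex.I) (by rwa [im_line])).continuousAt
  exact ContinuousAt.comp (f := fun θ : ℝ => (θ : ℂ) + y * Complex.I) h (by fun_prop)

theorem isTurning (U : IsUniformization f δ c w π) {y : ℝ} (hy : c < y)
    (h : ∀ i j, i ≠ j → ∃ φ : ℝ → ℝ, (∀ B, ∃ θ, B < φ θ) ∧ ∀ θ : ℝ,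
      w i (θ + y * Complex.I) - w j (θ + y * Complex.I) =
        ‖w i (θ + y * Complex.I) - w j (θ + y * Complex.I)‖ * Complex.exp (φ θ * Complex.I) ∧
      ∃ d : ℝ, 0 < d ∧ HasDerivAt φ d θ) :
    IsTurning fun i (θ : ℝ) => w i (θ + y * Complex.I) where
  continuous := U.continuous_line hy
  turning i j hij := by
    obtain ⟨φ, h1, h2⟩ := h i j hij
    refine ⟨φ, ?_, ?_, h1, fun θ => ⟨?_, (h2 θ).1⟩⟩
    · refine continuous_iff_continuousAt.2 fun θ => ?_
      obtain ⟨d, -, hd⟩ := (h2 θ).2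
      exact hd.continuousAt
    · refine strictMono_of_deriv_pos fun θ => ?_
      obtain ⟨d, hd0, hd⟩ := (h2 θ).2
      rwa [hd.deriv]
    · exact fun he => hij (U.injective _ (by rwa [im_line]) he)

theorem exists_closedBraid (U : IsUniformization f δ c w π) {ε : ℝ} (hε : 0 < ε)
    (hεc : ε < Real.exp (-c)) (h : IsTurning fun i (θ : ℝ) =>
      w i (θ + (-Real.log ε : ℝ) * Complex.I)) :
    ∃ (p : Conf n) (l : Path p p),
      (∀ t : unitInterval, (l t).1 =
        rootFunction f δ n (ε * Complex.exp (2 * Real.pi * (t : ℝ) * Complex.I))) ∧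
      ∃ β : BraidGroup n, IsPositive β ∧ IsStrictlyPositive β ∧ IsClosureOf l β := by
  have hnorm : ∀ t : ℝ, ‖(ε : ℂ) * Complex.exp (2 * Real.pi * t * Complex.I)‖ = ε := by
    intro t
    have := Complex.norm_exp_ofReal_mul_I (2 * Real.pi * t)
    push_cast at this
    rw [norm_mul, this, mul_one, Complex.norm_real, Real.norm_of_nonneg hε.le]
  have hne : ∀ t : ℝ, (ε : ℂ) * Complex.exp (2 * Real.pi * t * Complex.I) ≠ 0 := fun t =>
    mul_ne_zero (by exact_mod_cast hε.ne') (Complex.exp_ne_zero _)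
  have hF : ∀ t : ℝ, rootFunction f δ n (ε * Complex.exp (2 * Real.pi * t * Complex.I)) ∉
      discriminantLocus n := fun t =>
    U.rootFunction_notMem_discriminantLocus (hne t) (by rwa [hnorm])
  have hcont : Continuous fun t : unitInterval =>
      rootFunction f δ n (ε * Complex.exp (2 * Real.pi * (t : ℝ) * Complex.I)) := by
    refine continuous_iff_continuousAt.2 fun t => ?_
    exact ContinuousAt.comp
      (f := fun t : unitInterval => (ε : ℂ) * Complex.exp (2 * Real.pi * (t : ℝ) * Complex.I))
      (U.continuousAt_rootFunction (by rwa [hnorm])) (by fun_prop)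
  let l : Path (⟨_, hF 0⟩ : Conf n) ⟨_, hF 0⟩ :=
    { toFun := fun t => ⟨_, hF t⟩
      continuous_toFun := hcont.subtype_mk _
      source' := rfl
      target' := by
        apply Subtype.ext
        simp }
  refine ⟨_, l, fun t => rfl, h.exists_isStrictlyPositive π (fun i θ => ?_) fun t => ?_⟩
  · rw [← U.period]
    congr 1
    push_cast
    ring
  · change rootFunction f δ n _ = _
    have hl := Real.log_lt_iff_lt_exp hε |>.2 hεc
    have := U.rootFunction_exp (τ := (2 * Real.pi * (t : ℝ) : ℝ) + (-Real.log ε : ℝ) * Complex.I)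
      (by rw [im_line]; linarith)
    rw [← this, ← ofReal_mul_exp_eq hε]
    push_cast
    rfl

end IsUniformization

/-! ### Branches and components of the link -/

/-- The curve over a circle traced by a function on a horizontal line of the half plane. -/
def lineKnot (y : ℝ) (u : ℂ → ℂ) : Set (ℂ × ℂ) :=
  (fun τ => (Complex.exp (Complex.I * τ), u τ)) '' {τ | τ.im = y}

theorem im_add_two_pi_int (τ : ℂ) (k : ℤ) : (τ + 2 * Real.pi * k).im = τ.im := by
  have : (2 * Real.pi * k : ℂ) = ((2 * Real.pi * k : ℝ) : ℂ) := by push_cast; rfl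
  rw [this, Complex.add_im, Complex.ofReal_im, add_zero]

theorem branchKnot_eq_lineKnot {ε : ℝ} (hε : 0 < ε) {p : ℕ} (hp : 0 < p) {α u : ℂ → ℂ}
    (h : ∀ τ : ℂ, -Real.log ε ≤ τ.im → α (Complex.exp (Complex.I * τ / p)) = u τ) :
    branchKnot ε p α = lineKnot (-Real.log ε) u := by
  ext x
  constructor
  · rintro ⟨t, ht, rfl⟩
    have ht' : ‖t‖ ^ p = ε := ht
    have ht0 : t ≠ 0 := by
      rintro rfl
      rw [norm_zero, zero_pow hp.ne'] at ht'
      exact hε.ne ht'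
    obtain ⟨τ, h1, h2⟩ := exists_exp_I_mul_div_eq ht0 hp
    rw [← Real.log_pow, ht'] at h2
    refine ⟨τ, h2, ?_⟩
    simp only [← h1, exp_I_mul_div_pow τ hp, h τ h2.ge]
  · rintro ⟨τ, hτ, rfl⟩
    have hτ' : τ.im = -Real.log ε := hτ
    refine ⟨Complex.exp (Complex.I * τ / p), ?_, ?_⟩
    · change ‖_‖ ^ p = ε
      rw [← norm_pow, exp_I_mul_div_pow τ hp, norm_exp_I_mul, hτ', neg_neg, Real.exp_log hε]
    · simp only [exp_I_mul_div_pow τ hp, h τ hτ'.ge]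

theorem norm_lt_of_norm_pow_le {ε c : ℝ} (hεc : ε < Real.exp (-c)) {p : ℕ} (hp : 0 < p) {t : ℂ}
    (ht : ‖t‖ ^ p ≤ ε) : t ∈ Metric.ball (0 : ℂ) (Real.exp (-c / p)) := by
  rw [mem_ball_zero_iff]
  refine lt_of_pow_lt_pow_left₀ p (Real.exp_pos _).le ?_
  have : (p : ℝ) ≠ 0 := by exact_mod_cast hp.ne'
  rw [← Real.exp_nat_mul, mul_div_cancel₀ _ this]
  exact ht.trans_lt hεc

namespace IsUniformization

variable {f : ℂ[X][Y]} {δ c : ℝ} {w : Fin n → ℂ → ℂ} {π : Equiv.Perm (Fin n)}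

theorem continuousOn (U : IsUniformization f δ c w π) {y : ℝ} (hy : c < y) (i : Fin n) :
    ContinuousOn (w i) {τ | y ≤ τ.im} := fun τ hτ =>
  (U.differentiableAt i τ (hy.trans_le hτ)).continuousAt.continuousWithinAt

theorem lt_neg_log {ε : ℝ} (hε : 0 < ε) (hεc : ε < Real.exp (-c)) : c < -Real.log ε := by
  have := (Real.log_lt_iff_lt_exp hε).2 hεc
  linarith

theorem lineKnot_zpow_subset (U : IsUniformization f δ c w π) (y : ℝ) (i : Fin n) (k : ℤ) :
    lineKnot y (w ((π ^ k) i)) ⊆ lineKnot y (w i) := by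
  rintro _ ⟨τ, hτ, rfl⟩
  refine ⟨τ + 2 * Real.pi * k, (im_add_two_pi_int τ k).trans hτ, ?_⟩
  simp only [exp_I_mul_add_int, U.period_zpow]

theorem lineKnot_zpow (U : IsUniformization f δ c w π) (y : ℝ) (i : Fin n) (k : ℤ) :
    lineKnot y (w ((π ^ k) i)) = lineKnot y (w i) := by
  refine (U.lineKnot_zpow_subset y i k).antisymm ?_
  have := U.lineKnot_zpow_subset y ((π ^ k) i) (-k)
  rwa [← Equiv.Perm.mul_apply, ← zpow_add, neg_add_cancel, zpow_zero, Equiv.Perm.one_apply] at this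

/-- A common point of two such curves forces their indices into one cycle of `π`, and along a cycle
the curve is the same. -/
theorem lineKnot_eq_of_mem (U : IsUniformization f δ c w π) {y : ℝ} (hy : c < y) {i j : Fin n}
    {x : ℂ × ℂ} (hi : x ∈ lineKnot y (w i)) (hj : x ∈ lineKnot y (w j)) :
    lineKnot y (w i) = lineKnot y (w j) := by
  obtain ⟨τ, hτ, rfl⟩ := hi
  obtain ⟨σ, hσ, h⟩ := hj
  obtain ⟨h1, h2⟩ := Prod.ext_iff.1 h
  obtain ⟨k, rfl⟩ := exp_I_mul_eq_iff.1 h1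
  have h3 : w ((π ^ k) j) τ = w i τ := by rw [← U.period_zpow]; exact h2
  have hτ' : τ.im = y := hτ
  rw [← U.injective τ (hτ' ▸ hy) h3, U.lineKnot_zpow]

/-- The exponent `p` is the length of the cycle of `i`. The period `2πp` makes `w i` an analytic
function of `exp (I τ / p)`, and the minimality of `p` makes the parametrization one-to-one. -/
theorem exists_isBranch (U : IsUniformization f δ c w π) {ε : ℝ} (hε : 0 < ε)
    (hεc : ε < Real.exp (-c)) (i : Fin n) : ∃ (p : ℕ) (α : ℂ → ℂ), IsBranch f ε p α ∧
      branchKnot ε p α = lineKnot (-Real.log ε) (w i) := by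
  have hc := lt_neg_log hε hεc
  let p := Function.minimalPeriod (π • ·) i
  have hdvd : ∀ k : ℤ, (π ^ k) i = i ↔ (p : ℤ) ∣ k := fun k =>
    MulAction.zpow_smul_eq_iff_minimalPeriod_dvd (a := π) (b := i) (n := k)
  have hp : 0 < p := by
    refine Nat.pos_of_ne_zero fun h => ?_
    have h1 := (hdvd (orderOf π)).1 (by
      rw [zpow_natCast, pow_orderOf_eq_one, Equiv.Perm.one_apply])
    rw [h, Nat.cast_zero, zero_dvd_iff, Nat.cast_eq_zero] at h1
    exact (orderOf_pos π).ne' h1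
  have hpC : (p : ℂ) ≠ 0 := by exact_mod_cast hp.ne'
  obtain ⟨α, hα, hα0, hαw⟩ := exists_eq_comp_exp hp (U.differentiableAt i)
    (fun τ => by
      have := U.period_zpow p i τ
      rwa [(hdvd p).2 dvd_rfl, Int.cast_natCast] at this) (U.tendsto_zero i)
  refine ⟨p, α, ⟨hp, ?_, hα0, ?_, ?_⟩, branchKnot_eq_lineKnot hε hp fun τ _ => hαw τ⟩
  · exact (hα.analyticOnNhd Metric.isOpen_ball).mono fun t ht => norm_lt_of_norm_pow_le hεc hp ht
  · intro t ht s hs hts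
    obtain ⟨h1, h2⟩ := Prod.ext_iff.1 hts
    simp only at h1 h2
    by_cases ht0 : t = 0
    · rw [ht0, zero_pow hp.ne', eq_comm, pow_eq_zero_iff hp.ne'] at h1
      rw [ht0, h1]
    · have hs0 : s ≠ 0 := by
        rintro rfl
        rw [zero_pow hp.ne', pow_eq_zero_iff hp.ne'] at h1
        exact ht0 h1
      obtain ⟨τ, rfl, hτ⟩ := exists_exp_I_mul_div_eq_of_norm_pow_le ht0 hp ht
      obtain ⟨σ, rfl, hσ⟩ := exists_exp_I_mul_div_eq_of_norm_pow_le hs0 hp hs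
      rw [exp_I_mul_div_pow τ hp, exp_I_mul_div_pow σ hp] at h1
      obtain ⟨k, rfl⟩ := exp_I_mul_eq_iff.1 h1
      rw [hαw, hαw, U.period_zpow] at h2
      obtain ⟨m, rfl⟩ := (hdvd k).1 (U.injective σ (hc.trans_le hσ) h2)
      have : Complex.I * (σ + 2 * Real.pi * ((p * m : ℤ) : ℂ)) / p =
          Complex.I * σ / p + m * (2 * Real.pi * Complex.I) := by
        push_cast
        field_simp
      rw [this, Complex.exp_add, Complex.exp_int_mul_two_pi_mul_I, mul_one]
  · intro t ht
    by_cases ht0 : t = 0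
    · rw [ht0, hα0, zero_pow hp.ne']
      have : (0 : ℂ) ∈ localRoots f δ 0 := by
        rw [U.center]
        exact Multiset.mem_replicate.2 ⟨i.pos.ne', rfl⟩
      exact (mem_localRoots.1 this).2.1
    · obtain ⟨τ, rfl, hτ⟩ := exists_exp_I_mul_div_eq_of_norm_pow_le ht0 hp ht
      rw [exp_I_mul_div_pow τ hp, hαw]
      have : w i τ ∈ localRoots f δ (Complex.exp (Complex.I * τ)) := by
        rw [U.roots τ (hc.trans_le hτ)]
        exact Multiset.mem_map_of_mem _ (Finset.mem_univ i)
      exact (mem_localRoots.1 this).2.1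

end IsUniformization

theorem IsBranch.isCompact_branchKnot {f : ℂ[X][Y]} {ε : ℝ} {p : ℕ} {α : ℂ → ℂ}
    (h : IsBranch f ε p α) : IsCompact (branchKnot ε p α) := by
  refine IsCompact.image_of_continuousOn ?_ ?_
  · refine Metric.isCompact_of_isClosed_isBounded ?_ ?_
    · exact isClosed_eq (by fun_prop) continuous_const
    · refine Metric.isBounded_closedBall.subset
        (fun t (ht : ‖t‖ ^ p = ε) => ?_ : _ ⊆ Metric.closedBall (0 : ℂ) (max 1 ε))
      rw [mem_closedBall_zero_iff, le_max_iff]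
      refine (le_total ‖t‖ 1).imp id fun h1 => ?_
      rw [← ht]
      exact le_self_pow₀ h1 h.pos.ne'
  · refine ContinuousOn.prodMk (by fun_prop) (h.analytic.continuousOn.mono fun t ht => ?_)
    exact le_of_eq ht

namespace IsUniformization

variable {f : ℂ[X][Y]} {δ c : ℝ} {w : Fin n → ℂ → ℂ} {π : Equiv.Perm (Fin n)}

theorem singularityLink_eq_iUnion (U : IsUniformization f δ c w π) (hδ : 0 < δ) {ε : ℝ}
    (hε : 0 < ε) (hεc : ε < Real.exp (-c)) :
    singularityLink f ε δ = ⋃ i, lineKnot (-Real.log ε) (w i) := by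
  have hc := lt_neg_log hε hεc
  rw [U.singularityLink_eq hδ hε hεc]
  ext ⟨z, x⟩
  rw [Set.mem_iUnion]
  constructor
  · rintro ⟨h1, h2⟩
    simp only at h1 h2
    have hz : z ≠ 0 := norm_pos_iff.1 (h1 ▸ hε)
    obtain ⟨τ, rfl, hτ⟩ := exists_exp_I_mul_div_eq hz one_pos
    rw [h1, Nat.cast_one, one_mul] at hτ
    rw [Nat.cast_one, div_one] at h2
    rw [U.rootFunction_exp (hτ ▸ hc), mem_toMultiset_ofTuple] at h2
    obtain ⟨i, rfl⟩ := h2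
    exact ⟨i, τ, hτ, by simp⟩
  · rintro ⟨i, τ, hτ, h⟩
    obtain ⟨rfl, rfl⟩ := Prod.ext_iff.1 h
    have hτ' : τ.im = -Real.log ε := hτ
    refine ⟨?_, ?_⟩
    · simp only [norm_exp_I_mul, hτ', neg_neg, Real.exp_log hε]
    · simp only [U.rootFunction_exp (hτ' ▸ hc)]
      exact mem_toMultiset_ofTuple.2 ⟨i, rfl⟩

theorem isClosed_lineKnot (U : IsUniformization f δ c w π) {ε : ℝ} (hε : 0 < ε)
    (hεc : ε < Real.exp (-c)) (i : Fin n) : IsClosed (lineKnot (-Real.log ε) (w i)) := by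
  obtain ⟨p, α, h1, h2⟩ := U.exists_isBranch hε hεc i
  rw [← h2]
  exact h1.isCompact_branchKnot.isClosed

theorem isPreconnected_lineKnot (U : IsUniformization f δ c w π) {y : ℝ} (hy : c < y)
    (i : Fin n) : IsPreconnected (lineKnot y (w i)) := by
  have hconv : Convex ℝ {τ : ℂ | τ.im = y} := by
    intro a (ha : a.im = y) b (hb : b.im = y) s t _ _ hst
    change (s • a + t • b).im = y
    rw [Complex.add_im, Complex.smul_im, Complex.smul_im, ha, hb, ← add_smul, hst, one_smul]
  refine hconv.isPreconnected.image _ (ContinuousOn.prodMk (by fun_prop) ?_)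
  exact (U.continuousOn hy i).mono fun τ hτ => ge_of_eq hτ

/-- The link is a finite union of closed connected curves, any two of which are equal or disjoint;
hence these are its components. -/
theorem connectedComponentIn_eq (U : IsUniformization f δ c w π) (hδ : 0 < δ) {ε : ℝ}
    (hε : 0 < ε) (hεc : ε < Real.exp (-c)) {i : Fin n} {x : ℂ × ℂ}
    (hx : x ∈ lineKnot (-Real.log ε) (w i)) :
    connectedComponentIn (singularityLink f ε δ) x = lineKnot (-Real.log ε) (w i) := by
  have hc := lt_neg_log hε hεc
  have hlink := U.singularityLink_eq_iUnion hδ hε hεc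
  have hsub : lineKnot (-Real.log ε) (w i) ⊆ singularityLink f ε δ := by
    rw [hlink]
    exact Set.subset_iUnion (fun i => lineKnot (-Real.log ε) (w i)) i
  refine Set.Subset.antisymm ?_
    ((U.isPreconnected_lineKnot hc i).subset_connectedComponentIn hx hsub)
  let D : Set (ℂ × ℂ) := ⋃ j ∈ {j | lineKnot (-Real.log ε) (w j) ≠ lineKnot (-Real.log ε) (w i)},
    lineKnot (-Real.log ε) (w j)
  have hD : IsClosed D := Set.toFinite _ |>.isClosed_biUnion fun j _ =>
    U.isClosed_lineKnot hε hεc j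
  have hcover : singularityLink f ε δ ⊆ lineKnot (-Real.log ε) (w i) ∪ D := by
    rw [hlink]
    refine Set.iUnion_subset fun j => ?_
    by_cases hj : lineKnot (-Real.log ε) (w j) = lineKnot (-Real.log ε) (w i)
    · rw [hj]
      exact Set.subset_union_left
    · exact (Set.subset_biUnion_of_mem (u := fun j => lineKnot (-Real.log ε) (w j)) hj).trans
        Set.subset_union_right
  intro a ha
  refine (hcover (connectedComponentIn_subset _ _ ha)).resolve_right fun haD => ?_
  obtain ⟨b, -, hb1, hb2⟩ := isPreconnected_closed_iff.1 isPreconnected_connectedComponentIn _ D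
    (U.isClosed_lineKnot hε hεc i) hD ((connectedComponentIn_subset _ _).trans hcover)
    ⟨x, mem_connectedComponentIn (hsub hx), hx⟩ ⟨a, ha, haD⟩
  obtain ⟨j, hj, hbj⟩ := Set.mem_iUnion₂.1 hb2
  exact hj (U.lineKnot_eq_of_mem hc hbj hb1)

theorem exists_isBranch_connectedComponentIn_eq (U : IsUniformization f δ c w π) (hδ : 0 < δ)
    {ε : ℝ} (hε : 0 < ε) (hεc : ε < Real.exp (-c)) {x : ℂ × ℂ}
    (hx : x ∈ singularityLink f ε δ) : ∃ (p : ℕ) (α : ℂ → ℂ), IsBranch f ε p α ∧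
      connectedComponentIn (singularityLink f ε δ) x = branchKnot ε p α := by
  obtain ⟨i, hi⟩ := Set.mem_iUnion.1 (U.singularityLink_eq_iUnion hδ hε hεc ▸ hx)
  obtain ⟨p, α, h1, h2⟩ := U.exists_isBranch hε hεc i
  exact ⟨p, α, h1, by rw [U.connectedComponentIn_eq hδ hε hεc hi, h2]⟩

/-- Every branch is one of the roots. -/
theorem exists_eq_of_isBranch (U : IsUniformization f δ c w π) (hδ : 0 < δ) {ε : ℝ} (hε : 0 < ε)
    (hεc : ε < Real.exp (-c)) {p : ℕ} {α : ℂ → ℂ} (h : IsBranch f ε p α) :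
    ∃ i, ∀ τ : ℂ, -Real.log ε ≤ τ.im → α (Complex.exp (Complex.I * τ / p)) = w i τ := by
  have hc := lt_neg_log hε hεc
  have hpow : ∀ t : ℂ, ‖t‖ ^ p ≤ ε → ‖t ^ p‖ < Real.exp (-c) := fun t ht => by
    rw [norm_pow]
    exact ht.trans_lt hεc
  -- Along the segment from `0` to `t` the norm of `α` starts at `0` and cannot take the value `δ`,
  -- where `f` has no zeros.
  have hlt : ∀ t : ℂ, ‖t‖ ^ p ≤ ε → ‖α t‖ < δ := by
    intro t ht
    by_contra! hge
    have hseg : ∀ s ∈ Set.Icc (0 : ℝ) 1, ‖(s : ℂ) * t‖ ^ p ≤ ε := fun s hs => by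
      refine le_trans (pow_le_pow_left₀ (norm_nonneg _) ?_ p) ht
      rw [norm_mul, Complex.norm_real, Real.norm_of_nonneg hs.1]
      exact mul_le_of_le_one_left (norm_nonneg _) hs.2
    have hcont : ContinuousOn (fun s : ℝ => ‖α (s * t)‖) (Set.Icc 0 1) :=
      (h.analytic.continuousOn.comp (by fun_prop) hseg).norm
    obtain ⟨s, hs, hsδ⟩ := intermediate_value_Icc zero_le_one hcont
      (show δ ∈ Set.Icc _ _ by simpa [h.origin, hδ.le] using hge)
    exact U.boundary _ _ (hpow _ (hseg s hs)) hsδ (h.onCurve _ (hseg s hs))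
  have hmaps : ∀ τ ∈ {τ : ℂ | -Real.log ε ≤ τ.im},
      ‖Complex.exp (Complex.I * τ / p)‖ ^ p ≤ ε := fun τ hτ =>
    norm_exp_I_mul_div_pow_le h.pos hε hτ
  refine exists_eqOn_of_forall_exists_eq (convex_halfSpace_im_ge _).isPreconnected
    ⟨(-Real.log ε : ℝ) * Complex.I, by simp⟩
    (h.analytic.continuousOn.comp (by fun_prop) hmaps) (U.continuousOn hc)
    (fun τ hτ => U.injective τ (hc.trans_le hτ)) fun τ hτ => ?_
  have h1 : α (Complex.exp (Complex.I * τ / p)) ∈ localRoots f δ (Complex.exp (Complex.I * τ)) := by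
    rw [U.mem_localRoots_iff hδ (norm_exp_lt (hc.trans_le hτ))]
    refine ⟨?_, hlt _ (hmaps τ hτ)⟩
    rw [← exp_I_mul_div_pow τ h.pos]
    exact h.onCurve _ (hmaps τ hτ)
  rw [U.roots τ (hc.trans_le hτ), Multiset.mem_map] at h1
  obtain ⟨i, -, hi⟩ := h1
  exact ⟨i, hi.symm⟩

end IsUniformization

/-! ### Linking numbers and intersection numbers -/

theorem prod_range_add_of_periodic {M : Type*} [CommMonoid M] {g : ℕ → M} {q : ℕ}
    (hg : ∀ k, g (k + q) = g k) (m : ℕ) :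
    ∏ k ∈ Finset.range q, g (m + k) = ∏ k ∈ Finset.range q, g k := by
  induction m with
  | zero => simp
  | succ m ih =>
    rw [← ih]
    cases q with
    | zero => simp
    | succ q =>
      rw [Finset.prod_range_succ, Finset.prod_range_succ' (fun k => g (m + k))]
      congr 1
      · exact Finset.prod_congr rfl fun k _ => by rw [add_right_comm, add_assoc]
      · rw [add_zero, ← hg m]
        congr 1
        omega

theorem nthRoots_exp {q : ℕ} (hq : 0 < q) (τ : ℂ) : nthRoots q (Complex.exp (Complex.I * τ)) =
    (Multiset.range q).map fun k : ℕ => Complex.exp (Complex.I * (τ + 2 * Real.pi * k) / q) := by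
  rw [(Complex.isPrimitiveRoot_exp q hq.ne').nthRoots_eq (exp_I_mul_div_pow τ hq)]
  refine Multiset.map_congr rfl fun k _ => ?_
  rw [← Complex.exp_nat_mul, ← Complex.exp_add]
  congr 1
  ring

theorem prod_multiset_range {M : Type*} [CommMonoid M] (q : ℕ) (g : ℕ → M) :
    ((Multiset.range q).map g).prod = ∏ k ∈ Finset.range q, g k := rfl

theorem exp_I_mul_add_div (τ : ℂ) {p : ℕ} (hp : 0 < p) :
    Complex.exp (Complex.I * (τ + 2 * Real.pi * p) / p) = Complex.exp (Complex.I * τ / p) := by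
  have : (p : ℂ) ≠ 0 := by exact_mod_cast hp.ne'
  rw [show Complex.I * (τ + 2 * Real.pi * p) / p = Complex.I * τ / p + 2 * Real.pi * Complex.I by
    field_simp, Complex.exp_add, Complex.exp_two_pi_mul_I, mul_one]

/-- The total winding number of a function `t ^ m * exp (L t)`, as a function of `z = t ^ p`, over
a circle is `m`. -/
theorem hasWindingNumber_prod {R : ℝ} {m p : ℕ} (hp : 0 < p) {y : ℝ} {G L : ℂ → ℂ}
    (hL : DifferentiableOn ℂ L (Metric.ball 0 R)) (hy : Real.exp (-y / p) < R)
    (hG : ∀ t ∈ Metric.ball (0 : ℂ) R, t ≠ 0 → G t = t ^ m * Complex.exp (L t)) :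
    HasWindingNumber (fun θ => ∏ k ∈ Finset.range p,
      G (Complex.exp (Complex.I * (θ + y * Complex.I + 2 * Real.pi * k) / p))) m := by
  let t : ℕ → ℝ → ℂ := fun k θ =>
    Complex.exp (Complex.I * (θ + y * Complex.I + 2 * Real.pi * k) / p)
  let h : ℕ → ℝ → ℂ := fun k θ =>
    m * (Complex.I * (θ + y * Complex.I + 2 * Real.pi * k) / p) + L (t k θ)
  have ht : ∀ k θ, t k θ ∈ Metric.ball (0 : ℂ) R := by
    intro k θ
    rw [mem_ball_zero_iff, norm_exp_I_mul_div]
    convert hy using 3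
    have := im_add_two_pi_int (θ + y * Complex.I) k
    rw [Int.cast_natCast] at this
    rw [this, IsUniformization.im_line]
  have htc : ∀ k, Continuous (t k) := fun k => by fun_prop
  have hc : ∀ k, Continuous (h k) := by
    intro k
    refine Continuous.add (by fun_prop) ?_
    exact hL.continuousOn.comp_continuous (htc k) (ht k)
  have hGh : ∀ θ, ∏ k ∈ Finset.range p, G (t k θ) =
      Complex.exp (∑ k ∈ Finset.range p, h k θ) := by
    intro θ
    rw [Complex.exp_sum]
    refine Finset.prod_congr rfl fun k _ => ?_
    rw [hG _ (ht k θ) (Complex.exp_ne_zero _), Complex.exp_add, Complex.exp_nat_mul]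
  -- One turn of `z` carries the `k`-th value of `t` to the next one, so the increment of the total
  -- logarithm telescopes to `h p 0 - h 0 0`, which is `2πm I`.
  have hshift : ∀ k, h k (2 * Real.pi) = h (k + 1) 0 := by
    intro k
    have : ((2 * Real.pi : ℝ) : ℂ) + y * Complex.I + 2 * Real.pi * k =
        ((0 : ℝ) : ℂ) + y * Complex.I + 2 * Real.pi * ((k + 1 : ℕ) : ℂ) := by
      push_cast
      ring
    simp only [h, t, this]
  refine ⟨fun θ => (∑ k ∈ Finset.range p, h k θ).im,
    Complex.continuous_im.comp (continuous_finsetSum _ fun k _ => hc k), fun θ => ?_, ?_⟩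
  · change ∏ k ∈ Finset.range p, G (t k θ) ≠ 0 ∧ ∏ k ∈ Finset.range p, G (t k θ) =
      ‖∏ k ∈ Finset.range p, G (t k θ)‖ * _
    rw [hGh]
    exact ⟨Complex.exp_ne_zero _, exp_eq_norm_mul_exp _⟩
  · have hpC : (p : ℂ) ≠ 0 := by exact_mod_cast hp.ne'
    simp only [hshift]
    rw [← Complex.sub_im, ← Finset.sum_sub_distrib, Finset.sum_range_sub (fun k => h k 0)]
    have h1 : t p 0 = t 0 0 := by
      simp only [t]
      rw [exp_I_mul_add_div _ hp]
      simp
    have h2 : h p 0 - h 0 0 = ((2 * Real.pi * m : ℝ) : ℂ) * Complex.I := by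
      simp only [h, h1]
      push_cast
      field_simp
      ring
    rw [h2, Complex.im_ofReal_mul, Complex.I_im, mul_one, Int.cast_natCast]

namespace IsUniformization

variable {f : ℂ[X][Y]} {δ c : ℝ} {w : Fin n → ℂ → ℂ} {π : Equiv.Perm (Fin n)}

theorem sheets_exp (U : IsUniformization f δ c w π) {ε : ℝ} {q : ℕ} (hq : 0 < q) {β : ℂ → ℂ}
    {j : Fin n} (h : ∀ τ : ℂ, -Real.log ε ≤ τ.im → β (Complex.exp (Complex.I * τ / q)) = w j τ)
    {τ : ℂ} (hτ : -Real.log ε ≤ τ.im) : sheets q β (Complex.exp (Complex.I * τ)) =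
      (Multiset.range q).map fun k => w ((π ^ k) j) τ := by
  rw [sheets, nthRoots_exp hq, Multiset.map_map]
  refine Multiset.map_congr rfl fun k _ => ?_
  have := im_add_two_pi_int τ k
  rw [Int.cast_natCast] at this
  rw [Function.comp_apply, h _ (by rwa [this]), U.period_pow]

theorem pow_apply_eq_self (U : IsUniformization f δ c w π) {y : ℝ} (hy : c < y) {q : ℕ}
    (hq : 0 < q) {β : ℂ → ℂ} {j : Fin n}
    (h : ∀ τ : ℂ, y ≤ τ.im → β (Complex.exp (Complex.I * τ / q)) = w j τ) : (π ^ q) j = j := by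
  have him : y ≤ ((y : ℂ) * Complex.I).im := by simp
  have h1 := im_add_two_pi_int (y * Complex.I) q
  rw [Int.cast_natCast] at h1
  refine U.injective (y * Complex.I) (hy.trans_le him) ?_
  simp only
  rw [← U.period_pow, ← h _ (by rwa [h1]), exp_I_mul_add_div _ hq, h _ him]

/-- The product `W` is the equation of the second branch along the first, lifted to the half plane.
As a function of `t = exp (I τ / p)` it is `t ^ m * exp (L t)`, and the same `m` is its order at `0`
and the total winding number. -/
theorem exists_hasLinkingNumber (U : IsUniformization f δ c w π) (hδ : 0 < δ) {ε : ℝ} (hε : 0 < ε)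
    (hεc : ε < Real.exp (-c)) {p q : ℕ} {α β : ℂ → ℂ} (hα : IsBranch f ε p α)
    (hβ : IsBranch f ε q β) (hne : branchKnot ε p α ≠ branchKnot ε q β) :
    ∃ m : ℕ, 0 < m ∧ intersectionNumber p α q β = m ∧
      HasLinkingNumber ε (sheets p α) (sheets q β) m := by
  have hc := lt_neg_log hε hεc
  obtain ⟨i, hi⟩ := U.exists_eq_of_isBranch hδ hε hεc hα
  obtain ⟨j, hj⟩ := U.exists_eq_of_isBranch hδ hε hεc hβ
  rw [branchKnot_eq_lineKnot hε hα.pos hi, branchKnot_eq_lineKnot hε hβ.pos hj] at hne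
  -- Distinct knots mean that `i` is not in the cycle of `j`, so no factor of `W` vanishes.
  have hij : ∀ k : ℕ, i ≠ (π ^ k) j := fun k h => hne (by
    rw [h, ← zpow_natCast, U.lineKnot_zpow])
  have hpi := U.pow_apply_eq_self hc hα.pos hi
  have hqj := U.pow_apply_eq_self hc hβ.pos hj
  have hqj' : ∀ k, (π ^ (k + q)) j = (π ^ k) j := fun k => by
    rw [pow_add, Equiv.Perm.mul_apply, hqj]
  -- the equation of the second branch along the first one
  let W : ℂ → ℂ := fun τ => ∏ k ∈ Finset.range q, (w i τ - w ((π ^ k) j) τ)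
  have hWshift : ∀ (m : ℕ) τ, W (τ + 2 * Real.pi * m) =
      ∏ k ∈ Finset.range q, (w ((π ^ m) i) τ - w ((π ^ k) j) τ) := by
    intro m τ
    rw [← prod_range_add_of_periodic (fun k => by rw [hqj']) m]
    simp only [W, U.period_pow, pow_add, Equiv.Perm.mul_apply]
  have hWd : ∀ τ : ℂ, c < τ.im → DifferentiableAt ℂ W τ := fun τ hτ =>
    DifferentiableAt.fun_finsetProd fun k _ =>
      (U.differentiableAt i τ hτ).sub (U.differentiableAt _ τ hτ)
  have hWper : ∀ τ, W (τ + 2 * Real.pi * p) = W τ := fun τ => by rw [hWshift, hpi]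
  have hWlim : Filter.Tendsto W (Filter.comap Complex.im Filter.atTop) (nhds 0) := by
    have := tendsto_finsetProd (Finset.range q) fun k _ =>
      (U.tendsto_zero i).sub (U.tendsto_zero ((π ^ k) j))
    simpa [hβ.pos.ne'] using this
  have hWne : ∀ τ : ℂ, c < τ.im → W τ ≠ 0 := fun τ hτ =>
    Finset.prod_ne_zero_iff.2 fun k _ h => hij k (U.injective τ hτ (sub_eq_zero.1 h))
  obtain ⟨G, hGd, hG0, hGW⟩ := exists_eq_comp_exp hα.pos hWd hWper hWlim
  have hGne : ∀ t ∈ Metric.ball (0 : ℂ) (Real.exp (-c / p)), t ≠ 0 → G t ≠ 0 := by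
    intro t ht ht0
    obtain ⟨τ, rfl, -⟩ := exists_exp_I_mul_div_eq ht0 hα.pos
    rw [hGW]
    refine hWne τ ?_
    rw [mem_ball_zero_iff, norm_exp_I_mul_div, Real.exp_lt_exp,
      div_lt_div_iff_of_pos_right (by exact_mod_cast hα.pos)] at ht
    linarith
  obtain ⟨m, hm, hord, L, hL, hGL⟩ := exists_eq_pow_mul_exp (Real.exp_pos _) hGd hG0 hGne
  refine ⟨m, hm, ?_, ?_⟩
  · rw [← hord]
    apply analyticOrderAt_congr
    have hcont : ContinuousAt (fun t : ℂ => ‖t‖ ^ p) 0 := by fun_prop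
    have hsmall : ∀ᶠ t in nhds (0 : ℂ), ‖t‖ ^ p < ε :=
      hcont.eventually (gt_mem_nhds (by simpa [hα.pos.ne'] using hε))
    filter_upwards [hsmall] with t ht
    by_cases ht0 : t = 0
    · rw [ht0, hG0, zero_pow hα.pos.ne', sheets, nthRoots_zero_right, Multiset.map_replicate,
        hβ.origin, hα.origin, Multiset.map_replicate, Multiset.prod_replicate, sub_zero,
        zero_pow hβ.pos.ne']
    · obtain ⟨τ, rfl, hτ⟩ := exists_exp_I_mul_div_eq_of_norm_pow_le ht0 hα.pos ht.le
      rw [exp_I_mul_div_pow τ hα.pos, U.sheets_exp hβ.pos hj hτ, hi τ hτ, hGW, Multiset.map_map,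
        prod_multiset_range]
      rfl
  · unfold HasLinkingNumber
    have hwind := hasWindingNumber_prod hα.pos (y := -Real.log ε) hL (by
      rw [Real.exp_lt_exp]
      have : (0 : ℝ) < p := by exact_mod_cast hα.pos
      gcongr) fun t ht _ => hGL t ht
    convert hwind using 2 with θ
    have him : -Real.log ε ≤ ((θ : ℂ) + (-Real.log ε : ℝ) * Complex.I).im := (im_line _ _).ge
    rw [ofReal_mul_exp_eq hε, U.sheets_exp hα.pos hi him, U.sheets_exp hβ.pos hj him,
      Multiset.map_map, prod_multiset_range]
    refine Finset.prod_congr rfl fun k _ => ?_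
    -- A shift by `2πk` moves `i` along its cycle and only permutes the factors that belong to `j`.
    -- So the product of the shifted values of `G` is the double product over both branches.
    rw [Function.comp_apply, hGW, hWshift, Multiset.map_map, prod_multiset_range]
    rfl

end IsUniformization

end BraidLink

end

/-! ### Assembly of the theorem from one uniformization -/

theorem mainTheorem1 (f : ℂ[X][Y]) (hsq : Squarefree f) (hz : ¬ ((C X : ℂ[X][Y]) ∣ f))
    (h0 : f.evalEval 0 0 = 0)
    (n : ℕ) (hn : n = (f.map (evalRingHom (0 : ℂ))).rootMultiplicity 0) :
    0 < n ∧
    ∃ δ₀ : ℝ, 0 < δ₀ ∧ ∀ δ : ℝ, 0 < δ → δ ≤ δ₀ →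
    ∃ ε₀ : ℝ, 0 < ε₀ ∧ ∀ ε : ℝ, 0 < ε → ε ≤ ε₀ →
    ∃ F : ℂ → BraidLink.UnorderedTuples n,
      -- `F` is the `n`-valued analytic function `z ↦ {w : f(z, w) = 0}` near the origin
      (∀ z : ℂ, ‖z‖ ≤ ε → (F z).toMultiset = BraidLink.localRoots f δ z) ∧
      ContinuousOn F (Metric.closedBall 0 ε) ∧
      BraidLink.IsAnalyticMultivaluedOn F (Metric.ball 0 ε) ∧
      (F 0).toMultiset = Multiset.replicate n 0 ∧
      (∀ z : ℂ, ‖z‖ ≤ ε → z ≠ 0 → F z ∉ BraidLink.discriminantLocus n) ∧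
      -- its graph over `|z| = ε` is the link of the singularity
      BraidLink.singularityLink f ε δ = {x : ℂ × ℂ | ‖x.1‖ = ε ∧ x.2 ∈ (F x.1).toMultiset} ∧
      -- `d arg (w_i - w_j) / d arg z > 0` for `0 < |z| ≤ ε`
      (∀ r : ℝ, 0 < r → r ≤ ε → ∃ w : Fin n → ℝ → ℂ,
        (∀ i, Continuous (w i)) ∧
        (∀ θ : ℝ, F (r * Complex.exp (θ * Complex.I)) = BraidLink.ofTuple (fun i => w i θ)) ∧
        ∀ i j : Fin n, i ≠ j → ∃ φ : ℝ → ℝ, ∀ θ : ℝ,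
          w i θ ≠ w j θ ∧
          w i θ - w j θ = ‖w i θ - w j θ‖ * Complex.exp (φ θ * Complex.I) ∧
          ∃ d : ℝ, 0 < d ∧ HasDerivAt φ d θ) ∧
      -- the link is a strictly positive closed braid
      (∃ (p : BraidLink.Conf n) (l : Path p p),
        (∀ t : unitInterval,
          (l t).1 = F (ε * Complex.exp (2 * Real.pi * (t : ℝ) * Complex.I))) ∧
        ∃ β : BraidLink.BraidGroup n, BraidLink.IsPositive β ∧ BraidLink.IsStrictlyPositive β ∧
          BraidLink.IsClosureOf l β) ∧
      -- the components of the link are the knots of the branches; the linking number of two of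
      -- them is the intersection number of the branches, and is positive
      (∀ x ∈ BraidLink.singularityLink f ε δ, ∃ (p : ℕ) (α : ℂ → ℂ),
        BraidLink.IsBranch f ε p α ∧
        connectedComponentIn (BraidLink.singularityLink f ε δ) x =
          BraidLink.branchKnot ε p α) ∧
      (∀ (p q : ℕ) (α β : ℂ → ℂ), BraidLink.IsBranch f ε p α → BraidLink.IsBranch f ε q β →
        BraidLink.branchKnot ε p α ≠ BraidLink.branchKnot ε q β →
        ∃ m : ℕ, 0 < m ∧ BraidLink.intersectionNumber p α q β = m ∧
          BraidLink.HasLinkingNumber ε (BraidLink.sheets p α) (BraidLink.sheets q β) m) := by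
  have hn0 : 0 < n := by
    rw [hn, rootMultiplicity_pos (BraidLink.map_evalRingHom_zero_ne_zero hz), IsRoot,
      map_evalRingHom_eval, h0]
  refine ⟨hn0, ?_⟩
  obtain ⟨δ₀, hδ₀, H⟩ := BraidLink.exists_isUniformization hsq hz hn
  refine ⟨δ₀, hδ₀, fun δ hδ hδle => ?_⟩
  obtain ⟨c, w, π, U⟩ := H δ hδ hδle
  obtain ⟨c₁, hc₁, hturn⟩ := U.exists_turning
  -- The circle `|z| = r` is the line `Im τ = -log r`, which lies at height `c₁` or above exactly
  -- when `r ≤ exp (-c₁)`.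
  refine ⟨Real.exp (-c₁), Real.exp_pos _, fun ε hε hεle => ?_⟩
  have hlog : ∀ r : ℝ, 0 < r → r ≤ ε → c₁ ≤ -Real.log r := fun r hr hrε => by
    have := (Real.log_le_iff_le_exp hr).2 (hrε.trans hεle)
    linarith
  have hεc : ε < Real.exp (-c) := hεle.trans_lt (Real.exp_lt_exp.2 (neg_lt_neg hc₁))
  refine ⟨BraidLink.rootFunction f δ n,
    fun z hz => U.toMultiset_rootFunction (hz.trans_lt hεc),
    fun z hz => (U.continuousAt_rootFunction
      ((mem_closedBall_zero_iff.1 hz).trans_lt hεc)).continuousWithinAt,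
    fun k => (U.isAnalyticMultivaluedOn k).mono (Metric.ball_subset_ball hεc.le),
    by rw [U.rootFunction_zero, BraidLink.ofTuple_zero_toMultiset],
    fun z hz hz0 => U.rootFunction_notMem_discriminantLocus hz0 (hz.trans_lt hεc),
    U.singularityLink_eq hδ hε hεc, fun r hr hrε => ?_,
    U.exists_closedBraid hε hεc (U.isTurning (hc₁.trans_le (hlog ε hε le_rfl))
      (hturn _ (hlog ε hε le_rfl))),
    fun x hx => U.exists_isBranch_connectedComponentIn_eq hδ hε hεc hx,
    fun p q α β hα hβ hne => U.exists_hasLinkingNumber hδ hε hεc hα hβ hne⟩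
  have hc := hc₁.trans_le (hlog r hr hrε)
  refine ⟨fun i θ => w i (θ + (-Real.log r : ℝ) * Complex.I), U.continuous_line hc,
    fun θ => ?_, fun i j hij => ?_⟩
  · rw [BraidLink.ofReal_mul_exp_eq hr, U.rootFunction_exp]
    rwa [BraidLink.IsUniformization.im_line]
  · obtain ⟨φ, -, hφ⟩ := hturn _ (hlog r hr hrε) i j hij
    exact ⟨φ, fun θ => ⟨fun h => hij (U.injective _
      (by rwa [BraidLink.IsUniformization.im_line]) h), hφ θ⟩⟩
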